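/- Let $V$ and $W$ be real functions, analytic near $0$, vanishing at $0$ with a nondegenerate minimum there, $V(x)=\sum_{\mu\ge2}\frac{v_\mu}{\mu}x^\mu$, $W(x)=\sum_{\mu\ge2}\frac{\phi_\mu}{\mu}x^\mu$, $v_2,\phi_2>0$. For even $N\ge 2$ consider the periodic lattice ($x_{j+N}=x_j$) with Hamiltonian $H=\sum_{j=1}^N\left[\frac12p_j^2+V(x_j)+W(x_{j+1}-x_j)\right]$. The in-phase mode is the family of motions $x_j(t)=Q_\varepsilon(t)$ (all $j$) of small energy density $\varepsilon>0$, where $\ddot Q_\varepsilon+V'(Q_\varepsilon)=0$, $\frac12\dot Q_\varepsilon^2+V(Q_\varepsilon)=\varepsilon$, $Q_\varepsilon(0)>0=\dot Q_\varepsilon(0)$, $Q_\varepsilon$ has least period $2\pi/\omega_0(\varepsilon)$, and $Q_\varepsilon\to0$ uniformly as $\varepsilon\to0$. Such a family exists for all sufficiently small $\varepsilon$, and these are lattice motions of total energy $N\varepsilon$. Assume that the mode is isochronous up to order $n\ge1$: with $\omega_{0,0}^2=v_2$, $$\omega_0(\varepsilon)^2=\omega_{0,0}^2+\gamma_{0,n}\varepsilon^n+o(\varepsilon^n)\quad(\varepsilon\to0^+),\qquad\gamma_{0,n}\ne0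 .$$ (1) Put $X=(2\varepsilon/v_2)^{1/2}$, $\tau=\omega_0(\varepsilon)t$, $\tilde T(X)=\sqrt{v_2}/\omega_0(\varepsilon)$, $Q_0(X,\tau)=Q_\varepsilon(t)$. Then $\tilde T(X)=1+\tilde T_{2n}X^{2n}+o(X^{2n})$ with $\gamma_{0,n}=-2v_2(2/v_2)^n\,\tilde T_{2n}$. Consider the Hill equation $$\frac{\partial^2\eta}{\partial\tau^2}+\tilde T(X)^2\left[\frac{V''(Q_0(X,\tau))}{v_2}-\Delta\right]\eta=0 .$$ There are $X_0,\delta_0>0$ and a continuous function $\Delta_s$ on $(0,X_0)$ with $|\Delta_s|<\delta_0$ and $\Delta_s(X)\to0$ as $X\to0^+$ such that, for $0<X<X_0$ and $|\Delta|<\delta_0$: the equation has a nonzero even $2\pi$-periodic solution if and only if $\Delta=\Delta_s(X)$; it has an unbounded solution if $\Delta$ lies strictly between $0$ and $\Delta_s(X)$; all its solutions are bounded if $\Delta$ lies outside the closed interval with end points $0$ and $\Delta_s(X)$. The even periodic solutions on the curve can be normalized so as to tend to $\cos\tau$ uniformly as $X\to0^+$. This symmetric transition curve satisfies $$\Delta_s(X)=-4n\,\tilde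 T_{2n}X^{2n}+o(X^{2n})\quad(X\to0^+).$$ (2) For an integer $l$ not divisible by $N$, a perturbation of wave number $q=2\pi l/N$ is a solution $\xi_j(t)=e^{-iqj}\eta(t)$ of the variational equations of the lattice along the in-phase mode; the mode is $q$-stable at energy density $\varepsilon$ if all of these are bounded. Call $\varepsilon$ a tangent bifurcation energy density for $q$ if at $\varepsilon$ some nonzero such perturbation has the period $2\pi/\omega_0(\varepsilon)$ of the mode, and the mode is $q$-stable just below $\varepsilon$ and not $q$-stable just above. There are $r,\kappa_0>0$, depending only on $V$ and the family (not on $W$, $N$, $l$), such that the following holds for all $W$, $N$, $l$ as above with $\kappa:=\phi_2\sin^2(\pi l/N)<\kappa_0$. If $\gamma_{0,n}<0$, there is exactly one tangent bifurcation energy density for $q$ in $(0,r)$. It equals $E(\kappa)$ with a strictly increasing function $E$ independent of $W,N,l$ (so that the smallest wave number $q_c=2\pi/N$ bifurcates first), and $$E(\kappa)\sim\left(\frac{-2\kappa}{n\,\gamma_{0,n}}\right)^{1/n}\quad(\kappa\to0^+).$$ The mode is $q$-stable for $0<\varepsilon<E(\kappa)$ and not $q$-stable for $E(\kappa)<\varepsilon<r$.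 For $l=1$, i.e. $q=q_c$, the leading-order tangent bifurcation energy density is therefore $$\varepsilon_0^{(n)}=\left(\frac{-2\phi_2\sin^2(\pi/N)}{n\,\gamma_{0,n}}\right)^{1/n},$$ in particular as $N\to\infty$ with $W$ fixed. If $\gamma_{0,n}>0$, then for every $\varepsilon\in(0,r)$ the mode is $q$-stable and no nonzero perturbation of wave number $q$ has the period of the mode; there is no tangent bifurcation energy density for $q$ in $(0,r)$. (3) If $n=1$, then $\gamma_{0,1}=\frac{3v_4}{2v_2}-\frac{5v_3^2}{3v_2^2}$, and the leading-order formula becomes $$\varepsilon_0^{(1)}=\frac{12\,\phi_2v_2^2\sin^2(\pi/N)}{10v_3^2-9v_2v_4}.$$ -/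

import Mathlib

open Real Set Filter Topology Asymptotics

noncomputable section

/-- Admissible (onsite or interaction) potentials: analytic at `0`, where they vanish and have a
nondegenerate minimum. -/
structure IsPotential (U : ℝ → ℝ) : Prop where
  analytic : AnalyticAt ℝ U 0
  zero : U 0 = 0
  critical : deriv U 0 = 0
  pos : 0 < iteratedDeriv 2 U 0

/-- The coefficients `u_μ` in the expansion `U(x) = ∑_{μ ≥ 2} u_μ x ^ μ / μ`. -/
def potCoeff (U : ℝ → ℝ) (μ : ℕ) : ℝ :=
  iteratedDeriv μ U 0 / (Nat.factorial (μ - 1) : ℝ)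

/-! ### The lattice -/

/-- Motions of the lattice of `N` sites with Hamiltonian
`∑ (p_j ^ 2 / 2 + V (x_j) + W (x_{j+1} - x_j))` and periodic boundary conditions. -/
def IsLatticeMotion (V W : ℝ → ℝ) (N : ℕ) (x : ℤ → ℝ → ℝ) : Prop :=
  (∀ j : ℤ, x (j + N) = x j) ∧
  ∀ (j : ℤ) (t : ℝ),
    HasDerivAt (x j) (deriv (x j) t) t ∧
    HasDerivAt (deriv (x j))
      (-deriv V (x j t) - deriv W (x j t - x (j - 1) t) + deriv W (x (j + 1) t - x j t)) t

/-- The total energy at time `t`. -/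
def latticeEnergy (V W : ℝ → ℝ) (N : ℕ) (x : ℤ → ℝ → ℝ) (t : ℝ) : ℝ :=
  ∑ j ∈ Finset.Icc (1 : ℤ) (N : ℤ),
    (deriv (x j) t ^ 2 / 2 + V (x j t) + W (x (j + 1) t - x j t))

/-- Solutions `ξ` of the variational (linearised) equations along `x`. -/
def IsVariation (V W : ℝ → ℝ) (N : ℕ) (x : ℤ → ℝ → ℝ) (ξ : ℤ → ℝ → ℂ) : Prop :=
  (∀ j : ℤ, ξ (j + N) = ξ j) ∧
  ∀ (j : ℤ) (t : ℝ),
    HasDerivAt (ξ j) (deriv (ξ j) t) t ∧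
    HasDerivAt (deriv (ξ j))
      (-((iteratedDeriv 2 V (x j t) : ℝ) : ℂ) * ξ j t
        - ((iteratedDeriv 2 W (x j t - x (j - 1) t) : ℝ) : ℂ) * (ξ j t - ξ (j - 1) t)
        + ((iteratedDeriv 2 W (x (j + 1) t - x j t) : ℝ) : ℂ) * (ξ (j + 1) t - ξ j t)) t

/-- `η` is the amplitude of a perturbation of `x` with wave number `q = 2 π l / N`, that is,
`ξ_j (t) = exp (- i q j) η (t)` solves the variational equations along `x`. -/
def IsModePerturbation (V W : ℝ → ℝ) (N : ℕ) (l : ℤ) (x : ℤ → ℝ → ℝ) (η : ℝ → ℂ) : Prop :=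
  IsVariation V W N x
    (fun j t => Complex.exp (-(Complex.I * ((2 * π * (l : ℝ) / (N : ℝ) * (j : ℝ) : ℝ) : ℂ))) * η t)

/-! ### The in-phase mode -/

/-- The low-energy in-phase mode: for `0 < ε < ε₀`, `Q ε` is the oscillation of energy `ε` in the
potential `V`, with a positive turning point at time `0`, least period `2 π / ω ε`, and amplitude
tending to `0` with the energy. All sites of the lattice move according to `Q ε`. -/
structure IsInPhaseMode (V : ℝ → ℝ) (ε₀ : ℝ) (Q : ℝ → ℝ → ℝ) (ω : ℝ → ℝ) : Prop where
  pos : 0 < ε₀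
  motion : ∀ ε ∈ Ioo 0 ε₀, ∀ t : ℝ,
    HasDerivAt (Q ε) (deriv (Q ε) t) t ∧ HasDerivAt (deriv (Q ε)) (-deriv V (Q ε t)) t
  energy : ∀ ε ∈ Ioo 0 ε₀, ∀ t : ℝ, deriv (Q ε) t ^ 2 / 2 + V (Q ε t) = ε
  turning : ∀ ε ∈ Ioo 0 ε₀, 0 < Q ε 0 ∧ deriv (Q ε) 0 = 0
  freq_pos : ∀ ε ∈ Ioo 0 ε₀, 0 < ω ε
  periodic : ∀ ε ∈ Ioo 0 ε₀, Function.Periodic (Q ε) (2 * π / ω ε)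
  minimal : ∀ ε ∈ Ioo 0 ε₀, ∀ T : ℝ, 0 < T → Function.Periodic (Q ε) T → 2 * π / ω ε ≤ T
  small : TendstoUniformly Q (fun _ => 0) (𝓝[>] 0)

/-- The mode with frequency `ω` is isochronous up to order `n`:
`ω ^ 2 = ω_{0,0} ^ 2 + γ ε ^ n + o (ε ^ n)` with `n ≥ 1`, `γ ≠ 0` and `ω_{0,0} ^ 2 = v_2`. -/
def IsIsochronousUpTo (V : ℝ → ℝ) (ω : ℝ → ℝ) (n : ℕ) (γ : ℝ) : Prop :=
  1 ≤ n ∧ γ ≠ 0 ∧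
    (fun ε : ℝ => ω ε ^ 2 - (potCoeff V 2 + γ * ε ^ n)) =o[𝓝[>] 0] (fun ε : ℝ => ε ^ n)

/-! ### Stability of the in-phase mode and tangent bifurcation -/

/-- All perturbations of the in-phase mode `Qε` with wave number `2 π l / N` are bounded. -/
def IsStableMode (V W : ℝ → ℝ) (N : ℕ) (l : ℤ) (Qε : ℝ → ℝ) : Prop :=
  ∀ η : ℝ → ℂ, IsModePerturbation V W N l (fun _ => Qε) η → ∃ C : ℝ, ∀ t, ‖η t‖ ≤ C

/-- Some nonzero perturbation of `Qε` with wave number `2 π l / N` is `T`-periodic. -/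
def HasPeriodicPerturbation (V W : ℝ → ℝ) (N : ℕ) (l : ℤ) (Qε : ℝ → ℝ) (T : ℝ) : Prop :=
  ∃ η : ℝ → ℂ, η ≠ 0 ∧ IsModePerturbation V W N l (fun _ => Qε) η ∧ Function.Periodic η T

/-- `e` is an energy density at which the in-phase mode undergoes a tangent bifurcation through
the perturbations with wave number `2 π l / N`: one of these has the period of the mode itself,
and the mode turns, as the energy increases through `e`, from stable to unstable with respect to
them. -/
def IsTangentBifurcationEnergy (V W : ℝ → ℝ) (N : ℕ) (l : ℤ) (Q : ℝ → ℝ → ℝ) (ω : ℝ → ℝ)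
    (e : ℝ) : Prop :=
  HasPeriodicPerturbation V W N l (Q e) (2 * π / ω e) ∧
  (∀ᶠ e' in 𝓝[<] e, IsStableMode V W N l (Q e')) ∧
  (∀ᶠ e' in 𝓝[>] e, ¬ IsStableMode V W N l (Q e'))

/-! ### The dimensionless Hill equation and its symmetric transition curve -/

/-- The energy `ε` with `X = (2 ε / v_2) ^ (1 / 2)`. -/
def energyOf (V : ℝ → ℝ) (X : ℝ) : ℝ := potCoeff V 2 * X ^ 2 / 2

/-- The dimensionless period `T̃(X) = T(ε) √v_2 / (2 π)`, where `T(ε) = 2 π / ω(ε)`. -/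
def scaledPeriod (V : ℝ → ℝ) (ω : ℝ → ℝ) (X : ℝ) : ℝ :=
  (2 * π / ω (energyOf V X)) * √(potCoeff V 2) / (2 * π)

/-- The orbit as a function `Q₀(X, τ)` of the dimensionless time `τ = ω(ε) t`. -/
def scaledOrbit (V : ℝ → ℝ) (Q : ℝ → ℝ → ℝ) (ω : ℝ → ℝ) (X τ : ℝ) : ℝ :=
  Q (energyOf V X) (τ / ω (energyOf V X))

/-- `η'' + T̃(X) ^ 2 (V''(Q₀(X, τ)) / v_2 - Δ) η = 0`. -/
def IsHillSolution (V : ℝ → ℝ) (Q : ℝ → ℝ → ℝ) (ω : ℝ → ℝ) (X Δ : ℝ) (η : ℝ → ℝ) : Prop :=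
  ∀ τ : ℝ, HasDerivAt η (deriv η τ) τ ∧
    HasDerivAt (deriv η)
      (-(scaledPeriod V ω X ^ 2 *
        (iteratedDeriv 2 V (scaledOrbit V Q ω X τ) / potCoeff V 2 - Δ) * η τ)) τ

/-- All solutions of the Hill equation with parameters `X`, `Δ` are bounded. -/
def IsHillStable (V : ℝ → ℝ) (Q : ℝ → ℝ → ℝ) (ω : ℝ → ℝ) (X Δ : ℝ) : Prop :=
  ∀ η : ℝ → ℝ, IsHillSolution V Q ω X Δ η → ∃ C : ℝ, ∀ τ, |η τ| ≤ C

/-- `Δs` is, for `0 < X < X₀` and inside the window `|Δ| < δ₀`, the symmetric transition curve of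
the first instability zone, which issues from `X = 0`, `Δ = 0`. -/
structure IsSymmetricTransitionCurve (V : ℝ → ℝ) (Q : ℝ → ℝ → ℝ) (ω : ℝ → ℝ)
    (X₀ δ₀ : ℝ) (Δs : ℝ → ℝ) : Prop where
  X₀_pos : 0 < X₀
  δ₀_pos : 0 < δ₀
  mem : ∀ X ∈ Ioo 0 X₀, |Δs X| < δ₀
  continuousOn : ContinuousOn Δs (Ioo 0 X₀)
  tendsto_zero : Tendsto Δs (𝓝[>] 0) (𝓝 0)
  /-- The curve consists of the parameters at which a nonzero time-reversal symmetric solution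
  with the period of the mode exists. -/
  eigenvalue : ∀ X ∈ Ioo 0 X₀, ∀ Δ : ℝ, |Δ| < δ₀ →
    ((∃ η : ℝ → ℝ, η ≠ 0 ∧ IsHillSolution V Q ω X Δ η ∧ (∀ τ, η (-τ) = η τ) ∧
      Function.Periodic η (2 * π)) ↔ Δ = Δs X)
  /-- First zone: the eigenfunctions tend to `cos τ`, so that all of their Fourier coefficients
  except those of index `1` and `-1` vanish in the limit of zero energy. -/
  eigenfunction : ∃ ηs : ℝ → ℝ → ℝ,
    (∀ X ∈ Ioo 0 X₀, ηs X ≠ 0 ∧ IsHillSolution V Q ω X (Δs X) (ηs X) ∧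
      (∀ τ, ηs X (-τ) = ηs X τ) ∧ Function.Periodic (ηs X) (2 * π)) ∧
    TendstoUniformly ηs Real.cos (𝓝[>] 0)
  /-- The instability zone lies between the curve and the line `Δ = 0`. -/
  unstable : ∀ X ∈ Ioo 0 X₀, ∀ Δ : ℝ,
    min 0 (Δs X) < Δ → Δ < max 0 (Δs X) → ¬ IsHillStable V Q ω X Δ
  stable : ∀ X ∈ Ioo 0 X₀, ∀ Δ : ℝ, |Δ| < δ₀ →
    (Δ < min 0 (Δs X) ∨ max 0 (Δs X) < Δ) → IsHillStable V Q ω X Δ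

/-- The small parameter `φ_2 sin ^ 2 (q / 2)` for the wave number `q = 2 π l / N`. -/
def couplingParam (W : ℝ → ℝ) (N : ℕ) (l : ℤ) : ℝ :=
  potCoeff W 2 * Real.sin (π * (l : ℝ) / (N : ℝ)) ^ 2

end

noncomputable section

/-! ### Planar linear Hamiltonian systems -/

/-! The potential is straightened by an analytic coordinate `g` with `V (g u) = u ^ 2 / 2`. The
orbit of energy `A ^ 2 / 2` is then `g (A cos θ)` with velocity `-A sin θ`, and its phase obeys
`dt/dθ = G (A cos θ)` with `G = g'`. In the variable `θ`, Hill's equation `η'' + (V''(Q) + 4 κ) η =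
0` becomes a planar linear system whose coefficients are even and have period `2 π` for every
amplitude, so amplitude and coupling enter only as parameters of the coefficients.

For even coefficients the monodromy matrix is determined by the values at `π` of the solutions `c`,
`s` with initial values `(1, 0)`, `(0, 1)`: its trace is `2 + 4 c₂(π) s₁(π)`. Stability is therefore
decided by the sign of the product `c₂(π) s₁(π)`, called `closing`, as long as it exceeds `-1`.
Lagrange's identity over half a period turns a change of `κ` into a multiple of an integral that is
positive near `A = κ = 0`. Hence `s₁(π) = -m' κ` and `c₂(π) = m (κ - κs A)` with `m, m' > 0`, so
`closing = -m m' κ (κ - κs A)`. The mode is unstable exactly for `κ` strictly between `0` and `κs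
A`, and an even periodic solution exists exactly at `κ = κs A` (`exists_transition`,
`hill_dichotomy`).

It remains to find `κs`. At `κ = 0` Hill's equation is the variational equation of the orbit, solved
by the derivatives of the orbit in time and in amplitude. The second gives `c₂(π) = -A τ'(A) / (G(A)
G(-A))`, where `τ` is the half period. As `τ` is analytic, isochronicity up to order `n` reads `τ(A)
- τ(0) = A ^ (2n) f(A)`, and differentiation produces the factor `2n` behind the `n` of all the
leading-order formulas. One more use of Lagrange's identity, between `0` and `κs`, yields `κs A = A
^ (2n) F(A)` with `F` Lipschitz and `F(0) = -n γ / 2 ^ (n+1)` (`exists_factor`,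
`exists_transition_factor`). A Lipschitz `F` suffices for strict monotonicity near `0`.

Everything else is translation: `A = √v₂ X` and `κ = -v₂ Δ / 4` give the transition curve; `A = √(2
ε)` gives `κs ~ -(n γ / 2) ε ^ n`, whose inverse is the bifurcation energy when `γ < 0`, while for
`γ > 0` it is negative and never meets the coupling. For `n = 1` the coefficient follows from the
Taylor expansion of `V (g u) = u ^ 2 / 2`. -/

/-- Solutions of the planar system `y₁' = a y₂`, `y₂' = - b y₁`. -/
def IsPlanarSol (a b : ℝ → ℝ) (y : ℝ → ℝ × ℝ) : Prop :=
  ∀ θ, HasDerivAt y (a θ * (y θ).2, -(b θ * (y θ).1)) θ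

theorem planarField_lipschitz {p q : ℝ} {M : NNReal} (hp : |p| ≤ M) (hq : |q| ≤ M) :
    LipschitzWith M (fun y : ℝ × ℝ => (p * y.2, -(q * y.1))) := by
  refine LipschitzWith.of_dist_le_mul fun y z => ?_
  simp only [Prod.dist_eq, Real.dist_eq]
  have h1 : |p * y.2 - p * z.2| = |p| * |y.2 - z.2| := by rw [← mul_sub, abs_mul]
  have h2 : |-(q * y.1) - -(q * z.1)| = |q| * |y.1 - z.1| := by
    rw [← abs_mul, ← abs_neg]; congr 1; ring
  rw [h1, h2]
  refine max_le ?_ ?_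
  · exact mul_le_mul hp (le_max_right _ _) (abs_nonneg _) M.2
  · exact mul_le_mul hq (le_max_left _ _) (abs_nonneg _) M.2

theorem IsPlanarSol.ext {a b : ℝ → ℝ} {M : NNReal} (ha : ∀ θ, |a θ| ≤ M) (hb : ∀ θ, |b θ| ≤ M)
    {y z : ℝ → ℝ × ℝ} (hy : IsPlanarSol a b y) (hz : IsPlanarSol a b z) {θ₀ : ℝ}
    (h : y θ₀ = z θ₀) : y = z :=
  ODE_solution_unique_univ (v := fun θ y => (a θ * y.2, -(b θ * y.1))) (s := fun _ => univ)
    (fun θ => (planarField_lipschitz (ha θ) (hb θ)).lipschitzOnWith)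
    (fun θ => ⟨hy θ, trivial⟩) (fun θ => ⟨hz θ, trivial⟩) h

/-- Truncation of the real line to `[-R, R]`. -/
def clampTo (R x : ℝ) : ℝ := max (-R) (min R x)

theorem clampTo_lipschitz (R : ℝ) : LipschitzWith 1 (clampTo R) :=
  (LipschitzWith.id.const_min R).const_max (-R)

theorem abs_clampTo_le {R : ℝ} (hR : 0 ≤ R) (x : ℝ) : |clampTo R x| ≤ R := by
  unfold clampTo; rw [abs_le]
  exact ⟨le_max_left _ _, max_le (by linarith) (min_le_left _ _)⟩

theorem abs_clampTo_le_abs {R : ℝ} (hR : 0 ≤ R) (x : ℝ) : |clampTo R x| ≤ |x| := by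
  simpa [clampTo, Real.dist_eq, hR] using (clampTo_lipschitz R).dist_le_mul x 0

theorem clampTo_eq {R x : ℝ} (h : |x| ≤ R) : clampTo R x = x := by
  rw [abs_le] at h; simp [clampTo, h.1, h.2]

/-- Picard–Lindelöf on a prescribed interval needs a field bounded on the ball that holds the
trajectory. The linear field is truncated at the radius `R` that Grönwall's inequality predicts for
the true solution. Grönwall, applied forwards and, after `θ ↦ -θ`, backwards, keeps the truncated
solution within `R`, so the truncation never acts. -/
theorem exists_planarSol_Icc {a b : ℝ → ℝ} (hac : Continuous a) (hbc : Continuous b) {M : NNReal}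
    (ha : ∀ θ, |a θ| ≤ M) (hb : ∀ θ, |b θ| ≤ M) (y₀ : ℝ × ℝ) (T : ℝ) (hT : 0 ≤ T) :
    ∃ y : ℝ → ℝ × ℝ, y 0 = y₀ ∧ ∀ θ ∈ Icc (-T) T,
      HasDerivWithinAt y (a θ * (y θ).2, -(b θ * (y θ).1)) (Icc (-T) T) θ := by
  set R : ℝ := ‖y₀‖ * exp (M * T) with hRdef
  have hR : 0 ≤ R := by positivity
  set f : ℝ → ℝ × ℝ → ℝ × ℝ := fun θ y => (a θ * clampTo R y.2, -(b θ * clampTo R y.1)) with hf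
  have hlip : ∀ θ, LipschitzWith M (f θ) := by
    intro θ
    have h1 : LipschitzWith 1 (fun y : ℝ × ℝ => (clampTo R y.1, clampTo R y.2)) := by
      have h11 := (clampTo_lipschitz R).comp (LipschitzWith.prod_fst (α := ℝ) (β := ℝ))
      have h12 := (clampTo_lipschitz R).comp (LipschitzWith.prod_snd (α := ℝ) (β := ℝ))
      simpa using h11.prodMk h12
    simpa using! (planarField_lipschitz (ha θ) (hb θ)).comp h1
  have hnorm : ∀ θ y, ‖f θ y‖ ≤ M * R := by
    intro θ y
    refine max_le ?_ ?_
    · simp only [hf, norm_mul, Real.norm_eq_abs]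
      exact mul_le_mul (ha θ) (abs_clampTo_le hR _) (abs_nonneg _) M.2
    · simp only [hf, norm_neg, norm_mul, Real.norm_eq_abs]
      exact mul_le_mul (hb θ) (abs_clampTo_le hR _) (abs_nonneg _) M.2
  have hnorm' : ∀ θ y, ‖f θ y‖ ≤ M * ‖y‖ := by
    intro θ y
    refine max_le ?_ ?_
    · simp only [hf, norm_mul, Real.norm_eq_abs]
      exact mul_le_mul (ha θ) ((abs_clampTo_le_abs hR _).trans (norm_snd_le y)) (abs_nonneg _) M.2
    · simp only [hf, norm_neg, norm_mul, Real.norm_eq_abs]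
      exact mul_le_mul (hb θ) ((abs_clampTo_le_abs hR _).trans (norm_fst_le y)) (abs_nonneg _) M.2
  have h0 : (0 : ℝ) ∈ Icc (-T) T := ⟨by linarith, hT⟩
  have hPL : IsPicardLindelof f (⟨0, h0⟩ : Icc (-T) T) y₀
      (M * ⟨R, hR⟩ * ⟨T, hT⟩) 0 (M * ⟨R, hR⟩) M := by
    refine ⟨fun θ _ => (hlip θ).lipschitzOnWith, fun y _ => ?_, fun θ _ y _ => ?_, ?_⟩
    · exact Continuous.continuousOn (by simp only [hf]; fun_prop)
    · exact hnorm θ y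
    · simp only [sub_zero, zero_sub, neg_neg, max_self, NNReal.coe_zero]
      exact le_rfl
  obtain ⟨y, hy0, hy⟩ := hPL.exists_eq_forall_mem_Icc_hasDerivWithinAt₀
  have hy0' : y 0 = y₀ := hy0
  have hcont : ContinuousOn y (Icc (-T) T) := fun θ hθ => (hy θ hθ).continuousWithinAt
  have hfwd : ∀ θ ∈ Icc 0 T, ‖y θ‖ ≤ gronwallBound ‖y₀‖ M 0 (θ - 0) := by
    refine norm_le_gronwallBound_of_norm_deriv_right_le (f' := fun θ => f θ (y θ))
      (hcont.mono (Icc_subset_Icc (by linarith) le_rfl)) (fun θ hθ => ?_) (by rw [hy0'])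
      (fun θ _ => by simpa using hnorm' θ (y θ))
    have hθ' : θ ∈ Icc (-T) T := ⟨by linarith [hθ.1], hθ.2.le⟩
    exact (hy θ hθ').mono_of_mem_nhdsWithin
      (mem_of_superset (Icc_mem_nhdsGE hθ.2) (Icc_subset_Icc (by linarith [hθ.1]) le_rfl))
  have hbwd : ∀ θ ∈ Icc 0 T, ‖y (-θ)‖ ≤ gronwallBound ‖y₀‖ M 0 (θ - 0) := by
    refine norm_le_gronwallBound_of_norm_deriv_right_le (f := fun θ => y (-θ))
      (f' := fun θ => -f (-θ) (y (-θ)))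
      (hcont.comp continuous_neg.continuousOn (fun θ hθ => ⟨by linarith [hθ.2],
        by linarith [hθ.1]⟩)) (fun θ hθ => ?_) (by simp [hy0'])
      (fun θ _ => by simpa using hnorm' (-θ) (y (-θ)))
    have hθ' : -θ ∈ Icc (-T) T := ⟨by linarith [hθ.2], by linarith [hθ.1]⟩
    have h1 := (hy (-θ) hθ').scomp (h := fun s : ℝ => -s) (s := Icc (-T) T) θ
      (hasDerivWithinAt_neg θ (Icc (-T) T)) (fun s hs => ⟨by linarith [hs.2], by linarith [hs.1]⟩)
    have h2 : HasDerivWithinAt (fun θ => y (-θ)) (-f (-θ) (y (-θ))) (Icc (-T) T) θ := by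
      simpa [Function.comp_def] using! h1
    exact h2.mono_of_mem_nhdsWithin
      (mem_of_superset (Icc_mem_nhdsGE hθ.2) (Icc_subset_Icc (by linarith [hθ.1]) le_rfl))
  have hbound : ∀ θ ∈ Icc (-T) T, ‖y θ‖ ≤ R := by
    intro θ hθ
    have key : ∀ s ∈ Icc 0 T, gronwallBound ‖y₀‖ M 0 (s - 0) ≤ R := by
      intro s hs
      rw [gronwallBound_ε0, sub_zero]
      have : (M : ℝ) * s ≤ M * T := mul_le_mul_of_nonneg_left hs.2 M.2
      exact mul_le_mul_of_nonneg_left (exp_le_exp.2 this) (norm_nonneg _)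
    rcases le_total 0 θ with h | h
    · exact (hfwd θ ⟨h, hθ.2⟩).trans (key θ ⟨h, hθ.2⟩)
    · have hs : -θ ∈ Icc 0 T := ⟨by linarith, by linarith [hθ.1]⟩
      simpa using (hbwd (-θ) hs).trans (key _ hs)
  refine ⟨y, hy0', fun θ hθ => ?_⟩
  have h1 := hy θ hθ
  have e1 : clampTo R (y θ).1 = (y θ).1 := clampTo_eq ((norm_fst_le (y θ)).trans (hbound θ hθ))
  have e2 : clampTo R (y θ).2 = (y θ).2 := clampTo_eq ((norm_snd_le (y θ)).trans (hbound θ hθ))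
  simpa only [hf, e1, e2] using h1

theorem exists_planarSol {a b : ℝ → ℝ} (hac : Continuous a) (hbc : Continuous b) {M : NNReal}
    (ha : ∀ θ, |a θ| ≤ M) (hb : ∀ θ, |b θ| ≤ M) (y₀ : ℝ × ℝ) :
    ∃ y : ℝ → ℝ × ℝ, y 0 = y₀ ∧ IsPlanarSol a b y := by
  choose α hα0 hα using fun n : ℕ =>
    exists_planarSol_Icc hac hbc ha hb y₀ (n + 1 : ℝ) (by positivity)
  have hd : ∀ n : ℕ, ∀ θ ∈ Ioo (-(n + 1 : ℝ)) (n + 1),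
      HasDerivAt (α n) (a θ * (α n θ).2, -(b θ * (α n θ).1)) θ := fun n θ hθ =>
    (hα n θ (Ioo_subset_Icc_self hθ)).hasDerivAt (Icc_mem_nhds hθ.1 hθ.2)
  have huniq : ∀ m n : ℕ, m ≤ n → EqOn (α m) (α n) (Ioo (-(m + 1 : ℝ)) (m + 1)) := by
    intro m n hmn
    have hmn' : (m : ℝ) ≤ n := by exact_mod_cast hmn
    refine ODE_solution_unique_of_mem_Ioo (v := fun θ y => (a θ * y.2, -(b θ * y.1)))
      (s := fun _ => univ) (t₀ := 0)
      (fun θ _ => (planarField_lipschitz (ha θ) (hb θ)).lipschitzOnWith)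
      ⟨by linarith [Nat.cast_nonneg (α := ℝ) m], by positivity⟩
      (fun θ hθ => ⟨hd m θ hθ, trivial⟩)
      (fun θ hθ => ⟨hd n θ ⟨by linarith [hθ.1], by linarith [hθ.2]⟩, trivial⟩) ?_
    rw [hα0, hα0]
  -- The solution of index `n` lives on `[-(n+1), n+1]`, so index `⌈|θ|⌉₊` has `θ` in the interior;
  -- by `huniq` the choice of a larger index changes nothing.
  refine ⟨fun θ => α ⌈|θ|⌉₊ θ, hα0 _, fun θ => ?_⟩
  obtain ⟨N, hN⟩ := exists_nat_gt |θ|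
  have heq : ∀ s : ℝ, |s| < N → α ⌈|s|⌉₊ s = α N s := by
    intro s hs
    refine huniq _ _ (Nat.ceil_le.2 hs.le) ?_
    have := Nat.le_ceil |s|
    rw [mem_Ioo, ← abs_lt]; linarith
  have hev : (fun s => α ⌈|s|⌉₊ s) =ᶠ[𝓝 θ] α N := by
    have : {s : ℝ | |s| < N} ∈ 𝓝 θ := (isOpen_lt continuous_abs continuous_const).mem_nhds hN
    exact mem_of_superset this heq
  have h1 := hd N θ (by rw [mem_Ioo, ← abs_lt]; linarith)
  have h2 := h1.congr_of_eventuallyEq hev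
  simpa only [heq θ hN] using h2

/-- The solution of a planar system with initial value `y₀` at `0`. -/
def planarSol (a b : ℝ → ℝ) (y₀ : ℝ × ℝ) : ℝ → ℝ × ℝ :=
  Classical.epsilon fun y => y 0 = y₀ ∧ IsPlanarSol a b y

theorem planarSol_spec {a b : ℝ → ℝ} (hac : Continuous a) (hbc : Continuous b) {M : NNReal}
    (ha : ∀ θ, |a θ| ≤ M) (hb : ∀ θ, |b θ| ≤ M) (y₀ : ℝ × ℝ) :
    planarSol a b y₀ 0 = y₀ ∧ IsPlanarSol a b (planarSol a b y₀) :=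
  Classical.epsilon_spec (exists_planarSol hac hbc ha hb y₀)

section
variable {a b : ℝ → ℝ} {y z : ℝ → ℝ × ℝ}

theorem IsPlanarSol.fst (hy : IsPlanarSol a b y) (θ : ℝ) :
    HasDerivAt (fun θ => (y θ).1) (a θ * (y θ).2) θ := (hy θ).fst

theorem IsPlanarSol.snd (hy : IsPlanarSol a b y) (θ : ℝ) :
    HasDerivAt (fun θ => (y θ).2) (-(b θ * (y θ).1)) θ := (hy θ).snd

theorem IsPlanarSol.mk' (h1 : ∀ θ, HasDerivAt (fun θ => (y θ).1) (a θ * (y θ).2) θ)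
    (h2 : ∀ θ, HasDerivAt (fun θ => (y θ).2) (-(b θ * (y θ).1)) θ) : IsPlanarSol a b y :=
  fun θ => (h1 θ).prodMk (h2 θ)

theorem IsPlanarSol.continuous (hy : IsPlanarSol a b y) : Continuous y :=
  continuous_iff_continuousAt.2 fun θ => (hy θ).continuousAt

theorem IsPlanarSol.lincomb (hy : IsPlanarSol a b y) (hz : IsPlanarSol a b z) (u w : ℝ) :
    IsPlanarSol a b (fun θ => u • y θ + w • z θ) := by
  refine .mk' (fun θ => ?_) (fun θ => ?_)
  · convert! ((hy.fst θ).const_mul u).add ((hz.fst θ).const_mul w) using 1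
    simp; ring
  · convert! ((hy.snd θ).const_mul u).add ((hz.snd θ).const_mul w) using 1
    simp; ring

/-- Lagrange's identity for two systems that differ in their second coefficient. -/
theorem IsPlanarSol.hasDerivAt_wronskian {b' : ℝ → ℝ} (hy : IsPlanarSol a b y)
    (hz : IsPlanarSol a b' z) (θ : ℝ) :
    HasDerivAt (fun θ => (y θ).1 * (z θ).2 - (y θ).2 * (z θ).1)
      ((b θ - b' θ) * (y θ).1 * (z θ).1) θ := by
  convert! ((hy.fst θ).mul (hz.snd θ)).sub ((hy.snd θ).mul (hz.fst θ)) using 1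
  ring

theorem IsPlanarSol.wronskian_eq (hy : IsPlanarSol a b y) (hz : IsPlanarSol a b z) (θ : ℝ) :
    (y θ).1 * (z θ).2 - (y θ).2 * (z θ).1 = (y 0).1 * (z 0).2 - (y 0).2 * (z 0).1 := by
  refine is_const_of_deriv_eq_zero (f := fun θ => (y θ).1 * (z θ).2 - (y θ).2 * (z θ).1)
    (fun θ => (hy.hasDerivAt_wronskian hz θ).differentiableAt) (fun θ => ?_) θ 0
  rw [(hy.hasDerivAt_wronskian hz θ).deriv]; ring

theorem IsPlanarSol.wronskian_integral {b' : ℝ → ℝ} (hb : Continuous b) (hb' : Continuous b')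
    (hy : IsPlanarSol a b y) (hz : IsPlanarSol a b' z) (θ : ℝ) :
    (y θ).1 * (z θ).2 - (y θ).2 * (z θ).1 - ((y 0).1 * (z 0).2 - (y 0).2 * (z 0).1) =
      ∫ s in (0 : ℝ)..θ, (b s - b' s) * (y s).1 * (z s).1 := by
  have hyc := hy.continuous
  have hzc := hz.continuous
  refine (intervalIntegral.integral_eq_sub_of_hasDerivAt
    (fun s _ => hy.hasDerivAt_wronskian hz s) ?_).symm
  exact Continuous.intervalIntegrable (by fun_prop) _ _

/-- Reflection of solutions about `c / 2`. -/
theorem IsPlanarSol.reflect (hy : IsPlanarSol a b y) {c : ℝ} (ha : ∀ θ, a (c - θ) = a θ)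
    (hb : ∀ θ, b (c - θ) = b θ) :
    IsPlanarSol a b (fun θ => ((y (c - θ)).1, -(y (c - θ)).2)) := by
  refine .mk' (fun θ => ?_) (fun θ => ?_)
  · convert! (hy.fst (c - θ)).comp θ ((hasDerivAt_id θ).const_sub c) using 1
    rw [ha]; simp
  · convert! ((hy.snd (c - θ)).comp θ ((hasDerivAt_id θ).const_sub c)).neg using 1
    rw [hb]; simp

theorem IsPlanarSol.shift (hy : IsPlanarSol a b y) {c : ℝ} (ha : ∀ θ, a (θ + c) = a θ)
    (hb : ∀ θ, b (θ + c) = b θ) : IsPlanarSol a b (fun θ => y (θ + c)) := by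
  intro θ
  have := (hy (θ + c)).comp_add_const θ c
  rwa [ha, hb] at this

end

/-! ### Floquet theory of even periodic planar systems -/

/-- Bounded continuous even coefficients of period `2 π`. -/
structure IsEvenPeriodicPair (a b : ℝ → ℝ) (M : NNReal) : Prop where
  cont_a : Continuous a
  cont_b : Continuous b
  bound_a : ∀ θ, |a θ| ≤ M
  bound_b : ∀ θ, |b θ| ≤ M
  even_a : ∀ θ, a (-θ) = a θ
  even_b : ∀ θ, b (-θ) = b θ
  per_a : ∀ θ, a (θ + 2 * π) = a θ
  per_b : ∀ θ, b (θ + 2 * π) = b θ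

/-- The solution with initial value `(1, 0)`. -/
def cosSol (a b : ℝ → ℝ) : ℝ → ℝ × ℝ := planarSol a b (1, 0)

/-- The solution with initial value `(0, 1)`. -/
def sinSol (a b : ℝ → ℝ) : ℝ → ℝ × ℝ := planarSol a b (0, 1)

namespace IsEvenPeriodicPair

variable {a b : ℝ → ℝ} {M : NNReal} {y z : ℝ → ℝ × ℝ}

theorem cosSol_zero (h : IsEvenPeriodicPair a b M) : cosSol a b 0 = (1, 0) :=
  (planarSol_spec h.cont_a h.cont_b h.bound_a h.bound_b _).1

theorem sinSol_zero (h : IsEvenPeriodicPair a b M) : sinSol a b 0 = (0, 1) :=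
  (planarSol_spec h.cont_a h.cont_b h.bound_a h.bound_b _).1

theorem isPlanarSol_cosSol (h : IsEvenPeriodicPair a b M) : IsPlanarSol a b (cosSol a b) :=
  (planarSol_spec h.cont_a h.cont_b h.bound_a h.bound_b _).2

theorem isPlanarSol_sinSol (h : IsEvenPeriodicPair a b M) : IsPlanarSol a b (sinSol a b) :=
  (planarSol_spec h.cont_a h.cont_b h.bound_a h.bound_b _).2

theorem ext (h : IsEvenPeriodicPair a b M) (hy : IsPlanarSol a b y) (hz : IsPlanarSol a b z)
    {θ₀ : ℝ} (he : y θ₀ = z θ₀) : y = z :=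
  hy.ext h.bound_a h.bound_b hz he

theorem eq_lincomb (h : IsEvenPeriodicPair a b M) (hy : IsPlanarSol a b y) (θ : ℝ) :
    y θ = (y 0).1 • cosSol a b θ + (y 0).2 • sinSol a b θ :=
  congrFun (h.ext hy (h.isPlanarSol_cosSol.lincomb h.isPlanarSol_sinSol (y 0).1 (y 0).2)
    (θ₀ := 0) (by ext <;> simp [h.cosSol_zero, h.sinSol_zero])) θ

theorem cosSol_neg (h : IsEvenPeriodicPair a b M) (θ : ℝ) :
    cosSol a b (-θ) = ((cosSol a b θ).1, -(cosSol a b θ).2) := by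
  have h1 := h.isPlanarSol_cosSol.reflect (c := 0) (by simpa using h.even_a)
    (by simpa using h.even_b)
  have h2 := congrFun (h.ext h1 h.isPlanarSol_cosSol (θ₀ := 0) (by simp [h.cosSol_zero])) (-θ)
  simpa using h2.symm

theorem reflect_two_pi (h : IsEvenPeriodicPair a b M) (hy : IsPlanarSol a b y) :
    IsPlanarSol a b (fun θ => ((y (2 * π - θ)).1, -(y (2 * π - θ)).2)) :=
  hy.reflect (fun θ => by rw [← h.even_a θ, ← h.per_a (-θ)]; ring_nf)
    (fun θ => by rw [← h.even_b θ, ← h.per_b (-θ)]; ring_nf)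

theorem wronskian (h : IsEvenPeriodicPair a b M) (θ : ℝ) :
    (cosSol a b θ).1 * (sinSol a b θ).2 - (cosSol a b θ).2 * (sinSol a b θ).1 = 1 := by
  simpa [h.cosSol_zero, h.sinSol_zero] using
    h.isPlanarSol_cosSol.wronskian_eq h.isPlanarSol_sinSol θ

/-- The value after a full period in terms of the values after half a period. -/
theorem two_pi_eq (h : IsEvenPeriodicPair a b M) (hy : IsPlanarSol a b y) :
    y (2 * π) =
      ((y π).1 * (sinSol a b π).2 + (y π).2 * (sinSol a b π).1,
        (y π).1 * (cosSol a b π).2 + (y π).2 * (cosSol a b π).1) := by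
  -- The reflected solution starts at `y (2 * π)` with its second coordinate negated, and at `π`
  -- equals `y π` with the second coordinate negated. Its expansion in the basis at `π` is inverted
  -- by Cramer's rule, the determinant being the Wronskian `1`.
  have hr := h.reflect_two_pi hy
  have h1 := h.eq_lincomb hr π
  have e : 2 * π - π = π := by ring
  simp only [sub_zero, e] at h1
  have h11 := congrArg Prod.fst h1
  have h12 := congrArg Prod.snd h1
  simp only [Prod.fst_add, Prod.snd_add, Prod.smul_fst, Prod.smul_snd, smul_eq_mul] at h11 h12
  have hw := h.wronskian π
  ext
  · simp only
    linear_combination (-(sinSol a b π).2) * h11 + (sinSol a b π).1 * h12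
      - (y (2 * π)).1 * hw
  · simp only
    linear_combination (-(cosSol a b π).2) * h11 + (cosSol a b π).1 * h12
      - (y (2 * π)).2 * hw

/-- With `α, β` and `σ, δ` the half-period values of the two basis solutions, the diagonal entry is
`α δ + β σ`, which the Wronskian `α δ - β σ = 1` turns into `1 + 2 β σ`. The other diagonal entry is
the same, so the trace depends on `β σ` alone. -/
theorem cosSol_two_pi (h : IsEvenPeriodicPair a b M) :
    cosSol a b (2 * π) = (1 + 2 * ((cosSol a b π).2 * (sinSol a b π).1),
      2 * ((cosSol a b π).1 * (cosSol a b π).2)) := by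
  rw [h.two_pi_eq h.isPlanarSol_cosSol]
  have hw := h.wronskian π
  ext
  · simp only; linear_combination hw
  · simp only; ring

theorem sinSol_two_pi (h : IsEvenPeriodicPair a b M) :
    sinSol a b (2 * π) = (2 * ((sinSol a b π).1 * (sinSol a b π).2),
      1 + 2 * ((cosSol a b π).2 * (sinSol a b π).1)) := by
  rw [h.two_pi_eq h.isPlanarSol_sinSol]
  have hw := h.wronskian π
  ext
  · simp only; ring
  · simp only; linear_combination hw

theorem cosSol_add_two_pi (h : IsEvenPeriodicPair a b M) (θ : ℝ) :
    cosSol a b (θ + 2 * π) = (1 + 2 * ((cosSol a b π).2 * (sinSol a b π).1)) • cosSol a b θ +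
      (2 * ((cosSol a b π).1 * (cosSol a b π).2)) • sinSol a b θ := by
  have := h.eq_lincomb (h.isPlanarSol_cosSol.shift h.per_a h.per_b) θ
  simpa only [zero_add, h.cosSol_two_pi] using this

theorem sinSol_add_two_pi (h : IsEvenPeriodicPair a b M) (θ : ℝ) :
    sinSol a b (θ + 2 * π) = (2 * ((sinSol a b π).1 * (sinSol a b π).2)) • cosSol a b θ +
      (1 + 2 * ((cosSol a b π).2 * (sinSol a b π).1)) • sinSol a b θ := by
  have := h.eq_lincomb (h.isPlanarSol_sinSol.shift h.per_a h.per_b) θ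
  simpa only [zero_add, h.sinSol_two_pi] using this

/-- Trace larger than `2`: the even solution is unbounded. -/
theorem cosSol_unbounded (h : IsEvenPeriodicPair a b M)
    (hp : 0 < (cosSol a b π).2 * (sinSol a b π).1) :
    ¬ ∃ K : ℝ, ∀ θ, |(cosSol a b θ).1| ≤ K := by
  rintro ⟨K, hK⟩
  set p := (cosSol a b π).2 * (sinSol a b π).1 with hpdef
  -- Cayley–Hamilton for the monodromy matrix, of determinant `1` and trace `2 (1 + 2 p)`.
  have hrec : ∀ θ, (cosSol a b (θ + 2 * π + 2 * π)).1 =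
      2 * (1 + 2 * p) * (cosSol a b (θ + 2 * π)).1 - (cosSol a b θ).1 := by
    intro θ
    have h1 := congrArg Prod.fst (h.cosSol_add_two_pi (θ + 2 * π))
    have h2 := congrArg Prod.fst (h.cosSol_add_two_pi θ)
    have h3 := congrArg Prod.fst (h.sinSol_add_two_pi θ)
    simp only [Prod.fst_add, Prod.smul_fst, smul_eq_mul, ← hpdef] at h1 h2 h3
    have hw := h.wronskian π
    rw [h1, h3, h2]
    linear_combination (4 * p * (cosSol a b θ).1) * hw
      - 4 * (cosSol a b θ).1 * (1 + p) * hpdef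
  -- For `p > 0` the recursion makes the increments over successive periods at least `2 p`; linear
  -- growth is enough for unboundedness.
  have hind : ∀ n : ℕ, 1 + n * (2 * p) ≤ (cosSol a b (n * (2 * π))).1 ∧
      (cosSol a b (n * (2 * π))).1 + 2 * p ≤ (cosSol a b ((n + 1 : ℕ) * (2 * π))).1 := by
    intro n
    induction n with
    | zero => simp [h.cosSol_zero, h.cosSol_two_pi, ← hpdef]
    | succ n ih =>
      obtain ⟨ih1, ih2⟩ := ih
      refine ⟨by push_cast at ih2 ⊢; linarith, ?_⟩
      have hr := hrec (n * (2 * π))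
      have e1 : (n : ℝ) * (2 * π) + 2 * π = ((n + 1 : ℕ) : ℝ) * (2 * π) := by push_cast; ring
      have e2 : ((n + 1 : ℕ) : ℝ) * (2 * π) + 2 * π = ((n + 1 + 1 : ℕ) : ℝ) * (2 * π) := by
        push_cast; ring
      rw [e1, e2] at hr
      rw [hr]
      have hpos : 1 ≤ (cosSol a b ((n + 1 : ℕ) * (2 * π))).1 := by
        have : 0 ≤ (n : ℝ) * (2 * p) := by positivity
        linarith
      nlinarith
  obtain ⟨n, hn⟩ := exists_nat_gt (K / (2 * p))
  have h1 := (hind n).1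
  have h2 := (le_abs_self _).trans (hK (n * (2 * π)))
  rw [div_lt_iff₀ (by positivity)] at hn
  linarith

/-- Trace between `-2` and `2`: all solutions are bounded. -/
theorem bounded_of_neg (h : IsEvenPeriodicPair a b M)
    (hp : (cosSol a b π).2 * (sinSol a b π).1 < 0)
    (hp' : -1 < (cosSol a b π).2 * (sinSol a b π).1) (hy : IsPlanarSol a b y) :
    ∃ K : ℝ, ∀ θ, |(y θ).1| ≤ K := by
  set p := (cosSol a b π).2 * (sinSol a b π).1 with hpdef
  set B := 2 * ((cosSol a b π).1 * (cosSol a b π).2) with hB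
  set D := 2 * ((sinSol a b π).1 * (sinSol a b π).2) with hD
  have hw := h.wronskian π
  have hBD : B * D = 4 * p * (1 + p) := by rw [hB, hD]; linear_combination 4 * p * hw + 4 * (1 + p) * hpdef - 4 * (cosSol a b π).1 * (sinSol a b π).2 * hpdef
  have hBDneg : B * D < 0 := by rw [hBD]; nlinarith
  have hBne : B ≠ 0 := by rintro h0; simp [h0] at hBDneg
  -- the coordinates of the translates of `y`
  have hshift : ∀ c : ℤ, IsPlanarSol a b (fun θ => y (θ + c * (2 * π))) := by
    intro c
    refine hy.shift (fun θ => ?_) (fun θ => ?_)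
    · exact Function.Periodic.int_mul h.per_a c θ
    · exact Function.Periodic.int_mul h.per_b c θ
  -- This quadratic form is invariant under the monodromy matrix, because `(1 + 2 p) ^ 2 - B D = 1`.
  -- Since `B D = 4 p (1 + p) < 0`, it is definite, so the values of `y` at multiples of the period
  -- stay bounded.
  set q : ℝ → ℝ := fun θ => B * (y θ).1 ^ 2 - D * (y θ).2 ^ 2 with hq
  have hstep : ∀ c : ℤ, q ((c + 1 : ℤ) * (2 * π)) = q (c * (2 * π)) := by
    intro c
    have h1 := h.eq_lincomb (hshift c) (2 * π)
    simp only [zero_add] at h1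
    have e : 2 * π + (c : ℝ) * (2 * π) = ((c + 1 : ℤ) : ℝ) * (2 * π) := by push_cast; ring
    rw [e, h.cosSol_two_pi, h.sinSol_two_pi] at h1
    have h11 := congrArg Prod.fst h1
    have h12 := congrArg Prod.snd h1
    simp only [Prod.fst_add, Prod.snd_add, Prod.smul_fst, Prod.smul_snd, smul_eq_mul,
      ← hpdef, ← hB, ← hD] at h11 h12
    simp only [hq, h11, h12]
    linear_combination (D * (y (c * (2 * π))).2 ^ 2 - B * (y (c * (2 * π))).1 ^ 2) * hBD
  have hconst : ∀ c : ℤ, q (c * (2 * π)) = q 0 := by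
    intro c
    induction c with
    | zero => simp
    | succ n ih => rw [hstep]; exact ih
    | pred n ih => rw [← ih, ← hstep (-n - 1)]; congr 3; ring
  obtain ⟨R, hR⟩ : ∃ R : ℝ, ∀ c : ℤ, |(y (c * (2 * π))).1| ≤ R ∧ |(y (c * (2 * π))).2| ≤ R := by
    have key : ∀ c : ℤ, B ^ 2 * (y (c * (2 * π))).1 ^ 2 + -(B * D) * (y (c * (2 * π))).2 ^ 2
        = B * q 0 := by
      intro c; rw [← hconst c, hq]; ring
    refine ⟨1 + B * q 0 / B ^ 2 + B * q 0 / -(B * D), fun c => ?_⟩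
    have hk := key c
    have hB2 : 0 < B ^ 2 := by positivity
    have hBD' : 0 < -(B * D) := by linarith
    have hq0 : 0 ≤ B * q 0 := by rw [← hk]; positivity
    have hb1 : (y (c * (2 * π))).1 ^ 2 ≤ B * q 0 / B ^ 2 := by
      rw [le_div_iff₀ hB2]
      have : 0 ≤ -(B * D) * (y (c * (2 * π))).2 ^ 2 := by positivity
      linarith
    have hb2 : (y (c * (2 * π))).2 ^ 2 ≤ B * q 0 / -(B * D) := by
      rw [le_div_iff₀ hBD']
      have : 0 ≤ B ^ 2 * (y (c * (2 * π))).1 ^ 2 := by positivity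
      linarith
    have hd1 : 0 ≤ B * q 0 / B ^ 2 := by positivity
    have hd2 : 0 ≤ B * q 0 / -(B * D) := by positivity
    constructor
    · nlinarith [sq_abs (y (c * (2 * π))).1, sq_nonneg (|(y (c * (2 * π))).1| - 1)]
    · nlinarith [sq_abs (y (c * (2 * π))).2, sq_nonneg (|(y (c * (2 * π))).2| - 1)]
  obtain ⟨Kc, hKc⟩ := (isCompact_Icc (a := 0) (b := 2 * π)).exists_bound_of_continuousOn
    h.isPlanarSol_cosSol.continuous.fst.continuousOn
  obtain ⟨Ks, hKs⟩ := (isCompact_Icc (a := 0) (b := 2 * π)).exists_bound_of_continuousOn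
    h.isPlanarSol_sinSol.continuous.fst.continuousOn
  have hR0 : 0 ≤ R := (abs_nonneg _).trans (hR 0).1
  refine ⟨R * Kc + R * Ks, fun θ => ?_⟩
  set c : ℤ := ⌊θ / (2 * π)⌋ with hc
  have h2pi : (0 : ℝ) < 2 * π := by positivity
  set s := θ - c * (2 * π) with hs
  have hsmem : s ∈ Icc 0 (2 * π) := by
    have h1 := Int.floor_le (θ / (2 * π))
    have h2 := (Int.lt_floor_add_one (θ / (2 * π))).le
    rw [le_div_iff₀ h2pi] at h1
    rw [div_le_iff₀ h2pi] at h2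
    constructor <;> simp only [hs, hc] <;> linarith
  have h1 := congrArg Prod.fst (h.eq_lincomb (hshift c) s)
  simp only [zero_add, hs, sub_add_cancel, Prod.fst_add, Prod.smul_fst, smul_eq_mul] at h1
  rw [h1]
  refine (abs_add_le _ _).trans (add_le_add ?_ ?_)
  · rw [abs_mul]
    exact mul_le_mul (hR c).1 (hKc s hsmem) (abs_nonneg _) hR0
  · rw [abs_mul]
    exact mul_le_mul (hR c).2 (hKs s hsmem) (abs_nonneg _) hR0

theorem periodic_relations (h : IsEvenPeriodicPair a b M) (hy : IsPlanarSol a b y)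
    (hper : y (2 * π) = y 0) :
    (y 0).1 * (2 * ((cosSol a b π).2 * (sinSol a b π).1)) +
        (y 0).2 * (2 * ((sinSol a b π).1 * (sinSol a b π).2)) = 0 ∧
      (y 0).1 * (2 * ((cosSol a b π).1 * (cosSol a b π).2)) +
        (y 0).2 * (2 * ((cosSol a b π).2 * (sinSol a b π).1)) = 0 := by
  have h1 := h.eq_lincomb hy (2 * π)
  rw [h.cosSol_two_pi, h.sinSol_two_pi, hper] at h1
  have h11 := congrArg Prod.fst h1
  have h12 := congrArg Prod.snd h1
  simp only [Prod.fst_add, Prod.snd_add, Prod.smul_fst, Prod.smul_snd, smul_eq_mul] at h11 h12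
  constructor <;> linarith

theorem eq_zero_of_initial (h : IsEvenPeriodicPair a b M) (hy : IsPlanarSol a b y)
    (h1 : (y 0).1 = 0) (h2 : (y 0).2 = 0) (θ : ℝ) : y θ = 0 := by
  rw [h.eq_lincomb hy θ, h1, h2]; simp

/-- A nonzero periodic solution forces the trace to be `2`. -/
theorem mul_eq_zero_of_periodic (h : IsEvenPeriodicPair a b M) (hy : IsPlanarSol a b y)
    (hper : y (2 * π) = y 0) (hne : y ≠ 0) : (cosSol a b π).2 * (sinSol a b π).1 = 0 := by
  obtain ⟨h1, h2⟩ := h.periodic_relations hy hper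
  have hw := h.wronskian π
  by_contra hp
  set α := (cosSol a b π).1
  set β := (cosSol a b π).2
  set σ := (sinSol a b π).1
  set δ := (sinSol a b π).2
  -- Cramer's rule for the monodromy matrix minus the identity, whose determinant is `-4 β σ`.
  have hu : (β * σ) * (y 0).1 = 0 := by
    linear_combination (-β * σ / 2) * h1 + (σ * δ / 2) * h2 - (y 0).1 * (β * σ) * hw
  have hv : (β * σ) * (y 0).2 = 0 := by
    linear_combination (-β * σ / 2) * h2 + (α * β / 2) * h1 - (y 0).2 * (β * σ) * hw
  refine hne (funext fun θ => h.eq_zero_of_initial hy ?_ ?_ θ)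
  · exact (mul_eq_zero.1 hu).resolve_left hp
  · exact (mul_eq_zero.1 hv).resolve_left hp

/-- A nonzero even periodic solution exists only if `cosSol` is stationary at `π`. -/
theorem cosSol_pi_of_even (h : IsEvenPeriodicPair a b M) (ha0 : a 0 ≠ 0)
    (hy : IsPlanarSol a b y) (hper : y (2 * π) = y 0) (hne : y ≠ 0)
    (heven : ∀ θ, (y (-θ)).1 = (y θ).1) : (cosSol a b π).2 = 0 := by
  have h20 : (y 0).2 = 0 := by
    have hd := hy.fst 0
    have hd' : HasDerivAt (fun θ => (y (-θ)).1) (-(a 0 * (y 0).2)) 0 := by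
      have := HasDerivAt.scomp (h := fun s : ℝ => -s) 0 (by simpa using hd) (hasDerivAt_neg 0)
      simpa [Function.comp_def] using! this
    simp only [heven] at hd'
    have := hd.unique hd'
    have : a 0 * (y 0).2 = 0 := by linarith
    exact (mul_eq_zero.1 this).resolve_left ha0
  have h10 : (y 0).1 ≠ 0 := fun h1 => hne (funext fun θ => h.eq_zero_of_initial hy h1 h20 θ)
  obtain ⟨h1, h2⟩ := h.periodic_relations hy hper
  have hw := h.wronskian π
  rw [h20] at h1 h2
  by_contra hβ
  have hα : (cosSol a b π).1 = 0 := by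
    have : (y 0).1 * 2 * (cosSol a b π).2 * (cosSol a b π).1 = 0 := by linarith
    exact (mul_eq_zero.1 this).resolve_left (by simp [h10, hβ])
  have hσ : (sinSol a b π).1 = 0 := by
    have : (y 0).1 * 2 * (cosSol a b π).2 * (sinSol a b π).1 = 0 := by linarith
    exact (mul_eq_zero.1 this).resolve_left (by simp [h10, hβ])
  rw [hα, hσ] at hw; simp at hw

theorem cosSol_periodic (h : IsEvenPeriodicPair a b M) (hβ : (cosSol a b π).2 = 0) (θ : ℝ) :
    cosSol a b (θ + 2 * π) = cosSol a b θ := by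
  rw [h.cosSol_add_two_pi, hβ]; simp

end IsEvenPeriodicPair

/-! ### Dependence of planar systems on parameters -/

theorem IsPlanarSol.norm_le {a b : ℝ → ℝ} {M : NNReal} (ha : ∀ θ, |a θ| ≤ M)
    (hb : ∀ θ, |b θ| ≤ M) {y : ℝ → ℝ × ℝ} (hy : IsPlanarSol a b y) (h0 : ‖y 0‖ ≤ 1) {θ : ℝ}
    (hθ : θ ∈ Icc 0 π) : ‖y θ‖ ≤ exp (M * π) := by
  have hz : IsPlanarSol a b (fun _ => (0 : ℝ × ℝ)) := fun θ => by
    simpa using! hasDerivAt_const θ (0 : ℝ × ℝ)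
  have := dist_le_of_trajectories_ODE (v := fun θ y => (a θ * y.2, -(b θ * y.1))) (δ := 1)
    (fun θ => planarField_lipschitz (ha θ) (hb θ)) (a := 0) (b := π)
    hy.continuous.continuousOn (fun θ _ => (hy θ).hasDerivWithinAt)
    hz.continuous.continuousOn (fun θ _ => (hz θ).hasDerivWithinAt) (by simpa using h0) θ hθ
  rw [dist_zero_right, one_mul, sub_zero] at this
  refine this.trans (exp_le_exp.2 (mul_le_mul_of_nonneg_left hθ.2 M.2))

/-- The solution `z` of the second system solves the first one up to an error `d * exp (M * π)`, by
the bound of `norm_le` on `z`; Grönwall's inequality for approximate solutions does the rest. -/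
theorem IsPlanarSol.norm_sub_le {a b a' b' : ℝ → ℝ} {M : NNReal} (hM : 0 < M)
    (ha : ∀ θ, |a θ| ≤ M) (hb : ∀ θ, |b θ| ≤ M) (ha' : ∀ θ, |a' θ| ≤ M) (hb' : ∀ θ, |b' θ| ≤ M)
    {y z : ℝ → ℝ × ℝ} (hy : IsPlanarSol a b y) (hz : IsPlanarSol a' b' z) (hyz : y 0 = z 0)
    (h0 : ‖y 0‖ ≤ 1) {d : ℝ} (hda : ∀ θ, |a θ - a' θ| ≤ d) (hdb : ∀ θ, |b θ - b' θ| ≤ d)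
    {θ : ℝ} (hθ : θ ∈ Icc 0 π) :
    ‖y θ - z θ‖ ≤ exp (M * π) / M * exp (M * π) * d := by
  have hd : 0 ≤ d := (abs_nonneg _).trans (hda 0)
  have key := dist_le_of_approx_trajectories_ODE (v := fun θ y => (a θ * y.2, -(b θ * y.1)))
    (K := M) (δ := 0) (εf := 0) (εg := d * exp (M * π)) (f' := fun θ => (a θ * (y θ).2, -(b θ * (y θ).1)))
    (g' := fun θ => (a' θ * (z θ).2, -(b' θ * (z θ).1)))
    (fun θ => planarField_lipschitz (ha θ) (hb θ)) (a := 0) (b := π)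
    hy.continuous.continuousOn (fun θ _ => (hy θ).hasDerivWithinAt) (fun θ _ => by simp)
    hz.continuous.continuousOn (fun θ _ => (hz θ).hasDerivWithinAt) (fun θ hθ => ?_)
    (by simp [hyz]) θ hθ
  · rw [dist_eq_norm, sub_zero, zero_add, gronwallBound_of_K_ne_0 (by exact_mod_cast hM.ne')] at key
    refine key.trans ?_
    have hM' : (0 : ℝ) < M := by exact_mod_cast hM
    have h1 : exp (M * θ) ≤ exp (M * π) :=
      exp_le_exp.2 (mul_le_mul_of_nonneg_left hθ.2 M.2)
    have h2 : exp (M * θ) - 1 ≤ exp (M * π) := by linarith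
    have h3 : 0 ≤ d * exp (M * π) / M := by positivity
    calc _ = d * exp (M * π) / M * (exp (M * θ) - 1) := by ring
      _ ≤ d * exp (M * π) / M * exp (M * π) := mul_le_mul_of_nonneg_left h2 h3
      _ = _ := by ring
  · have hn := hz.norm_le ha' hb' (hyz ▸ h0) (Ico_subset_Icc_self hθ)
    rw [Prod.dist_eq]
    refine max_le ?_ ?_
    · rw [Real.dist_eq, show a' θ * (z θ).2 - a θ * (z θ).2 = -(a θ - a' θ) * (z θ).2 by ring,
        abs_mul, abs_neg]
      exact mul_le_mul (hda θ) ((norm_snd_le (z θ)).trans hn) (abs_nonneg _) hd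
    · rw [Real.dist_eq, show -(b' θ * (z θ).1) - -(b θ * (z θ).1) = (b θ - b' θ) * (z θ).1 by ring,
        abs_mul]
      exact mul_le_mul (hdb θ) ((norm_fst_le (z θ)).trans hn) (abs_nonneg _) hd

/-! ### Hill's equation in phase variables. -/

/-- The restoring coefficient `G ⬝ V''(g)` expressed by `G = g'` and `G₂ = g''`. -/
def restoringCoeff (G G₂ : ℝ → ℝ) (u : ℝ) : ℝ := (G u - u * G₂ u) / G u ^ 2

/-- Regularity of the density `G = dt/dθ` of time with respect to phase. -/
structure IsPhaseDensity (G G₂ : ℝ → ℝ) (ρ L : ℝ) : Prop where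
  ρ_pos : 0 < ρ
  L_nonneg : 0 ≤ L
  deriv : ∀ u, |u| ≤ ρ → HasDerivAt G (G₂ u) u
  pos : ∀ u, |u| ≤ ρ → 0 < G u
  cont : ContinuousOn G₂ (Icc (-ρ) ρ)
  lip : ∀ u v, |u| ≤ ρ → |v| ≤ ρ → |G u - G v| ≤ L * |u - v|
  lipK : ∀ u v, |u| ≤ ρ → |v| ≤ ρ →
    |restoringCoeff G G₂ u - restoringCoeff G G₂ v| ≤ L * |u - v|

/-- First coefficient of the Hill equation in phase variables at amplitude `A`. -/
def phaseA (G : ℝ → ℝ) (A θ : ℝ) : ℝ := G (A * cos θ)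

/-- Second coefficient of the Hill equation in phase variables. -/
def phaseB (G G₂ : ℝ → ℝ) (A κ θ : ℝ) : ℝ :=
  restoringCoeff G G₂ (A * cos θ) + 4 * κ * G (A * cos θ)

/-- Solutions of the Hill equation in phase variables. -/
def phaseSol (G G₂ : ℝ → ℝ) (y₀ : ℝ × ℝ) (A κ : ℝ) : ℝ → ℝ × ℝ :=
  planarSol (phaseA G A) (phaseB G G₂ A κ) y₀

/-- The weighted product integral of two solutions. -/
def phaseIntegral (G G₂ : ℝ → ℝ) (y₀ : ℝ × ℝ) (A κ κ' : ℝ) : ℝ :=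
  ∫ θ in (0 : ℝ)..π, phaseA G A θ * (phaseSol G G₂ y₀ A κ θ).1 * (phaseSol G G₂ y₀ A κ' θ).1

theorem abs_mul_cos_le {A ρ : ℝ} (hA : |A| ≤ ρ) (θ : ℝ) : |A * cos θ| ≤ ρ := by
  rw [abs_mul]
  exact (mul_le_of_le_one_right (abs_nonneg _) (abs_cos_le_one θ)).trans hA

namespace IsPhaseDensity

variable {G G₂ : ℝ → ℝ} {ρ L : ℝ}

theorem continuous_comp (_ : IsPhaseDensity G G₂ ρ L) {F : ℝ → ℝ}
    (hF : ContinuousOn F (Icc (-ρ) ρ)) {A : ℝ} (hA : |A| ≤ ρ) :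
    Continuous fun θ => F (A * cos θ) :=
  hF.comp_continuous (by fun_prop) fun θ => abs_le.1 (abs_mul_cos_le hA θ)

theorem continuousOn_G (h : IsPhaseDensity G G₂ ρ L) : ContinuousOn G (Icc (-ρ) ρ) :=
  fun u hu => (h.deriv u (abs_le.2 hu)).continuousAt.continuousWithinAt

theorem continuousOn_K (h : IsPhaseDensity G G₂ ρ L) :
    ContinuousOn (restoringCoeff G G₂) (Icc (-ρ) ρ) := by
  have h1 := h.continuousOn_G
  have h2 := h.cont
  refine ContinuousOn.div (by fun_prop) (by fun_prop) fun u hu => ?_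
  have := h.pos u (abs_le.2 hu)
  positivity

theorem continuous_phaseA (h : IsPhaseDensity G G₂ ρ L) {A : ℝ} (hA : |A| ≤ ρ) :
    Continuous (phaseA G A) := h.continuous_comp h.continuousOn_G hA

theorem continuous_phaseB (h : IsPhaseDensity G G₂ ρ L) {A : ℝ} (hA : |A| ≤ ρ) (κ : ℝ) :
    Continuous (phaseB G G₂ A κ) :=
  (h.continuous_comp h.continuousOn_K hA).add
    (continuous_const.mul (h.continuous_comp h.continuousOn_G hA))

theorem zero_mem (h : IsPhaseDensity G G₂ ρ L) : |(0 : ℝ)| ≤ ρ := by simpa using h.ρ_pos.le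

theorem exists_bound (h : IsPhaseDensity G G₂ ρ L) :
    ∃ M : NNReal, 0 < M ∧ (∀ u, |u| ≤ ρ → |G u| ≤ M) ∧ ∀ A κ : ℝ, |A| ≤ ρ → |κ| ≤ 1 →
      IsEvenPeriodicPair (phaseA G A) (phaseB G G₂ A κ) M := by
  have hρ := h.ρ_pos
  have hL := h.L_nonneg
  set M₁ : ℝ := |G 0| + L * ρ
  set M₂ : ℝ := |restoringCoeff G G₂ 0| + L * ρ
  have hM₁ : 0 ≤ M₁ := by positivity
  have hM₂ : 0 ≤ M₂ := by positivity
  have hG : ∀ u, |u| ≤ ρ → |G u| ≤ M₁ := by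
    intro u hu
    have h1 := h.lip u 0 hu h.zero_mem
    rw [sub_zero] at h1
    have h2 : L * |u| ≤ L * ρ := mul_le_mul_of_nonneg_left hu hL
    have h3 := abs_sub_abs_le_abs_sub (G u) (G 0)
    simp only [M₁]; linarith
  have hK : ∀ u, |u| ≤ ρ → |restoringCoeff G G₂ u| ≤ M₂ := by
    intro u hu
    have h1 := h.lipK u 0 hu h.zero_mem
    rw [sub_zero] at h1
    have h2 : L * |u| ≤ L * ρ := mul_le_mul_of_nonneg_left hu hL
    have h3 := abs_sub_abs_le_abs_sub (restoringCoeff G G₂ u) (restoringCoeff G G₂ 0)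
    simp only [M₂]; linarith
  -- `4 M₁ + M₂` bounds the second coefficient when `|κ| ≤ 1`; the extra `1` makes the bound
  -- positive, as the division by `M` in `norm_sub_le` requires.
  refine ⟨⟨4 * M₁ + M₂ + 1, by positivity⟩, ?_, fun u hu => ?_, fun A κ hA hκ => ?_⟩
  · exact (show (0 : ℝ) < 4 * M₁ + M₂ + 1 by positivity)
  · exact (hG u hu).trans (show M₁ ≤ 4 * M₁ + M₂ + 1 by linarith)
  · refine ⟨h.continuous_phaseA hA, h.continuous_phaseB hA κ, fun θ => ?_, fun θ => ?_,
      fun θ => by simp [phaseA], fun θ => by simp [phaseB],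
      fun θ => by simp [phaseA], fun θ => by simp [phaseB]⟩
    · exact (hG _ (abs_mul_cos_le hA θ)).trans (show M₁ ≤ 4 * M₁ + M₂ + 1 by linarith)
    · have h1 := hG _ (abs_mul_cos_le hA θ)
      have h2 := hK _ (abs_mul_cos_le hA θ)
      have h3 : |4 * κ * G (A * cos θ)| ≤ 4 * M₁ := by
        rw [abs_mul, abs_mul]
        have : |κ| * |G (A * cos θ)| ≤ 1 * M₁ := mul_le_mul hκ h1 (abs_nonneg _) zero_le_one
        norm_num; linarith
      have h4 := abs_add_le (restoringCoeff G G₂ (A * cos θ)) (4 * κ * G (A * cos θ))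
      show |phaseB G G₂ A κ θ| ≤ 4 * M₁ + M₂ + 1
      simp only [phaseB]; linarith

/-- Solutions are bounded and Lipschitz in the parameters, uniformly over half a period. -/
theorem exists_phaseSol_lipschitz (h : IsPhaseDensity G G₂ ρ L) :
    ∃ Λ : ℝ, 0 < Λ ∧ ∀ y₀ : ℝ × ℝ, ‖y₀‖ ≤ 1 → ∀ θ ∈ Icc 0 π, ∀ A κ : ℝ, |A| ≤ ρ → |κ| ≤ 1 →
      ‖phaseSol G G₂ y₀ A κ θ‖ ≤ Λ ∧ |phaseA G A θ| ≤ Λ ∧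
      ∀ A' κ' : ℝ, |A'| ≤ ρ → |κ'| ≤ 1 → 
        |phaseA G A θ - phaseA G A' θ| ≤ Λ * |A - A'| ∧
        ‖phaseSol G G₂ y₀ A κ θ - phaseSol G G₂ y₀ A' κ' θ‖ ≤ Λ * (|A - A'| + |κ - κ'|) := by
  obtain ⟨M, hM, hMG, hpair⟩ := h.exists_bound
  have hM' : (0 : ℝ) < M := by exact_mod_cast hM
  have hL := h.L_nonneg
  set c : ℝ := exp (M * π) / M * exp (M * π)
  have hc : 0 < c := by positivity
  -- The summands bound, in turn, the solution, the first coefficient, its Lipschitz constant in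
  -- `A`, and the Lipschitz constant of the solution. In the last, `5 L + 4 M` controls both
  -- coefficients and `c` is the Grönwall factor.
  refine ⟨exp (M * π) + M + L + c * (5 * L + 4 * M), by positivity, ?_⟩
  intro y₀ hy₀ θ hθ A κ hA hκ
  have hp := hpair A κ hA hκ
  obtain ⟨hy0, hy⟩ := planarSol_spec hp.cont_a hp.cont_b hp.bound_a hp.bound_b y₀
  have hpos2 : 0 ≤ c * (5 * L + 4 * M) := by positivity
  have hea := exp_pos (M * π)
  refine ⟨?_, ?_, ?_⟩
  · have := hy.norm_le hp.bound_a hp.bound_b (by rwa [hy0]) hθ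
    refine this.trans (by linarith)
  · have := hp.bound_a θ
    linarith
  intro A' κ' hA' hκ'
  have hlipA : ∀ θ, |A * cos θ - A' * cos θ| ≤ |A - A'| := by
    intro θ
    rw [← sub_mul, abs_mul]
    exact mul_le_of_le_one_right (abs_nonneg _) (abs_cos_le_one θ)
  have hda : ∀ θ, |phaseA G A θ - phaseA G A' θ| ≤ L * |A - A'| := fun θ =>
    (h.lip _ _ (abs_mul_cos_le hA θ) (abs_mul_cos_le hA' θ)).trans
      (mul_le_mul_of_nonneg_left (hlipA θ) hL)
  have hdK : ∀ θ, |restoringCoeff G G₂ (A * cos θ) - restoringCoeff G G₂ (A' * cos θ)|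
      ≤ L * |A - A'| := fun θ =>
    (h.lipK _ _ (abs_mul_cos_le hA θ) (abs_mul_cos_le hA' θ)).trans
      (mul_le_mul_of_nonneg_left (hlipA θ) hL)
  have hp' := hpair A' κ' hA' hκ'
  obtain ⟨hz0, hz⟩ := planarSol_spec hp'.cont_a hp'.cont_b hp'.bound_a hp'.bound_b y₀
  have n1 := abs_nonneg (A - A')
  have n2 := abs_nonneg (κ - κ')
  refine ⟨(hda θ).trans ?_, ?_⟩
  · exact mul_le_mul_of_nonneg_right (by linarith) n1
  have hdb : ∀ θ, |phaseB G G₂ A κ θ - phaseB G G₂ A' κ' θ|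
      ≤ (5 * L + 4 * M) * (|A - A'| + |κ - κ'|) := by
    intro θ
    have e : phaseB G G₂ A κ θ - phaseB G G₂ A' κ' θ =
        (restoringCoeff G G₂ (A * cos θ) - restoringCoeff G G₂ (A' * cos θ)) +
        (4 * (κ - κ') * G (A * cos θ) + 4 * κ' * (phaseA G A θ - phaseA G A' θ)) := by
      simp only [phaseB, phaseA]; ring
    rw [e]
    have h1 : |4 * (κ - κ') * G (A * cos θ)| ≤ 4 * |κ - κ'| * M := by
      rw [abs_mul, abs_mul]
      have := mul_le_mul_of_nonneg_left (hMG _ (abs_mul_cos_le hA θ))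
        (by positivity : 0 ≤ 4 * |κ - κ'|)
      simpa using this
    have h2 : |4 * κ' * (phaseA G A θ - phaseA G A' θ)| ≤ 4 * (L * |A - A'|) := by
      rw [abs_mul, abs_mul]
      have := mul_le_mul hκ' (hda θ) (abs_nonneg _) zero_le_one
      norm_num; linarith
    have h3 := abs_add_le (4 * (κ - κ') * G (A * cos θ)) (4 * κ' * (phaseA G A θ - phaseA G A' θ))
    refine (abs_add_le _ _).trans ?_
    have h4 := hdK θ
    have h5 : 0 ≤ L * |κ - κ'| := by positivity
    have h6 : 0 ≤ M * |A - A'| := by positivity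
    linarith
  have hda' : ∀ θ, |phaseA G A θ - phaseA G A' θ| ≤ (5 * L + 4 * M) * (|A - A'| + |κ - κ'|) := by
    intro θ
    refine (hda θ).trans ?_
    have h5 : 0 ≤ L * |κ - κ'| := by positivity
    have h6 : 0 ≤ M * |A - A'| := by positivity
    have h7 : 0 ≤ M * |κ - κ'| := by positivity
    have h8 : 0 ≤ L * |A - A'| := by positivity
    linarith
  have := hy.norm_sub_le hM hp.bound_a hp.bound_b hp'.bound_a hp'.bound_b hz (by rw [hy0, hz0])
    (by rwa [hy0]) hda' hdb hθ
  refine this.trans ?_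
  rw [← mul_assoc]
  refine mul_le_mul_of_nonneg_right ?_ (by positivity)
  linarith

theorem abs_mul_sub_mul_le {x y x' y' B d e : ℝ} (hx' : |x'| ≤ B) (hy : |y| ≤ B)
    (hd : |x - x'| ≤ d) (he : |y - y'| ≤ e) : |x * y - x' * y'| ≤ B * (d + e) := by
  have e1 : x * y - x' * y' = (x - x') * y + x' * (y - y') := by ring
  rw [e1]
  refine (abs_add_le _ _).trans ?_
  rw [abs_mul, abs_mul]
  have h1 := mul_le_mul hd hy (abs_nonneg _) ((abs_nonneg _).trans hd)
  have h2 := mul_le_mul hx' he (abs_nonneg _) ((abs_nonneg _).trans hx')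
  linarith

theorem exists_phaseIntegral_lipschitz (h : IsPhaseDensity G G₂ ρ L) :
    ∃ Λ : ℝ, 0 < Λ ∧ ∀ y₀ : ℝ × ℝ, ‖y₀‖ ≤ 1 → ∀ A κ μ A' κ' μ' : ℝ, |A| ≤ ρ → |κ| ≤ 1 → |μ| ≤ 1 →
      |A'| ≤ ρ → |κ'| ≤ 1 → |μ'| ≤ 1 →
      |phaseIntegral G G₂ y₀ A κ μ - phaseIntegral G G₂ y₀ A' κ' μ'| ≤
        Λ * (|A - A'| + |κ - κ'| + |μ - μ'|) := by
  obtain ⟨Λ, hΛ, hlip⟩ := h.exists_phaseSol_lipschitz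
  obtain ⟨M, hM, hMG, hpair⟩ := h.exists_bound
  refine ⟨(Λ ^ 2 * (2 * Λ) + Λ ^ 3) * π, by positivity, ?_⟩
  intro y₀ hy₀ A κ μ A' κ' μ' hA hκ hμ hA' hκ' hμ'
  have hcont : ∀ A κ : ℝ, |A| ≤ ρ → |κ| ≤ 1 → Continuous (phaseSol G G₂ y₀ A κ) := by
    intro A κ hA hκ
    have hp := hpair A κ hA hκ
    exact (planarSol_spec hp.cont_a hp.cont_b hp.bound_a hp.bound_b y₀).2.continuous
  have c1 := hcont A κ hA hκ
  have c2 := hcont A μ hA hμ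
  have c3 := hcont A' κ' hA' hκ'
  have c4 := hcont A' μ' hA' hμ'
  have c5 := h.continuous_phaseA hA
  have c6 := h.continuous_phaseA hA'
  unfold phaseIntegral
  rw [← intervalIntegral.integral_sub (Continuous.intervalIntegrable (by fun_prop) _ _)
    (Continuous.intervalIntegrable (by fun_prop) _ _)]
  have key : ∀ θ ∈ uIoc (0 : ℝ) π, ‖phaseA G A θ * (phaseSol G G₂ y₀ A κ θ).1 *
      (phaseSol G G₂ y₀ A μ θ).1 - phaseA G A' θ * (phaseSol G G₂ y₀ A' κ' θ).1 *
      (phaseSol G G₂ y₀ A' μ' θ).1‖ ≤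
      (Λ ^ 2 * (2 * Λ) + Λ ^ 3) * (|A - A'| + |κ - κ'| + |μ - μ'|) := by
    intro θ hθ
    rw [uIoc_of_le pi_pos.le] at hθ
    have hθ' : θ ∈ Icc 0 π := ⟨hθ.1.le, hθ.2⟩
    obtain ⟨s1, s2, s3⟩ := hlip y₀ hy₀ θ hθ' A κ hA hκ
    obtain ⟨s4, s5⟩ := s3 A' κ' hA' hκ'
    obtain ⟨t1, -, t3⟩ := hlip y₀ hy₀ θ hθ' A μ hA hμ
    obtain ⟨-, t5⟩ := t3 A' μ' hA' hμ'
    obtain ⟨r1, r2, -⟩ := hlip y₀ hy₀ θ hθ' A' κ' hA' hκ'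
    have p1 := abs_mul_sub_mul_le r2 ((norm_fst_le _).trans s1) s4 ((norm_fst_le _).trans s5)
    have p2 : |phaseA G A' θ * (phaseSol G G₂ y₀ A' κ' θ).1| ≤ Λ * Λ := by
      rw [abs_mul]
      exact mul_le_mul r2 ((norm_fst_le _).trans r1) (abs_nonneg _) hΛ.le
    have q1 := (norm_fst_le _).trans t1
    have q2 := (norm_fst_le _).trans t5
    rw [Real.norm_eq_abs] at q1 q2 ⊢
    rw [show ∀ x y x' y' : ℝ, x * y - x' * y' = (x - x') * y + x' * (y - y') from
      fun x y x' y' => by ring]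
    refine (abs_add_le _ _).trans ?_
    rw [abs_mul, abs_mul]
    have m1 := mul_le_mul p1 q1 (abs_nonneg _) ((abs_nonneg _).trans p1)
    have m2 := mul_le_mul p2 q2 (abs_nonneg _) (by positivity)
    simp only [Prod.fst_sub] at m1 m2
    have n1 := abs_nonneg (A - A')
    have n2 := abs_nonneg (κ - κ')
    have n3 := abs_nonneg (μ - μ')
    refine (add_le_add m1 m2).trans ?_
    have e : (Λ ^ 2 * (2 * Λ) + Λ ^ 3) * (|A - A'| + |κ - κ'| + |μ - μ'|) -
      (Λ * (Λ * |A - A'| + Λ * (|A - A'| + |κ - κ'|)) * Λ +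
        Λ * Λ * (Λ * (|A - A'| + |μ - μ'|))) =
        Λ ^ 3 * (2 * |κ - κ'| + 2 * |μ - μ'|) := by ring
    have : 0 ≤ Λ ^ 3 * (2 * |κ - κ'| + 2 * |μ - μ'|) := by positivity
    linarith
  have := intervalIntegral.norm_integral_le_of_norm_le_const key
  rw [sub_zero, abs_of_pos pi_pos] at this
  refine this.trans (le_of_eq (by ring))

theorem phaseSol_spec (h : IsPhaseDensity G G₂ ρ L) (y₀ : ℝ × ℝ) {A κ : ℝ} (hA : |A| ≤ ρ)
    (hκ : |κ| ≤ 1) : phaseSol G G₂ y₀ A κ 0 = y₀ ∧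
      IsPlanarSol (phaseA G A) (phaseB G G₂ A κ) (phaseSol G G₂ y₀ A κ) := by
  obtain ⟨M, hM, hMG, hpair⟩ := h.exists_bound
  have hp := hpair A κ hA hκ
  exact planarSol_spec hp.cont_a hp.cont_b hp.bound_a hp.bound_b y₀

theorem phaseSol_eq (h : IsPhaseDensity G G₂ ρ L) {y₀ : ℝ × ℝ} {A κ : ℝ} (hA : |A| ≤ ρ)
    (hκ : |κ| ≤ 1) {y : ℝ → ℝ × ℝ} (hy : IsPlanarSol (phaseA G A) (phaseB G G₂ A κ) y)
    (h0 : y 0 = y₀) : phaseSol G G₂ y₀ A κ = y := by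
  obtain ⟨M, hM, hMG, hpair⟩ := h.exists_bound
  obtain ⟨h1, h2⟩ := h.phaseSol_spec y₀ hA hκ
  exact (hpair A κ hA hκ).ext h2 hy (θ₀ := 0) (by rw [h1, h0])

/-- Lagrange's identity over half a period. -/
theorem phase_wronskian (h : IsPhaseDensity G G₂ ρ L) (y₀ : ℝ × ℝ) {A κ μ : ℝ} (hA : |A| ≤ ρ)
    (hκ : |κ| ≤ 1) (hμ : |μ| ≤ 1) :
    (phaseSol G G₂ y₀ A κ π).1 * (phaseSol G G₂ y₀ A μ π).2 -
      (phaseSol G G₂ y₀ A κ π).2 * (phaseSol G G₂ y₀ A μ π).1 =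
      4 * (κ - μ) * phaseIntegral G G₂ y₀ A κ μ := by
  obtain ⟨h1, h2⟩ := h.phaseSol_spec y₀ hA hκ
  obtain ⟨h3, h4⟩ := h.phaseSol_spec y₀ hA hμ
  have := h2.wronskian_integral (h.continuous_phaseB hA κ) (h.continuous_phaseB hA μ) h4 π
  rw [h1, h3] at this
  rw [show y₀.1 * y₀.2 - y₀.2 * y₀.1 = 0 by ring, sub_zero] at this
  rw [this, phaseIntegral, ← intervalIntegral.integral_const_mul]
  congr 1; ext θ
  simp only [phaseB, phaseA]; ring

/-! ### Explicit solutions without coupling -/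

/-- Without coupling, Hill's equation is the linearisation of the equation of motion along the
orbit, so the velocity `-A sin θ` solves it. Division by `-A` and normalisation give a formula that
also holds at `A = 0`. -/
theorem phaseSol_sin_zero (h : IsPhaseDensity G G₂ ρ L) {A : ℝ} (hA : |A| ≤ ρ) :
    phaseSol G G₂ (0, 1) A 0 = fun θ => (G A * sin θ, G A * (cos θ / G (A * cos θ))) := by
  have hGA := h.pos A hA
  refine h.phaseSol_eq hA (by simp) (.mk' (fun θ => ?_) (fun θ => ?_)) ?_
  · have hG := (h.pos _ (abs_mul_cos_le hA θ)).ne'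
    convert! (hasDerivAt_sin θ).const_mul (G A) using 1
    simp only [phaseA]; field_simp
  · have hG := (h.pos _ (abs_mul_cos_le hA θ)).ne'
    have hd : HasDerivAt (fun θ => G (A * cos θ)) (G₂ (A * cos θ) * (A * -sin θ)) θ :=
      (h.deriv _ (abs_mul_cos_le hA θ)).comp θ ((hasDerivAt_cos θ).const_mul A)
    convert! (((hasDerivAt_cos θ).div hd hG)).const_mul (G A) using 1
    simp only [phaseB, restoringCoeff]; field_simp; ring
  · simp; field_simp

/-- The derivative with respect to the amplitude of the time as a function of the phase. -/
def phaseTimeDeriv (G₂ : ℝ → ℝ) (A θ : ℝ) : ℝ := ∫ s in (0 : ℝ)..θ, G₂ (A * cos s) * cos s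

/-- The second solution of the linearised equation is the derivative of the orbit `g (A cos θ)` in
the amplitude at fixed time. The phase then moves with `A` so that `∫₀^θ G (A cos s) ds` stays
constant, which contributes the term with `phaseTimeDeriv`. -/
theorem phaseSol_cos_zero (h : IsPhaseDensity G G₂ ρ L) {A : ℝ} (hA : |A| ≤ ρ) :
    phaseSol G G₂ (1, 0) A 0 = fun θ =>
      ((G A)⁻¹ * (G (A * cos θ) * cos θ + A * sin θ * phaseTimeDeriv G₂ A θ),
        (G A)⁻¹ * (-sin θ + A * cos θ * phaseTimeDeriv G₂ A θ / G (A * cos θ))) := by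
  have hGA := h.pos A hA
  have hT : ∀ θ, HasDerivAt (phaseTimeDeriv G₂ A) (G₂ (A * cos θ) * cos θ) θ := fun θ =>
    (((h.continuous_comp h.cont hA).mul continuous_cos).integral_hasStrictDerivAt 0 θ).hasDerivAt
  have hd : ∀ θ, HasDerivAt (fun θ => G (A * cos θ)) (G₂ (A * cos θ) * (A * -sin θ)) θ :=
    fun θ => (h.deriv _ (abs_mul_cos_le hA θ)).comp θ ((hasDerivAt_cos θ).const_mul A)
  refine h.phaseSol_eq hA (by simp) (.mk' (fun θ => ?_) (fun θ => ?_)) ?_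
  · have hG := (h.pos _ (abs_mul_cos_le hA θ)).ne'
    convert! ((((hd θ).mul (hasDerivAt_cos θ))).add
      (((hasDerivAt_sin θ).const_mul A).mul (hT θ))).const_mul (G A)⁻¹ using 1
    simp only [phaseA]; field_simp; ring
  · have hG := (h.pos _ (abs_mul_cos_le hA θ)).ne'
    convert! (((hasDerivAt_sin θ).neg).add
      ((((hasDerivAt_cos θ).const_mul A).mul (hT θ)).div (hd θ) hG)).const_mul (G A)⁻¹ using 1
    simp only [phaseB, restoringCoeff, Pi.mul_apply]; field_simp; ring
  · simp [phaseTimeDeriv, hGA.ne']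

end IsPhaseDensity

/-! ### Half-period values near zero amplitude and the transition parameter. -/

namespace IsPhaseDensity

variable {G G₂ : ℝ → ℝ} {ρ L : ℝ}

/-- At `A = κ = 0` the coefficients are the constants `G 0` and `1 / G 0` and the first component is
`cos θ`. The integral is positive here, hence on a neighbourhood by its Lipschitz bound; all signs
of the transition analysis come from this. -/
theorem phaseIntegral_cos_zero (h : IsPhaseDensity G G₂ ρ L) :
    phaseIntegral G G₂ (1, 0) 0 0 0 = G 0 * (π / 2) := by
  have h0 := (h.pos 0 h.zero_mem).ne'
  have : ∀ θ, phaseA G 0 θ * (phaseSol G G₂ (1, 0) 0 0 θ).1 * (phaseSol G G₂ (1, 0) 0 0 θ).1 =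
      G 0 * cos θ ^ 2 := by
    intro θ
    rw [h.phaseSol_cos_zero h.zero_mem]
    simp [phaseA]; field_simp
  simp only [phaseIntegral, this, intervalIntegral.integral_const_mul, integral_cos_sq]
  simp

theorem phaseIntegral_sin_zero (h : IsPhaseDensity G G₂ ρ L) :
    phaseIntegral G G₂ (0, 1) 0 0 0 = G 0 ^ 3 * (π / 2) := by
  have : ∀ θ, phaseA G 0 θ * (phaseSol G G₂ (0, 1) 0 0 θ).1 * (phaseSol G G₂ (0, 1) 0 0 θ).1 =
      G 0 ^ 3 * sin θ ^ 2 := by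
    intro θ
    rw [h.phaseSol_sin_zero h.zero_mem]
    simp [phaseA]; ring
  simp only [phaseIntegral, this, intervalIntegral.integral_const_mul, integral_sin_sq]
  simp

theorem phaseSol_cos_zero_pi (h : IsPhaseDensity G G₂ ρ L) :
    phaseSol G G₂ (1, 0) 0 0 π = (-1, 0) := by
  have h0 := (h.pos 0 h.zero_mem).ne'
  rw [h.phaseSol_cos_zero h.zero_mem]
  simp [h0]

theorem phaseSol_sin_zero_pi (h : IsPhaseDensity G G₂ ρ L) :
    phaseSol G G₂ (0, 1) 0 0 π = (0, -1) := by
  have h0 := (h.pos 0 h.zero_mem).ne'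
  rw [h.phaseSol_sin_zero h.zero_mem]
  simp; field_simp

theorem abs_div_sub_div_le {x y x' y' c C δ : ℝ} (hc : 0 < c) (hy : c ≤ y) (hy' : c ≤ y')
    (hx' : |x'| ≤ C) (hx : |x - x'| ≤ δ) (hyy : |y - y'| ≤ δ) :
    |x / y - x' / y'| ≤ (1 / c + C / c ^ 2) * δ := by
  have h1 : 0 < y := hc.trans_le hy
  have h2 : 0 < y' := hc.trans_le hy'
  have hδ : 0 ≤ δ := (abs_nonneg _).trans hx
  have e : x / y - x' / y' = (x - x') / y + x' * (y' - y) / (y * y') := by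
    field_simp; ring
  rw [e]
  refine (abs_add_le _ _).trans ?_
  rw [abs_div, abs_div, abs_mul, abs_of_pos h1, abs_of_pos (mul_pos h1 h2), abs_sub_comm y' y]
  have t1 : |x - x'| / y ≤ δ / c := div_le_div₀ hδ hx hc hy
  have hC : 0 ≤ C := (abs_nonneg _).trans hx'
  have t2 : |x'| * |y - y'| / (y * y') ≤ C * δ / (c * c) :=
    div_le_div₀ (by positivity) (mul_le_mul hx' hyy (abs_nonneg _) hC) (by positivity)
      (mul_le_mul hy hy' hc.le h1.le)
  refine (add_le_add t1 t2).trans (le_of_eq (by ring))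

/-- The parameter at which a half-period solution closes up, as a function of the amplitude. -/
theorem exists_transition (h : IsPhaseDensity G G₂ ρ L) :
    ∃ (A₁ d Λ : ℝ) (κs H : ℝ → ℝ), 0 < A₁ ∧ A₁ ≤ ρ ∧ 0 < d ∧ d ≤ 1 ∧ 0 < Λ ∧
      (∀ A, |A| < A₁ → |κs A| < d ∧
        (∀ κ, |κ| ≤ d → ∃ m m' : ℝ, 0 < m ∧ 0 < m' ∧
          (phaseSol G G₂ (1, 0) A κ π).2 = m * (κ - κs A) ∧
          (phaseSol G G₂ (0, 1) A κ π).1 = -m' * κ ∧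
          -1 < (phaseSol G G₂ (1, 0) A κ π).2 * (phaseSol G G₂ (0, 1) A κ π).1) ∧
        κs A = (phaseSol G G₂ (1, 0) A 0 π).2 * H A ∧
        ∀ B, |B| < A₁ → |H A - H B| ≤ Λ * |A - B| ∧ |κs A - κs B| ≤ Λ * |A - B|) ∧
      H 0 = -1 / (2 * π * G 0) ∧ κs 0 = 0 := by
  obtain ⟨Λ₁, hΛ₁, hsol⟩ := h.exists_phaseSol_lipschitz
  obtain ⟨Λ₂, hΛ₂, hint⟩ := h.exists_phaseIntegral_lipschitz
  have hρ := h.ρ_pos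
  have hG0 := h.pos 0 h.zero_mem
  have n10 : ‖((1 : ℝ), (0 : ℝ))‖ ≤ 1 := by simp [Prod.norm_def]
  have n01 : ‖((0 : ℝ), (1 : ℝ))‖ ≤ 1 := by simp [Prod.norm_def]
  have hπ : π ∈ Icc 0 π := ⟨pi_pos.le, le_rfl⟩
  set ι : ℝ := G 0 * (π / 2) with hι
  set ι' : ℝ := G 0 ^ 3 * (π / 2) with hι'
  have hιpos : 0 < ι := by positivity
  have hι'pos : 0 < ι' := by positivity
  -- The bound `1 / (4 Λ₁)` keeps the half-period values within `1 / 2` of those at the origin of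
  -- parameter space, and `min ι ι' / (6 Λ₂)` keeps both integrals above half of theirs.
  set d : ℝ := min (min ρ 1) (min (1 / (4 * Λ₁)) (min ι ι' / (6 * Λ₂))) with hd
  have hdpos : 0 < d := by
    simp only [hd, lt_min_iff]
    refine ⟨⟨hρ, one_pos⟩, by positivity, div_pos (lt_min hιpos hι'pos) (by positivity)⟩
  have hdρ : d ≤ ρ := (min_le_left _ _).trans (min_le_left _ _)
  have hd1 : d ≤ 1 := (min_le_left _ _).trans (min_le_right _ _)
  have hdΛ₁ : Λ₁ * (d + d) ≤ 1 / 2 := by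
    have : d ≤ 1 / (4 * Λ₁) := (min_le_right _ _).trans (min_le_left _ _)
    rw [le_div_iff₀ (by positivity)] at this; linarith
  have hdΛ₂ : Λ₂ * (d + d + d) ≤ min ι ι' / 2 := by
    have : d ≤ min ι ι' / (6 * Λ₂) := (min_le_right _ _).trans (min_le_right _ _)
    rw [le_div_iff₀ (by positivity)] at this; linarith
  have hdι : Λ₂ * (d + d + d) ≤ ι / 2 := hdΛ₂.trans (by linarith [min_le_left ι ι'])
  have hdι' : Λ₂ * (d + d + d) ≤ ι' / 2 := hdΛ₂.trans (by linarith [min_le_right ι ι'])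
  have z1 : |(0 : ℝ)| ≤ 1 := by simp
  have zd : |(0 : ℝ)| ≤ d := by simpa using hdpos.le
  -- values at half a period
  have hC : ∀ A κ : ℝ, |A| ≤ d → |κ| ≤ d →
      |(phaseSol G G₂ (1, 0) A κ π).1 + 1| ≤ 1 / 2 ∧ |(phaseSol G G₂ (1, 0) A κ π).2| ≤ 1 / 2 := by
    intro A κ hA hκ
    have h1 := ((hsol (1, 0) n10 π hπ A κ (hA.trans hdρ) (hκ.trans hd1)).2.2 0 0
      h.zero_mem z1).2
    rw [h.phaseSol_cos_zero_pi, sub_zero, sub_zero] at h1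
    have h2 : Λ₁ * (|A| + |κ|) ≤ 1 / 2 := by nlinarith
    have h3 := (norm_fst_le _).trans (h1.trans h2)
    have h4 := (norm_snd_le _).trans (h1.trans h2)
    simpa using And.intro h3 h4
  have hS : ∀ A κ : ℝ, |A| ≤ d → |κ| ≤ d →
      |(phaseSol G G₂ (0, 1) A κ π).1| ≤ 1 / 2 ∧ |(phaseSol G G₂ (0, 1) A κ π).2 + 1| ≤ 1 / 2 := by
    intro A κ hA hκ
    have h1 := ((hsol (0, 1) n01 π hπ A κ (hA.trans hdρ) (hκ.trans hd1)).2.2 0 0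
      h.zero_mem z1).2
    rw [h.phaseSol_sin_zero_pi, sub_zero, sub_zero] at h1
    have h2 : Λ₁ * (|A| + |κ|) ≤ 1 / 2 := by nlinarith
    have h3 := (norm_fst_le _).trans (h1.trans h2)
    have h4 := (norm_snd_le _).trans (h1.trans h2)
    simpa using And.intro h3 h4
  have hI : ∀ A κ μ : ℝ, |A| ≤ d → |κ| ≤ d → |μ| ≤ d →
      ι / 2 ≤ phaseIntegral G G₂ (1, 0) A κ μ := by
    intro A κ μ hA hκ hμ
    have h1 := hint (1, 0) n10 A κ μ 0 0 0 (hA.trans hdρ) (hκ.trans hd1) (hμ.trans hd1)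
      h.zero_mem z1 z1
    rw [h.phaseIntegral_cos_zero, sub_zero, sub_zero, sub_zero] at h1
    have h2 : Λ₂ * (|A| + |κ| + |μ|) ≤ Λ₂ * (d + d + d) := by
      apply mul_le_mul_of_nonneg_left _ hΛ₂.le; linarith
    have h3 := (abs_le.1 h1).1
    linarith
  have hJ : ∀ A κ μ : ℝ, |A| ≤ d → |κ| ≤ d → |μ| ≤ d →
      ι' / 2 ≤ phaseIntegral G G₂ (0, 1) A κ μ := by
    intro A κ μ hA hκ hμ
    have h1 := hint (0, 1) n01 A κ μ 0 0 0 (hA.trans hdρ) (hκ.trans hd1) (hμ.trans hd1)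
      h.zero_mem z1 z1
    rw [h.phaseIntegral_sin_zero, sub_zero, sub_zero, sub_zero] at h1
    have h2 : Λ₂ * (|A| + |κ| + |μ|) ≤ Λ₂ * (d + d + d) := by
      apply mul_le_mul_of_nonneg_left _ hΛ₂.le; linarith
    have h3 := (abs_le.1 h1).1
    linarith
  -- For `|A| < A₁` the value `c₂(π)` without coupling is below `d ι`. In Lagrange's identity
  -- between `0` and `±d` its contribution is then less than `2 d ι`, which `4 d` times the integral
  -- dominates, so `c₂(π)` changes sign between `κ = -d` and `κ = d`.
  set A₁ : ℝ := min d (d * ι / Λ₁) with hA₁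
  have hA₁pos : 0 < A₁ := lt_min hdpos (by positivity)
  have hA₁d : A₁ ≤ d := min_le_left _ _
  have hA₁Λ : Λ₁ * A₁ ≤ d * ι := by
    have : A₁ ≤ d * ι / Λ₁ := min_le_right _ _
    rwa [le_div_iff₀ hΛ₁, mul_comm] at this
  -- existence of the transition parameter
  have hex : ∀ A : ℝ, ∃ κ : ℝ, |A| < A₁ → |κ| < d ∧ (phaseSol G G₂ (1, 0) A κ π).2 = 0 := by
    intro A
    by_cases hA : |A| < A₁
    swap
    · exact ⟨0, fun hA' => absurd hA' hA⟩
    have hAd : |A| ≤ d := hA.le.trans hA₁d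
    have hAρ := hAd.trans hdρ
    have hcont : ContinuousOn (fun κ => (phaseSol G G₂ (1, 0) A κ π).2) (Icc (-d) d) := by
      refine (LipschitzOnWith.of_dist_le_mul (K := ⟨Λ₁, hΛ₁.le⟩) fun κ hκ μ hμ => ?_).continuousOn
      have := ((hsol (1, 0) n10 π hπ A κ hAρ ((abs_le.2 hκ).trans hd1)).2.2 A μ hAρ
        ((abs_le.2 hμ).trans hd1)).2
      rw [sub_self, abs_zero, zero_add] at this
      exact (norm_snd_le _).trans this
    have hc2 : |(phaseSol G G₂ (1, 0) A 0 π).2| ≤ Λ₁ * |A| := by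
      have h1 := ((hsol (1, 0) n10 π hπ A 0 hAρ z1).2.2 0 0 h.zero_mem z1).2
      rw [h.phaseSol_cos_zero_pi, sub_zero, sub_zero, abs_zero, add_zero] at h1
      simpa using (norm_snd_le _).trans h1
    have hc0 := abs_le.1 (hC A 0 hAd zd).1
    have hsign : ∀ μ : ℝ, |μ| ≤ d → ∃ w : ℝ, |w| < 2 * d * ι ∧
        (phaseSol G G₂ (1, 0) A 0 π).1 * (phaseSol G G₂ (1, 0) A μ π).2 =
        w - 4 * μ * phaseIntegral G G₂ (1, 0) A 0 μ := by
      intro μ hμ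
      refine ⟨(phaseSol G G₂ (1, 0) A 0 π).2 * (phaseSol G G₂ (1, 0) A μ π).1, ?_, ?_⟩
      · have h1 : |(phaseSol G G₂ (1, 0) A μ π).1| ≤ 3 / 2 := by
          have := abs_le.1 (hC A μ hAd hμ).1
          rw [abs_le]; constructor <;> linarith
        rw [abs_mul]
        have h2 := mul_le_mul hc2 h1 (abs_nonneg _) (by positivity)
        have h3 : Λ₁ * |A| ≤ Λ₁ * A₁ := mul_le_mul_of_nonneg_left hA.le hΛ₁.le
        have h4 : 0 < d * ι := by positivity
        linarith
      · have := h.phase_wronskian (1, 0) hAρ z1 (hμ.trans hd1)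
        linear_combination this
    have hdd : |d| ≤ d := by rw [abs_of_pos hdpos]
    have hdd' : |-d| ≤ d := by rw [abs_neg, abs_of_pos hdpos]
    have hpos : 0 < (phaseSol G G₂ (1, 0) A d π).2 := by
      obtain ⟨w, hw, he⟩ := hsign d hdd
      have h1 := hI A 0 d hAd zd hdd
      have h2 := (abs_lt.1 hw).2
      have h3 : d * (ι / 2) ≤ d * phaseIntegral G G₂ (1, 0) A 0 d :=
        mul_le_mul_of_nonneg_left h1 hdpos.le
      by_contra hneg
      have h4 : 0 ≤ (phaseSol G G₂ (1, 0) A 0 π).1 * (phaseSol G G₂ (1, 0) A d π).2 :=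
        mul_nonneg_of_nonpos_of_nonpos (by linarith) (not_lt.1 hneg)
      linarith
    have hneg : (phaseSol G G₂ (1, 0) A (-d) π).2 < 0 := by
      obtain ⟨w, hw, he⟩ := hsign (-d) hdd'
      have h1 := hI A 0 (-d) hAd zd hdd'
      have h2 := (abs_lt.1 hw).1
      have h3 : d * (ι / 2) ≤ d * phaseIntegral G G₂ (1, 0) A 0 (-d) :=
        mul_le_mul_of_nonneg_left h1 hdpos.le
      by_contra hneg
      have h4 : (phaseSol G G₂ (1, 0) A 0 π).1 * (phaseSol G G₂ (1, 0) A (-d) π).2 ≤ 0 :=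
        mul_nonpos_of_nonpos_of_nonneg (by linarith) (not_lt.1 hneg)
      linarith
    obtain ⟨κ, hκ, hκ0⟩ := intermediate_value_Ioo (by linarith : -d ≤ d) hcont ⟨hneg, hpos⟩
    exact ⟨κ, fun _ => ⟨abs_lt.2 hκ, hκ0⟩⟩
  choose κs hκs using hex
  have hA0 : ∀ A, |A| < A₁ → |A| ≤ d := fun A hA => hA.le.trans hA₁d
  have hκd : ∀ A, |A| < A₁ → |κs A| ≤ d := fun A hA => (hκs A hA).1.le
  -- Lagrange's identity between `κs A`, where `c₂(π)` vanishes, and `κ`. The lower bound is `4 (ι /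
  -- 2) / (3 / 2)`; it is uniform in `A`, which makes `κs` Lipschitz below, and `m > 0` makes the
  -- zero unique.
  have hm : ∀ A, |A| < A₁ → ∀ κ, |κ| ≤ d → ∃ m, 4 * ι / 3 ≤ m ∧
      (phaseSol G G₂ (1, 0) A κ π).2 = m * (κ - κs A) := by
    intro A hA κ hκ
    have hw := h.phase_wronskian (1, 0) ((hA0 A hA).trans hdρ) ((hκd A hA).trans hd1)
      (hκ.trans hd1)
    rw [(hκs A hA).2] at hw
    have h1 := abs_le.1 (hC A (κs A) (hA0 A hA) (hκd A hA)).1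
    have h2 := hI A (κs A) κ (hA0 A hA) (hκd A hA) hκ
    have hc : 0 < -(phaseSol G G₂ (1, 0) A (κs A) π).1 := by linarith
    refine ⟨4 * phaseIntegral G G₂ (1, 0) A (κs A) κ / -(phaseSol G G₂ (1, 0) A (κs A) π).1,
      ?_, ?_⟩
    · rw [le_div_iff₀ hc]
      have : 4 * ι / 3 * -(phaseSol G G₂ (1, 0) A (κs A) π).1 ≤ 4 * ι / 3 * (3 / 2) :=
        mul_le_mul_of_nonneg_left (by linarith) (by positivity)
      linarith
    · rw [div_mul_eq_mul_div, eq_div_iff hc.ne']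
      linear_combination -hw
  -- At coupling `κs B` the value `c₂(π)` is `m (κs B - κs A)` for amplitude `A` and `0` for
  -- amplitude `B`, so the Lipschitz bound in the amplitude transfers to `κs`.
  have hκlip : ∀ A B, |A| < A₁ → |B| < A₁ → |κs A - κs B| ≤ 3 * Λ₁ / (4 * ι) * |A - B| := by
    intro A B hA hB
    obtain ⟨m, hm1, hm2⟩ := hm A hA (κs B) (hκd B hB)
    have h1 := ((hsol (1, 0) n10 π hπ A (κs B) ((hA0 A hA).trans hdρ)
      ((hκd B hB).trans hd1)).2.2 B (κs B) ((hA0 B hB).trans hdρ) ((hκd B hB).trans hd1)).2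
    have h2 := (norm_snd_le _).trans h1
    rw [Prod.snd_sub, hm2, (hκs B hB).2, sub_zero, sub_self, abs_zero, add_zero,
      Real.norm_eq_abs, abs_mul] at h2
    have hm0 : 0 < m := lt_of_lt_of_le (by positivity) hm1
    rw [abs_of_pos hm0, abs_sub_comm] at h2
    rw [div_mul_eq_mul_div, le_div_iff₀ (by positivity)]
    have := mul_le_mul_of_nonneg_right hm1 (abs_nonneg (κs A - κs B))
    linarith
  set Λκ := 3 * Λ₁ / (4 * ι) with hΛκ
  have hΛκ0 : 0 < Λκ := by positivity
  -- The quotient `κs A / c₂(π)`, with `c₂` taken without coupling, as given by Lagrange's identity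
  -- between the couplings `0` and `κs A`. It stays defined and Lipschitz where both terms of the
  -- quotient vanish.
  set H : ℝ → ℝ := fun A =>
    (phaseSol G G₂ (1, 0) A (κs A) π).1 / (4 * phaseIntegral G G₂ (1, 0) A 0 (κs A)) with hH
  have hκeq : ∀ A, |A| < A₁ → κs A = (phaseSol G G₂ (1, 0) A 0 π).2 * H A := by
    intro A hA
    have hw := h.phase_wronskian (1, 0) ((hA0 A hA).trans hdρ) z1 ((hκd A hA).trans hd1)
    rw [(hκs A hA).2] at hw
    have h2 := hI A 0 (κs A) (hA0 A hA) zd (hκd A hA)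
    have h3 : 0 < 4 * phaseIntegral G G₂ (1, 0) A 0 (κs A) := by linarith
    rw [hH, ← mul_div_assoc, eq_div_iff h3.ne']
    linear_combination hw
  have hz : |(0 : ℝ)| < A₁ := by simpa using hA₁pos
  have hκ0 : κs 0 = 0 := by rw [hκeq 0 hz, h.phaseSol_cos_zero_pi]; simp
  set δ := Λ₁ * (1 + Λκ) + 4 * (Λ₂ * (1 + Λκ)) with hδ
  refine ⟨A₁, d, Λκ + (1 / (2 * ι) + (3 / 2) / (2 * ι) ^ 2) * δ, κs, H, hA₁pos,
    hA₁d.trans hdρ, hdpos, hd1, by positivity, ?_, ?_, hκ0⟩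
  · intro A hA
    refine ⟨(hκs A hA).1, fun κ hκ => ?_, hκeq A hA, fun B hB => ⟨?_, ?_⟩⟩
    · obtain ⟨m, hm1, hm2⟩ := hm A hA κ hκ
      have hw := h.phase_wronskian (0, 1) ((hA0 A hA).trans hdρ) z1 (hκ.trans hd1)
      have h1 := abs_le.1 (hS A 0 (hA0 A hA) zd).2
      have h2 := hJ A 0 κ (hA0 A hA) zd hκ
      have hs : 0 < -(phaseSol G G₂ (0, 1) A 0 π).2 := by linarith
      -- Time translation forces `s₁(π) = 0` without coupling at every amplitude, so the second
      -- transition curve is the line `κ = 0`.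
      have hs0 : (phaseSol G G₂ (0, 1) A 0 π).1 = 0 := by
        rw [h.phaseSol_sin_zero ((hA0 A hA).trans hdρ)]; simp
      rw [hs0] at hw
      refine ⟨m, 4 * phaseIntegral G G₂ (0, 1) A 0 κ / -(phaseSol G G₂ (0, 1) A 0 π).2,
        lt_of_lt_of_le (by positivity) hm1, div_pos (by linarith) hs, hm2, ?_, ?_⟩
      · rw [neg_mul, div_mul_eq_mul_div, ← neg_div, eq_div_iff hs.ne']
        linear_combination hw
      · have h3 := (hC A κ (hA0 A hA) hκ).2
        have h4 := (hS A κ (hA0 A hA) hκ).1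
        have h5 : |(phaseSol G G₂ (1, 0) A κ π).2 * (phaseSol G G₂ (0, 1) A κ π).1| ≤
            1 / 2 * (1 / 2) := by
          rw [abs_mul]; exact mul_le_mul h3 h4 (abs_nonneg _) (by norm_num)
        linarith [(abs_le.1 h5).1]
    · have hAρ := (hA0 A hA).trans hdρ
      have hBρ := (hA0 B hB).trans hdρ
      have hκA := (hκd A hA).trans hd1
      have hκB := (hκd B hB).trans hd1
      have hk := hκlip A B hA hB
      have n1 := abs_nonneg (A - B)
      have p1 : |(phaseSol G G₂ (1, 0) A (κs A) π).1 - (phaseSol G G₂ (1, 0) B (κs B) π).1| ≤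
          δ * |A - B| := by
        have h1 := ((hsol (1, 0) n10 π hπ A (κs A) hAρ hκA).2.2 B (κs B) hBρ hκB).2
        have h2 := (norm_fst_le _).trans h1
        refine h2.trans ?_
        have h3 : Λ₁ * (|A - B| + |κs A - κs B|) ≤ Λ₁ * (|A - B| + Λκ * |A - B|) :=
          mul_le_mul_of_nonneg_left (by linarith) hΛ₁.le
        have h4 : 0 ≤ 4 * (Λ₂ * (1 + Λκ)) * |A - B| := by positivity
        rw [hδ]; linarith
      have p2 : |4 * phaseIntegral G G₂ (1, 0) A 0 (κs A) -
          4 * phaseIntegral G G₂ (1, 0) B 0 (κs B)| ≤ δ * |A - B| := by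
        have h1 := hint (1, 0) n10 A 0 (κs A) B 0 (κs B) hAρ z1 hκA hBρ z1 hκB
        rw [sub_self, abs_zero, add_zero] at h1
        rw [← mul_sub, abs_mul, abs_of_pos (by norm_num : (0 : ℝ) < 4)]
        have h3 : Λ₂ * (|A - B| + |κs A - κs B|) ≤ Λ₂ * (|A - B| + Λκ * |A - B|) :=
          mul_le_mul_of_nonneg_left (by linarith) hΛ₂.le
        have h4 : 0 ≤ Λ₁ * (1 + Λκ) * |A - B| := by positivity
        rw [hδ]; linarith
      have p3 : |(phaseSol G G₂ (1, 0) B (κs B) π).1| ≤ 3 / 2 := by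
        have := abs_le.1 (hC B (κs B) (hA0 B hB) (hκd B hB)).1
        rw [abs_le]; constructor <;> linarith
      have i1 := hI A 0 (κs A) (hA0 A hA) zd (hκd A hA)
      have i2 := hI B 0 (κs B) (hA0 B hB) zd (hκd B hB)
      have := abs_div_sub_div_le (c := 2 * ι) (by positivity) (by linarith) (by linarith) p3 p1 p2
      refine this.trans ?_
      have : 0 ≤ Λκ * |A - B| := by positivity
      linarith
    · refine (hκlip A B hA hB).trans (mul_le_mul_of_nonneg_right ?_ (abs_nonneg _))
      have : 0 ≤ (1 / (2 * ι) + (3 / 2) / (2 * ι) ^ 2) * δ := by positivity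
      linarith
  · simp only [hH, hκ0, h.phaseIntegral_cos_zero, h.phaseSol_cos_zero_pi]
    congr 1; ring

end IsPhaseDensity

/-! ### The energy coordinate of a potential well -/

/-- `g` is the inverse of the coordinate `h` with `V = h ^ 2 / 2`. -/
structure IsEnergyChart (V g : ℝ → ℝ) (R s : ℝ) : Prop where
  R_pos : 0 < R
  s_pos : 0 < s
  zero : g 0 = 0
  analytic : ∀ u, |u| < R → AnalyticAt ℝ g u
  analyticV : ∀ u, |u| < R → AnalyticAt ℝ V (g u)
  deriv_pos : ∀ u, |u| < R → 0 < deriv g u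
  energy : ∀ u, |u| < R → V (g u) = u ^ 2 / 2
  inv : ∀ x, 0 < x → x < s → ∀ A, 0 < A → V x = A ^ 2 / 2 → x = g A

theorem potCoeff_two (U : ℝ → ℝ) : potCoeff U 2 = iteratedDeriv 2 U 0 := by
  simp [potCoeff]

theorem IsPotential.potCoeff_two_pos {U : ℝ → ℝ} (h : IsPotential U) : 0 < potCoeff U 2 := by
  rw [potCoeff_two]; exact h.pos

/-- Taylor's formula gives `V = x ^ 2 a(x) / 2` with `a` analytic and `a(0) = V''(0) > 0`. Then `h =
x √a` has `V = h ^ 2 / 2` and `h'(0) > 0`, and `g` is its analytic local inverse. -/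
theorem IsPotential.exists_chart {V : ℝ → ℝ} (hV : IsPotential V) :
    ∃ (g : ℝ → ℝ) (R s : ℝ), IsEnergyChart V g R s := by
  obtain ⟨F, hF, hVF⟩ := hV.analytic.exists_eventuallyEq_sum_add_pow_mul 3
  set a : ℝ → ℝ := fun x => iteratedDeriv 2 V 0 + 2 * x * F x with ha
  have haan : AnalyticAt ℝ a 0 := by fun_prop
  have ha0 : 0 < a 0 := by simpa [ha] using hV.pos
  have hVa : ∀ᶠ x in 𝓝 0, V x = x ^ 2 * a x / 2 := by
    filter_upwards [hVF] with x hx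
    rw [hx]
    simp [Finset.sum_range_succ, hV.zero, hV.critical, iteratedDeriv_one, ha]
    ring
  have hapos : ∀ᶠ x in 𝓝 0, 0 < a x := haan.continuousAt.eventually (lt_mem_nhds ha0)
  -- The square root of `a` in this form is positive everywhere, so `h` is positive on positive
  -- arguments; that selects the root `h x = A` in the last field of the chart.
  set w : ℝ → ℝ := fun x => exp (log (a x) / 2) with hw
  have hwan : AnalyticAt ℝ w 0 := ((haan.log ha0).div_const (c := 2)).rexp'
  set h : ℝ → ℝ := fun x => x * w x with hh
  have hhan : AnalyticAt ℝ h 0 := analyticAt_id.mul hwan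
  have hh0 : h 0 = 0 := by simp [hh]
  have hVh : ∀ᶠ x in 𝓝 0, V x = h x ^ 2 / 2 := by
    filter_upwards [hVa, hapos] with x hx hax
    have : w x ^ 2 = a x := by
      rw [hw, ← exp_nat_mul]
      rw [show ((2 : ℕ) : ℝ) * (log (a x) / 2) = log (a x) by push_cast; ring, exp_log hax]
    rw [hx, hh, ← this]; ring
  have hdh : HasDerivAt h (w 0) 0 := by
    have := (hasDerivAt_id (0 : ℝ)).mul hwan.differentiableAt.hasDerivAt
    simpa using! this
  have hw0 : 0 < w 0 := exp_pos _
  have hdh' : deriv h 0 ≠ 0 := by rw [hdh.deriv]; exact hw0.ne'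
  set g := hhan.hasStrictDerivAt.localInverse _ _ _ hdh' with hg
  have hgan : AnalyticAt ℝ g 0 := by
    have := hhan.analyticAt_localInverse hdh'
    rwa [hh0] at this
  have hgl : ∀ᶠ x in 𝓝 0, g (h x) = x := hhan.hasStrictDerivAt.eventually_left_inverse hdh'
  have hgr : ∀ᶠ u in 𝓝 0, h (g u) = u := by
    have := hhan.hasStrictDerivAt.eventually_right_inverse hdh'
    rwa [hh0] at this
  have hg0 : g 0 = 0 := by
    have := hgl.self_of_nhds
    rwa [hh0] at this
  have hgd : 0 < deriv g 0 := by
    have := (hhan.hasStrictDerivAt.to_localInverse hdh').hasDerivAt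
    rw [hh0] at this
    rw [hg, this.deriv, hdh.deriv]; positivity
  have hgt : Tendsto g (𝓝 0) (𝓝 0) := by
    have := hgan.continuousAt.tendsto
    rwa [hg0] at this
  have hall : ∀ᶠ u in 𝓝 0, AnalyticAt ℝ g u ∧ AnalyticAt ℝ V (g u) ∧ 0 < deriv g u ∧
      V (g u) = u ^ 2 / 2 := by
    filter_upwards [hgan.eventually_analyticAt, hgt.eventually hV.analytic.eventually_analyticAt,
      hgan.deriv.continuousAt.eventually (lt_mem_nhds hgd), hgt.eventually hVh, hgr]
      with u h1 h2 h3 h4 h5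
    exact ⟨h1, h2, h3, by rw [h4, h5]⟩
  obtain ⟨R, hR, hRall⟩ := Metric.eventually_nhds_iff.1 hall
  have hwpos : ∀ x, 0 < w x := fun x => exp_pos _
  obtain ⟨s, hs, hsall⟩ := Metric.eventually_nhds_iff.1 (hVh.and hgl)
  refine ⟨g, R, s, hR, hs, hg0, fun u hu => ?_, fun u hu => ?_, fun u hu => ?_, fun u hu => ?_,
    fun x hx hxs A hA hVx => ?_⟩
  · exact (hRall (by simpa using hu)).1
  · exact (hRall (by simpa using hu)).2.1
  · exact (hRall (by simpa using hu)).2.2.1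
  · exact (hRall (by simpa using hu)).2.2.2
  · obtain ⟨h1, h2⟩ := hsall (show dist x 0 < s by simpa [abs_of_pos hx] using hxs)
    have h3 : h x = A := by
      have h4 : h x ^ 2 = A ^ 2 := by linarith
      exact (pow_left_inj₀ (mul_pos hx (hwpos x)).le hA.le two_ne_zero).1 h4
    rw [← h3, h2]

theorem exists_lipschitz_of_analyticAt {f : ℝ → ℝ} {ρ : ℝ}
    (hf : ∀ u, |u| ≤ ρ → AnalyticAt ℝ f u) :
    ∃ L : ℝ, 0 ≤ L ∧ ∀ u v, |u| ≤ ρ → |v| ≤ ρ → |f u - f v| ≤ L * |u - v| := by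
  obtain ⟨L, hL⟩ := (isCompact_Icc (a := -ρ) (b := ρ)).exists_bound_of_continuousOn
    (f := deriv f) fun u hu => (hf u (abs_le.2 hu)).deriv.continuousAt.continuousWithinAt
  refine ⟨max L 0, le_max_right _ _, fun u v hu hv => ?_⟩
  have := (convex_Icc (-ρ) ρ).norm_image_sub_le_of_norm_deriv_le
    (fun x hx => (hf x (abs_le.2 hx)).differentiableAt)
    (fun x hx => (hL x hx).trans (le_max_left L 0)) (abs_le.1 hv) (abs_le.1 hu)
  exact this

namespace IsEnergyChart

variable {V g : ℝ → ℝ} {R s : ℝ}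

theorem eventually_lt {u : ℝ} (hu : |u| < R) : ∀ᶠ v in 𝓝 u, |v| < R :=
  continuous_abs.continuousAt.eventually (gt_mem_nhds hu)

theorem hasDerivAt (h : IsEnergyChart V g R s) {u : ℝ} (hu : |u| < R) :
    HasDerivAt g (deriv g u) u := (h.analytic u hu).differentiableAt.hasDerivAt

theorem hasDerivAt_deriv (h : IsEnergyChart V g R s) {u : ℝ} (hu : |u| < R) :
    HasDerivAt (deriv g) (deriv (deriv g) u) u :=
  (h.analytic u hu).deriv.differentiableAt.hasDerivAt

theorem deriv_mul (h : IsEnergyChart V g R s) {u : ℝ} (hu : |u| < R) :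
    deriv V (g u) * deriv g u = u := by
  have h1 := (h.analyticV u hu).differentiableAt.hasDerivAt.comp u (h.hasDerivAt hu)
  have h2 : HasDerivAt (fun u : ℝ => u ^ 2 / 2) u u := by
    simpa using! (hasDerivAt_pow 2 u).div_const 2
  exact h1.unique (h2.congr_of_eventuallyEq ((eventually_lt hu).mono fun v hv => h.energy v hv))

theorem deriv_deriv_mul (h : IsEnergyChart V g R s) {u : ℝ} (hu : |u| < R) :
    iteratedDeriv 2 V (g u) * deriv g u ^ 2 + deriv V (g u) * deriv (deriv g) u = 1 := by
  have h0 : HasDerivAt (deriv V) (iteratedDeriv 2 V (g u)) (g u) := by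
    have := (h.analyticV u hu).deriv.differentiableAt.hasDerivAt
    rwa [iteratedDeriv_succ, iteratedDeriv_one]
  have h1 := (h0.comp u (h.hasDerivAt hu)).mul (h.hasDerivAt_deriv hu)
  have h2 := h1.unique ((hasDerivAt_id u).congr_of_eventuallyEq
    ((eventually_lt hu).mono fun v hv => h.deriv_mul hv))
  rw [← h2]
  simp only [Function.comp]; ring

/-- Differentiating `V (g u) = u ^ 2 / 2` twice eliminates `V` from the coefficient of Hill's
equation, leaving only `g'` and `g''`. -/
theorem mul_iteratedDeriv (h : IsEnergyChart V g R s) {u : ℝ} (hu : |u| < R) :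
    deriv g u * iteratedDeriv 2 V (g u) = restoringCoeff (deriv g) (deriv (deriv g)) u := by
  have h1 := h.deriv_deriv_mul hu
  have h2 := h.deriv_mul hu
  have h3 := (h.deriv_pos u hu).ne'
  rw [restoringCoeff, eq_div_iff (pow_ne_zero 2 h3)]
  linear_combination deriv g u * h1 - deriv (deriv g) u * h2

theorem deriv_zero_sq (h : IsEnergyChart V g R s) : potCoeff V 2 * deriv g 0 ^ 2 = 1 := by
  have h0 : |(0 : ℝ)| < R := by simpa using h.R_pos
  have h1 := h.deriv_deriv_mul h0
  have h2 := h.deriv_mul h0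
  have h3 := (h.deriv_pos 0 h0).ne'
  have h4 : deriv V (g 0) = 0 := (mul_eq_zero.1 h2).resolve_right h3
  rw [h4, h.zero] at h1
  rw [potCoeff_two]; linarith

theorem exists_phaseDensity (h : IsEnergyChart V g R s) :
    ∃ L, IsPhaseDensity (deriv g) (deriv (deriv g)) (R / 2) L := by
  have hR := h.R_pos
  have hlt : ∀ u : ℝ, |u| ≤ R / 2 → |u| < R := fun u hu => by linarith
  obtain ⟨L₁, h1, hL₁⟩ := exists_lipschitz_of_analyticAt (f := deriv g) (ρ := R / 2)
    fun u hu => (h.analytic u (hlt u hu)).deriv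
  obtain ⟨L₂, h2, hL₂⟩ := exists_lipschitz_of_analyticAt
    (f := restoringCoeff (deriv g) (deriv (deriv g))) (ρ := R / 2) fun u hu => by
      have h3 := (h.analytic u (hlt u hu)).deriv
      have h4 := (h.deriv_pos u (hlt u hu)).ne'
      exact (h3.sub (analyticAt_id.mul h3.deriv)).div (h3.pow 2) (pow_ne_zero 2 h4)
  refine ⟨L₁ + L₂, by positivity, by positivity, fun u hu => h.hasDerivAt_deriv (hlt u hu),
    fun u hu => h.deriv_pos u (hlt u hu), fun u hu => ?_, fun u v hu hv => ?_,
    fun u v hu hv => ?_⟩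
  · exact (h.analytic u (hlt u (abs_le.2 hu))).deriv.deriv.continuousAt.continuousWithinAt
  · exact (hL₁ u v hu hv).trans (mul_le_mul_of_nonneg_right (by linarith) (abs_nonneg _))
  · exact (hL₂ u v hu hv).trans (mul_le_mul_of_nonneg_right (by linarith) (abs_nonneg _))

end IsEnergyChart

/-! ### Time as a function of the phase -/

/-- The time needed to reach the phase `θ` at amplitude `A`. -/
def phaseTime (G : ℝ → ℝ) (A θ : ℝ) : ℝ := ∫ s in (0 : ℝ)..θ, phaseA G A s

/-- The phase as a function of time. -/
def phaseOf (G : ℝ → ℝ) (A : ℝ) : ℝ → ℝ := Function.invFun (phaseTime G A)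

namespace IsPhaseDensity

variable {G G₂ : ℝ → ℝ} {ρ L A : ℝ}

theorem phaseA_pos (h : IsPhaseDensity G G₂ ρ L) (hA : |A| ≤ ρ) (θ : ℝ) : 0 < phaseA G A θ :=
  h.pos _ (abs_mul_cos_le hA θ)

theorem phaseTime_zero (G : ℝ → ℝ) (A : ℝ) : phaseTime G A 0 = 0 := by simp [phaseTime]

theorem hasDerivAt_phaseTime (h : IsPhaseDensity G G₂ ρ L) (hA : |A| ≤ ρ) (θ : ℝ) :
    HasDerivAt (phaseTime G A) (phaseA G A θ) θ :=
  ((h.continuous_phaseA hA).integral_hasStrictDerivAt 0 θ).hasDerivAt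

theorem phaseTime_strictMono (h : IsPhaseDensity G G₂ ρ L) (hA : |A| ≤ ρ) :
    StrictMono (phaseTime G A) :=
  strictMono_of_hasDerivAt_pos (h.hasDerivAt_phaseTime hA) (h.phaseA_pos hA)

theorem phaseTime_continuous (h : IsPhaseDensity G G₂ ρ L) (hA : |A| ≤ ρ) :
    Continuous (phaseTime G A) :=
  continuous_iff_continuousAt.2 fun θ => (h.hasDerivAt_phaseTime hA θ).continuousAt

theorem phaseTime_neg (G : ℝ → ℝ) (A θ : ℝ) : phaseTime G A (-θ) = -phaseTime G A θ := by
  have := intervalIntegral.integral_comp_neg (f := phaseA G A) (a := 0) (b := -θ)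
  simp only [phaseA, cos_neg, neg_neg, neg_zero] at this
  rw [phaseTime, phaseTime, ← intervalIntegral.integral_symm]
  exact this

theorem phaseA_periodic (G : ℝ → ℝ) (A : ℝ) : Function.Periodic (phaseA G A) (2 * π) :=
  fun θ => by simp [phaseA]

theorem phaseTime_add_two_pi (h : IsPhaseDensity G G₂ ρ L) (hA : |A| ≤ ρ) (θ : ℝ) :
    phaseTime G A (θ + 2 * π) = phaseTime G A θ + phaseTime G A (2 * π) := by
  have hi : ∀ x y, IntervalIntegrable (phaseA G A) MeasureTheory.volume x y := fun x y =>
    (h.continuous_phaseA hA).intervalIntegrable x y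
  rw [phaseTime, ← intervalIntegral.integral_add_adjacent_intervals (hi 0 θ) (hi θ _),
    (phaseA_periodic G A).intervalIntegral_add_eq θ 0, zero_add]
  rfl

theorem phaseTime_two_pi (h : IsPhaseDensity G G₂ ρ L) (hA : |A| ≤ ρ) :
    phaseTime G A (2 * π) = 2 * phaseTime G A π := by
  have := h.phaseTime_add_two_pi hA (-π)
  rw [phaseTime_neg, show -π + 2 * π = π by ring] at this
  linarith

theorem phaseTime_pi_pos (h : IsPhaseDensity G G₂ ρ L) (hA : |A| ≤ ρ) : 0 < phaseTime G A π := by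
  have := h.phaseTime_strictMono hA pi_pos
  rwa [phaseTime_zero] at this

theorem phaseTime_surjective (h : IsPhaseDensity G G₂ ρ L) (hA : |A| ≤ ρ) :
    Function.Surjective (phaseTime G A) := by
  have hi : ∀ x y, IntervalIntegrable (phaseA G A) MeasureTheory.volume x y := fun x y =>
    (h.continuous_phaseA hA).intervalIntegrable x y
  refine (h.phaseTime_continuous hA).surjective ?_ ?_
  · exact (phaseA_periodic G A).tendsto_atTop_intervalIntegral_of_pos' (hi _ _)
      (h.phaseA_pos hA) two_pi_pos
  · exact (phaseA_periodic G A).tendsto_atBot_intervalIntegral_of_pos' (hi _ _)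
      (h.phaseA_pos hA) two_pi_pos

theorem phaseOf_phaseTime (h : IsPhaseDensity G G₂ ρ L) (hA : |A| ≤ ρ) (θ : ℝ) :
    phaseOf G A (phaseTime G A θ) = θ :=
  Function.leftInverse_invFun (h.phaseTime_strictMono hA).injective θ

theorem phaseTime_phaseOf (h : IsPhaseDensity G G₂ ρ L) (hA : |A| ≤ ρ) (t : ℝ) :
    phaseTime G A (phaseOf G A t) = t :=
  Function.rightInverse_invFun (h.phaseTime_surjective hA) t

theorem hasDerivAt_phaseOf (h : IsPhaseDensity G G₂ ρ L) (hA : |A| ≤ ρ) (t : ℝ) :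
    HasDerivAt (phaseOf G A) (phaseA G A (phaseOf G A t))⁻¹ t := by
  have hcont : Continuous (phaseOf G A) := by
    set e := (h.phaseTime_strictMono hA).orderIsoOfSurjective _ (h.phaseTime_surjective hA)
    have : phaseOf G A = e.symm := by
      funext t
      apply e.injective
      rw [e.apply_symm_apply]
      exact h.phaseTime_phaseOf hA t
    rw [this]; exact e.symm.continuous
  exact HasDerivAt.of_local_left_inverse hcont.continuousAt (h.hasDerivAt_phaseTime hA _)
    (h.phaseA_pos hA _).ne' (Eventually.of_forall (h.phaseTime_phaseOf hA))

theorem phaseOf_zero (h : IsPhaseDensity G G₂ ρ L) (hA : |A| ≤ ρ) : phaseOf G A 0 = 0 := by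
  have := h.phaseOf_phaseTime hA 0
  rwa [phaseTime_zero] at this

theorem phaseOf_add_period (h : IsPhaseDensity G G₂ ρ L) (hA : |A| ≤ ρ) (t : ℝ) :
    phaseOf G A (t + phaseTime G A (2 * π)) = phaseOf G A t + 2 * π := by
  apply (h.phaseTime_strictMono hA).injective
  rw [h.phaseTime_add_two_pi hA, h.phaseTime_phaseOf hA, h.phaseTime_phaseOf hA]

end IsPhaseDensity

/-! ### The in-phase mode -/

/-- The oscillation of energy `A ^ 2 / 2`. -/
def modeOrbit (g : ℝ → ℝ) (A t : ℝ) : ℝ := g (A * cos (phaseOf (deriv g) A t))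

namespace IsEnergyChart

variable {V g : ℝ → ℝ} {R s L A : ℝ}

/-- With `u = A cos θ` and `θ' = 1 / g'(u)`, the factor `g'(u)` cancels from the velocity. The
acceleration is `-u / g'(u)`, and this is `-V'(g u)` because `V'(g u) g'(u) = u`. -/
theorem hasDerivAt_modeOrbit (h : IsEnergyChart V g R s)
    (hp : IsPhaseDensity (deriv g) (deriv (deriv g)) (R / 2) L) (hA : |A| ≤ R / 2) (t : ℝ) :
    HasDerivAt (modeOrbit g A) (-A * sin (phaseOf (deriv g) A t)) t ∧
    HasDerivAt (fun t => -A * sin (phaseOf (deriv g) A t)) (-deriv V (modeOrbit g A t)) t := by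
  set Θ := phaseOf (deriv g) A with hΘ
  have hR := h.R_pos
  have hlt : |A * cos (Θ t)| < R := by linarith [abs_mul_cos_le hA (Θ t)]
  have hΘd := hp.hasDerivAt_phaseOf hA t
  have hne := (h.deriv_pos _ hlt).ne'
  constructor
  · have h1 := (h.hasDerivAt hlt).comp t ((hΘd.cos).const_mul A)
    convert! h1 using 1
    simp only [phaseA, ← hΘ]; field_simp
  · convert! (hΘd.sin).const_mul (-A) using 1
    have := h.deriv_mul hlt
    simp only [phaseA, modeOrbit, ← hΘ]
    rw [eq_div_of_mul_eq hne this]; field_simp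

theorem deriv_modeOrbit (h : IsEnergyChart V g R s)
    (hp : IsPhaseDensity (deriv g) (deriv (deriv g)) (R / 2) L) (hA : |A| ≤ R / 2) :
    deriv (modeOrbit g A) = fun t => -A * sin (phaseOf (deriv g) A t) :=
  funext fun t => (h.hasDerivAt_modeOrbit hp hA t).1.deriv

theorem injOn (h : IsEnergyChart V g R s) {u v : ℝ} (hu : |u| < R) (hv : |v| < R)
    (huv : g u = g v) : u = v := by
  have hmono : StrictMonoOn g (Ioo (-R) R) := by
    refine strictMonoOn_of_deriv_pos (convex_Ioo _ _)
      (fun x hx => (h.analytic x (abs_lt.2 hx)).continuousAt.continuousWithinAt) fun x hx => ?_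
    rw [interior_Ioo] at hx
    exact h.deriv_pos x (abs_lt.2 hx)
  exact hmono.injOn (abs_lt.1 hu) (abs_lt.1 hv) huv

theorem modeOrbit_periodic (hp : IsPhaseDensity (deriv g) (deriv (deriv g)) (R / 2) L)
    (hA : |A| ≤ R / 2) :
    Function.Periodic (modeOrbit g A) (phaseTime (deriv g) A (2 * π)) := fun t => by
  simp only [modeOrbit, hp.phaseOf_add_period hA, cos_add_two_pi]

/-- After any period the orbit is back at its turning value `g A`. Injectivity of `g` forces the
cosine of the phase to be `1`, so the phase is a positive multiple of `2 π`. -/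
theorem modeOrbit_minimal (h : IsEnergyChart V g R s)
    (hp : IsPhaseDensity (deriv g) (deriv (deriv g)) (R / 2) L) (hA : |A| ≤ R / 2) (hA0 : A ≠ 0)
    {T : ℝ} (hT : 0 < T) (hper : Function.Periodic (modeOrbit g A) T) :
    phaseTime (deriv g) A (2 * π) ≤ T := by
  have hR := h.R_pos
  have h1 := hper 0
  simp only [modeOrbit, zero_add, hp.phaseOf_zero hA, cos_zero, mul_one] at h1
  have h2 := h.injOn (by linarith [abs_mul_cos_le hA (phaseOf (deriv g) A T)])
    (by linarith) h1
  have h3 : cos (phaseOf (deriv g) A T) = 1 := mul_left_cancel₀ hA0 (by rw [h2, mul_one])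
  obtain ⟨k, hk⟩ := (cos_eq_one_iff _).1 h3
  have hmono := hp.phaseTime_strictMono hA
  have h4 : 0 < phaseOf (deriv g) A T := by
    rw [← hmono.lt_iff_lt, hp.phaseTime_phaseOf hA, IsPhaseDensity.phaseTime_zero]; exact hT
  have h5 : 2 * π ≤ phaseOf (deriv g) A T := by
    rw [← hk] at h4 ⊢
    have : (0 : ℝ) < k := by
      by_contra hneg
      have := mul_nonpos_of_nonpos_of_nonneg (not_lt.1 hneg) two_pi_pos.le
      linarith
    have : (1 : ℝ) ≤ k := by exact_mod_cast (show (0 : ℤ) < k by exact_mod_cast this)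
    nlinarith [pi_pos]
  have := hmono.monotone h5
  rwa [hp.phaseTime_phaseOf hA] at this

theorem abs_sqrt_le {ε ρ : ℝ} (hρ : 0 ≤ ρ) (hε : ε ≤ ρ ^ 2 / 2) : |√(2 * ε)| ≤ ρ := by
  rw [abs_of_nonneg (sqrt_nonneg _), sqrt_le_left hρ]; linarith

theorem exists_abs_le (h : IsEnergyChart V g R s) {σ : ℝ} (hσ : 0 < σ) :
    ∃ α, 0 < α ∧ ∀ u, |u| ≤ α → |g u| ≤ σ := by
  have h0 : |(0 : ℝ)| < R := by simpa using h.R_pos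
  have hc := (h.analytic 0 h0).continuousAt
  obtain ⟨α, hα, hg⟩ := Metric.continuousAt_iff.1 hc σ hσ
  refine ⟨α / 2, by positivity, fun u hu => ?_⟩
  have := hg (x := u) (by simp; linarith)
  rw [h.zero] at this
  simpa using this.le

theorem exists_mode (h : IsEnergyChart V g R s)
    (hp : IsPhaseDensity (deriv g) (deriv (deriv g)) (R / 2) L) :
    IsInPhaseMode V ((R / 2) ^ 2 / 2) (fun ε => modeOrbit g √(2 * ε))
      (fun ε => π / phaseTime (deriv g) √(2 * ε) π) := by
  have hR := h.R_pos
  have hA : ∀ ε ∈ Ioo 0 ((R / 2) ^ 2 / 2), |√(2 * ε)| ≤ R / 2 := fun ε hε =>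
    abs_sqrt_le (by positivity) hε.2.le
  have hA0 : ∀ ε ∈ Ioo 0 ((R / 2) ^ 2 / 2), 0 < √(2 * ε) := fun ε hε =>
    sqrt_pos.2 (by linarith [hε.1])
  have hT : ∀ ε ∈ Ioo 0 ((R / 2) ^ 2 / 2), 2 * π / (π / phaseTime (deriv g) √(2 * ε) π) =
      phaseTime (deriv g) √(2 * ε) (2 * π) := by
    intro ε hε
    have := hp.phaseTime_pi_pos (hA ε hε)
    rw [hp.phaseTime_two_pi (hA ε hε)]
    field_simp
  refine ⟨by positivity, fun ε hε t => ?_, fun ε hε t => ?_, fun ε hε => ⟨?_, ?_⟩, fun ε hε => ?_,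
    fun ε hε => ?_, fun ε hε T hT0 hper => ?_, ?_⟩
  · rw [h.deriv_modeOrbit hp (hA ε hε)]
    exact h.hasDerivAt_modeOrbit hp (hA ε hε) t
  · rw [h.deriv_modeOrbit hp (hA ε hε)]
    have hlt := abs_mul_cos_le (hA ε hε) (phaseOf (deriv g) √(2 * ε) t)
    rw [modeOrbit, h.energy _ (by linarith)]
    have h1 : √(2 * ε) ^ 2 = 2 * ε := sq_sqrt (by linarith [hε.1])
    have h2 := sin_sq_add_cos_sq (phaseOf (deriv g) √(2 * ε) t)
    simp only [mul_pow, neg_sq, h1]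
    linear_combination ε * h2
  · have hh := hA ε hε
    rw [modeOrbit, hp.phaseOf_zero hh, cos_zero, mul_one]
    have hmono : StrictMonoOn g (Ioo (-R) R) := by
      refine strictMonoOn_of_deriv_pos (convex_Ioo _ _)
        (fun x hx => (h.analytic x (abs_lt.2 hx)).continuousAt.continuousWithinAt) fun x hx => ?_
      rw [interior_Ioo] at hx
      exact h.deriv_pos x (abs_lt.2 hx)
    have := hmono ⟨by linarith, hR⟩ (abs_lt.1 (by linarith)) (hA0 ε hε)
    rwa [h.zero] at this
  · rw [h.deriv_modeOrbit hp (hA ε hε)]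
    simp only [hp.phaseOf_zero (hA ε hε), sin_zero, mul_zero]
  · exact div_pos pi_pos (hp.phaseTime_pi_pos (hA ε hε))
  · simp only [hT ε hε]
    exact modeOrbit_periodic hp (hA ε hε)
  · simp only [hT ε hε]
    exact h.modeOrbit_minimal hp (hA ε hε) (hA0 ε hε).ne' hT0 hper
  · rw [Metric.tendstoUniformly_iff]
    intro σ hσ
    obtain ⟨α, hα, hg⟩ := h.exists_abs_le (half_pos hσ)
    have : Ioo 0 (α ^ 2 / 2) ∈ 𝓝[>] (0 : ℝ) := Ioo_mem_nhdsGT (by positivity)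
    filter_upwards [this] with ε hε t
    have h1 := abs_mul_cos_le (abs_sqrt_le hα.le hε.2.le) (phaseOf (deriv g) √(2 * ε) t)
    have h2 := hg _ h1
    rw [dist_zero_left, modeOrbit, Real.norm_eq_abs]
    linarith

/-- Every low-energy in-phase mode is the explicit one. -/
theorem mode_unique (h : IsEnergyChart V g R s)
    (hp : IsPhaseDensity (deriv g) (deriv (deriv g)) (R / 2) L) (hV : IsPotential V)
    {ε₀ : ℝ} {Q : ℝ → ℝ → ℝ} {ω : ℝ → ℝ} (hQ : IsInPhaseMode V ε₀ Q ω) :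
    ∃ r, 0 < r ∧ r ≤ ε₀ ∧ r ≤ (R / 2) ^ 2 / 2 ∧ ∀ ε ∈ Ioo 0 r,
      Q ε = modeOrbit g √(2 * ε) ∧ ω ε = π / phaseTime (deriv g) √(2 * ε) π := by
  have hR := h.R_pos
  obtain ⟨σ', hσ', hVan⟩ := Metric.eventually_nhds_iff.1 hV.analytic.eventually_analyticAt
  set σ := min (σ' / 2) (s / 2) with hσdef
  have hs := h.s_pos
  have hσ : 0 < σ := lt_min (by linarith) (by linarith)
  have hσ1 : σ ≤ σ' / 2 := min_le_left _ _
  have hσ2 : σ ≤ s / 2 := min_le_right _ _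
  obtain ⟨C, hC0, hC⟩ := exists_lipschitz_of_analyticAt (f := deriv V) (ρ := σ) fun u hu =>
    (hVan (show dist u 0 < σ' by simp; linarith)).deriv
  obtain ⟨α, hα, hg⟩ := h.exists_abs_le hσ
  obtain ⟨r₁, hr₁, hQs⟩ : ∃ r₁ > 0, ∀ ε ∈ Ioo 0 r₁, ∀ t, |Q ε t| < σ := by
    have h1 := Metric.tendstoUniformly_iff.1 hQ.small σ hσ
    obtain ⟨r₁, hr₁, h2⟩ := mem_nhdsGT_iff_exists_Ioo_subset.1 h1
    refine ⟨r₁, hr₁, fun ε hε t => ?_⟩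
    simpa using h2 hε t
  have hε₀ := hQ.pos
  -- Nothing is known of `V` away from `0`, so uniqueness is applied in the strip `|x| ≤ σ`, where
  -- `V'` is Lipschitz. `r₁` keeps the given orbit there, `α ^ 2 / 2` the explicit one, and the last
  -- term keeps the amplitude in the chart.
  refine ⟨min (min r₁ ε₀) (min (α ^ 2 / 2) ((R / 2) ^ 2 / 2)), ?_, ?_, ?_, ?_⟩
  · exact lt_min (lt_min hr₁ hε₀) (lt_min (by positivity) (by positivity))
  · exact (min_le_left _ _).trans (min_le_right _ _)
  · exact (min_le_right _ _).trans (min_le_right _ _)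
  intro ε hε
  simp only [mem_Ioo, lt_min_iff] at hε
  obtain ⟨hε0, ⟨hε1, hε2⟩, hε3, hε4⟩ := hε
  have hεm : ε ∈ Ioo 0 ε₀ := ⟨hε0, hε2⟩
  set A := √(2 * ε) with hAdef
  have hA : |A| ≤ R / 2 := abs_sqrt_le (by positivity) hε4.le
  have hApos : 0 < A := sqrt_pos.2 (by linarith)
  have hAα : |A| ≤ α := abs_sqrt_le hα.le hε3.le
  have hAsq : A ^ 2 = 2 * ε := sq_sqrt (by linarith)
  have hinit : Q ε 0 = g A := by
    obtain ⟨t1, t2⟩ := hQ.turning ε hεm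
    have he := hQ.energy ε hεm 0
    rw [t2] at he
    refine h.inv _ t1 ?_ A hApos (by rw [hAsq]; linarith)
    have := hQs ε ⟨hε0, hε1⟩ 0
    rw [abs_of_pos t1] at this
    linarith
  have hm := fun t => h.hasDerivAt_modeOrbit hp hA t
  have heq : (fun t => (Q ε t, deriv (Q ε) t)) =
      fun t => (modeOrbit g A t, -A * sin (phaseOf (deriv g) A t)) := by
    refine ODE_solution_unique_univ (v := fun (_ : ℝ) (y : ℝ × ℝ) => (y.2, -deriv V y.1))
      (K := ⟨max 1 C, by positivity⟩) (s := fun _ => {y | |y.1| ≤ σ}) (t₀ := 0) (fun t => ?_)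
      (fun t => ⟨?_, ?_⟩) (fun t => ⟨?_, ?_⟩) ?_
    · refine LipschitzOnWith.of_dist_le_mul fun y hy z hz => ?_
      rw [Prod.dist_eq]
      have hd0 : 0 ≤ dist y z := dist_nonneg
      refine max_le ?_ ?_
      · refine (le_max_right (dist y.1 z.1) (dist y.2 z.2)).trans ?_
        have : 1 * dist y z ≤ max 1 C * dist y z :=
          mul_le_mul_of_nonneg_right (le_max_left _ _) hd0
        rw [one_mul] at this
        exact this
      · rw [Real.dist_eq, neg_sub_neg, abs_sub_comm]
        refine (hC _ _ hy hz).trans ?_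
        have h1 : |y.1 - z.1| ≤ dist y z := le_max_left _ _
        exact mul_le_mul (le_max_right _ _) h1 (abs_nonneg _) (zero_le_one.trans (le_max_left 1 C))
    · exact (hQ.motion ε hεm t).1.prodMk (hQ.motion ε hεm t).2
    · exact (hQs ε ⟨hε0, hε1⟩ t).le
    · exact (hm t).1.prodMk (hm t).2
    · exact hg _ (abs_mul_cos_le hAα _)
    · simp [hinit, (hQ.turning ε hεm).2, modeOrbit, hp.phaseOf_zero hA]
  have hQeq : Q ε = modeOrbit g A := funext fun t => congrArg Prod.fst (congrFun heq t)
  refine ⟨hQeq, ?_⟩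
  have hω := hQ.freq_pos ε hεm
  have hτ := hp.phaseTime_pi_pos hA
  -- The frequency is fixed by comparing least periods in both directions.
  have h1 := hQ.minimal ε hεm (phaseTime (deriv g) A (2 * π))
    (by rw [hp.phaseTime_two_pi hA]; linarith) (by rw [hQeq]; exact modeOrbit_periodic hp hA)
  have h2 := h.modeOrbit_minimal hp hA hApos.ne' (T := 2 * π / ω ε) (by positivity)
    (by rw [← hQeq]; exact hQ.periodic ε hεm)
  have h3 := le_antisymm h1 h2
  rw [hp.phaseTime_two_pi hA] at h3
  rw [eq_div_iff hτ.ne']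
  field_simp at h3
  linarith

end IsEnergyChart

/-! ### Hill's equation along the mode -/

/-- Hill's equation along the mode of amplitude `A`, in the time variable `τ = c t`. -/
def IsModeHillSol (V g : ℝ → ℝ) (A κ c : ℝ) (η : ℝ → ℝ) : Prop :=
  ∀ τ, HasDerivAt η (deriv η τ) τ ∧ HasDerivAt (deriv η)
    (-((iteratedDeriv 2 V (modeOrbit g A (τ / c)) + 4 * κ) / c ^ 2 * η τ)) τ

/-- The even solution of Hill's equation. -/
def evenHillSol (g : ℝ → ℝ) (A κ c τ : ℝ) : ℝ :=
  (phaseSol (deriv g) (deriv (deriv g)) (1, 0) A κ (phaseOf (deriv g) A (τ / c))).1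

namespace IsEnergyChart

variable {V g : ℝ → ℝ} {R s L A κ c : ℝ} {η : ℝ → ℝ}

theorem modeOrbit_phaseTime (hp : IsPhaseDensity (deriv g) (deriv (deriv g)) (R / 2) L)
    (hA : |A| ≤ R / 2) (θ : ℝ) : modeOrbit g A (phaseTime (deriv g) A θ) = g (A * cos θ) := by
  rw [modeOrbit, hp.phaseOf_phaseTime hA]

theorem phaseB_eq (h : IsEnergyChart V g R s) (hA : |A| ≤ R / 2) (κ θ : ℝ) :
    phaseB (deriv g) (deriv (deriv g)) A κ θ =
      phaseA (deriv g) A θ * (iteratedDeriv 2 V (g (A * cos θ)) + 4 * κ) := by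
  have hR := h.R_pos
  have := h.mul_iteratedDeriv (u := A * cos θ) (by linarith [abs_mul_cos_le hA θ])
  rw [phaseB, ← this, phaseA]; ring

/-- The substitution `τ = c t`, `dt/dθ = G`. The factor `c` in the second component turns `dη/dτ`
into `dη/dt`, so the planar system does not depend on the time scale. -/
theorem isPlanarSol_of_hill (h : IsEnergyChart V g R s)
    (hp : IsPhaseDensity (deriv g) (deriv (deriv g)) (R / 2) L) (hA : |A| ≤ R / 2) (hc : c ≠ 0)
    (hη : IsModeHillSol V g A κ c η) :
    IsPlanarSol (phaseA (deriv g) A) (phaseB (deriv g) (deriv (deriv g)) A κ)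
      (fun θ => (η (c * phaseTime (deriv g) A θ), c * deriv η (c * phaseTime (deriv g) A θ))) := by
  have ht := fun θ => (hp.hasDerivAt_phaseTime hA θ).const_mul c
  refine .mk' (fun θ => ?_) (fun θ => ?_)
  · convert! (hη _).1.comp θ (ht θ) using 1
    ring
  · convert! ((hη _).2.comp θ (ht θ)).const_mul c using 1
    rw [mul_div_cancel_left₀ _ hc, modeOrbit_phaseTime hp hA, h.phaseB_eq hA]
    field_simp

theorem hill_of_isPlanarSol (h : IsEnergyChart V g R s)
    (hp : IsPhaseDensity (deriv g) (deriv (deriv g)) (R / 2) L) (hA : |A| ≤ R / 2) (hc : c ≠ 0)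
    {y : ℝ → ℝ × ℝ}
    (hy : IsPlanarSol (phaseA (deriv g) A) (phaseB (deriv g) (deriv (deriv g)) A κ) y) :
    IsModeHillSol V g A κ c (fun τ => (y (phaseOf (deriv g) A (τ / c))).1) := by
  have hΘ : ∀ τ, HasDerivAt (fun τ => phaseOf (deriv g) A (τ / c))
      ((phaseA (deriv g) A (phaseOf (deriv g) A (τ / c)))⁻¹ * (1 / c)) τ := fun τ =>
    (hp.hasDerivAt_phaseOf hA (τ / c)).comp τ ((hasDerivAt_id τ).div_const c)
  have hne := fun θ => (hp.phaseA_pos hA θ).ne'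
  have h1 : ∀ τ, HasDerivAt (fun τ => (y (phaseOf (deriv g) A (τ / c))).1)
      ((y (phaseOf (deriv g) A (τ / c))).2 / c) τ := by
    intro τ
    convert! (hy.fst _).comp τ (hΘ τ) using 1
    have := hne (phaseOf (deriv g) A (τ / c))
    field_simp
  have hd : deriv (fun τ => (y (phaseOf (deriv g) A (τ / c))).1) =
      fun τ => (y (phaseOf (deriv g) A (τ / c))).2 / c := funext fun τ => (h1 τ).deriv
  intro τ
  rw [hd]
  refine ⟨h1 τ, ?_⟩
  convert! ((hy.snd _).comp τ (hΘ τ)).div_const c using 1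
  have := hne (phaseOf (deriv g) A (τ / c))
  rw [h.phaseB_eq hA, modeOrbit]
  field_simp

theorem hill_ne_zero (hp : IsPhaseDensity (deriv g) (deriv (deriv g)) (R / 2) L)
    (hA : |A| ≤ R / 2) (hc : c ≠ 0) (hne : η ≠ 0) :
    (fun θ => (η (c * phaseTime (deriv g) A θ), c * deriv η (c * phaseTime (deriv g) A θ))) ≠
      (0 : ℝ → ℝ × ℝ) := by
  intro h0
  refine hne (funext fun τ => ?_)
  have := congrArg Prod.fst (congrFun h0 (phaseOf (deriv g) A (τ / c)))
  simpa [hp.phaseTime_phaseOf hA, mul_div_cancel₀ τ hc] using this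

/-- The product of the values at `π` that determines the trace of the monodromy matrix. -/
abbrev closing (g : ℝ → ℝ) (A κ : ℝ) : ℝ :=
  (phaseSol (deriv g) (deriv (deriv g)) (1, 0) A κ π).2 *
    (phaseSol (deriv g) (deriv (deriv g)) (0, 1) A κ π).1

theorem exists_unbounded (h : IsEnergyChart V g R s)
    (hp : IsPhaseDensity (deriv g) (deriv (deriv g)) (R / 2) L) (hA : |A| ≤ R / 2)
    (hκ : |κ| ≤ 1) (hc : c ≠ 0) (hpos : 0 < closing g A κ) :
    ∃ η, IsModeHillSol V g A κ c η ∧ ¬ ∃ C, ∀ τ, |η τ| ≤ C := by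
  obtain ⟨M, -, -, hpair⟩ := hp.exists_bound
  have hpr := hpair A κ hA hκ
  refine ⟨_, h.hill_of_isPlanarSol hp hA hc hpr.isPlanarSol_cosSol, ?_⟩
  rintro ⟨C, hC⟩
  refine hpr.cosSol_unbounded hpos ⟨C, fun θ => ?_⟩
  have := hC (c * phaseTime (deriv g) A θ)
  rwa [mul_div_cancel_left₀ _ hc, hp.phaseOf_phaseTime hA] at this

theorem hill_bounded (h : IsEnergyChart V g R s)
    (hp : IsPhaseDensity (deriv g) (deriv (deriv g)) (R / 2) L) (hA : |A| ≤ R / 2)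
    (hκ : |κ| ≤ 1) (hc : c ≠ 0) (hneg : closing g A κ < 0) (hneg' : -1 < closing g A κ)
    (hη : IsModeHillSol V g A κ c η) : ∃ C, ∀ τ, |η τ| ≤ C := by
  obtain ⟨M, -, -, hpair⟩ := hp.exists_bound
  have hpr := hpair A κ hA hκ
  obtain ⟨C, hC⟩ := hpr.bounded_of_neg hneg hneg' (h.isPlanarSol_of_hill hp hA hc hη)
  refine ⟨C, fun τ => ?_⟩
  have := hC (phaseOf (deriv g) A (τ / c))
  simpa only [hp.phaseTime_phaseOf hA, mul_div_cancel₀ τ hc] using this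

theorem hill_periodic_aux (hper : Function.Periodic η (c * phaseTime (deriv g) A (2 * π))) :
    (fun θ => (η (c * phaseTime (deriv g) A θ), c * deriv η (c * phaseTime (deriv g) A θ)))
      (2 * π) =
    (fun θ => (η (c * phaseTime (deriv g) A θ), c * deriv η (c * phaseTime (deriv g) A θ))) 0 := by
  set T := c * phaseTime (deriv g) A (2 * π) with hT
  have h1 : η T = η 0 := by simpa using hper 0
  have h2 : deriv η T = deriv η 0 := by
    have : deriv (fun x => η (x + T)) 0 = deriv η (0 + T) := deriv_comp_add_const η T 0
    rw [show (fun x => η (x + T)) = η from funext hper, zero_add] at this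
    exact this.symm
  simp only [IsPhaseDensity.phaseTime_zero, mul_zero, ← hT, h1, h2]

theorem closing_eq_zero (h : IsEnergyChart V g R s)
    (hp : IsPhaseDensity (deriv g) (deriv (deriv g)) (R / 2) L) (hA : |A| ≤ R / 2)
    (hκ : |κ| ≤ 1) (hc : c ≠ 0) (hη : IsModeHillSol V g A κ c η) (hne : η ≠ 0)
    (hper : Function.Periodic η (c * phaseTime (deriv g) A (2 * π))) : closing g A κ = 0 := by
  obtain ⟨M, -, -, hpair⟩ := hp.exists_bound
  exact (hpair A κ hA hκ).mul_eq_zero_of_periodic (h.isPlanarSol_of_hill hp hA hc hη)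
    (hill_periodic_aux hper) (hill_ne_zero hp hA hc hne)

theorem even_closing (h : IsEnergyChart V g R s)
    (hp : IsPhaseDensity (deriv g) (deriv (deriv g)) (R / 2) L) (hA : |A| ≤ R / 2)
    (hκ : |κ| ≤ 1) (hc : c ≠ 0) (hη : IsModeHillSol V g A κ c η) (hne : η ≠ 0)
    (hper : Function.Periodic η (c * phaseTime (deriv g) A (2 * π)))
    (heven : ∀ τ, η (-τ) = η τ) :
    (phaseSol (deriv g) (deriv (deriv g)) (1, 0) A κ π).2 = 0 := by
  obtain ⟨M, -, -, hpair⟩ := hp.exists_bound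
  refine (hpair A κ hA hκ).cosSol_pi_of_even (hp.phaseA_pos hA 0).ne'
    (h.isPlanarSol_of_hill hp hA hc hη) (hill_periodic_aux hper) (hill_ne_zero hp hA hc hne) ?_
  intro θ
  simp only [IsPhaseDensity.phaseTime_neg, mul_neg, heven]

theorem evenHillSol_spec (h : IsEnergyChart V g R s)
    (hp : IsPhaseDensity (deriv g) (deriv (deriv g)) (R / 2) L) (hA : |A| ≤ R / 2)
    (hκ : |κ| ≤ 1) (hc : c ≠ 0) :
    IsModeHillSol V g A κ c (evenHillSol g A κ c) ∧ evenHillSol g A κ c 0 = 1 ∧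
      (∀ τ, evenHillSol g A κ c (-τ) = evenHillSol g A κ c τ) ∧
      ((phaseSol (deriv g) (deriv (deriv g)) (1, 0) A κ π).2 = 0 →
        Function.Periodic (evenHillSol g A κ c) (c * phaseTime (deriv g) A (2 * π))) := by
  obtain ⟨M, -, -, hpair⟩ := hp.exists_bound
  have hpr := hpair A κ hA hκ
  refine ⟨h.hill_of_isPlanarSol hp hA hc hpr.isPlanarSol_cosSol, ?_, fun τ => ?_, fun h0 τ => ?_⟩
  · simp only [evenHillSol, zero_div, hp.phaseOf_zero hA, (hp.phaseSol_spec (1, 0) hA hκ).1]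
  · have hodd : phaseOf (deriv g) A (-(τ / c)) = -phaseOf (deriv g) A (τ / c) := by
      apply (hp.phaseTime_strictMono hA).injective
      rw [IsPhaseDensity.phaseTime_neg, hp.phaseTime_phaseOf hA, hp.phaseTime_phaseOf hA]
    simp only [evenHillSol, neg_div, hodd]
    have := congrArg Prod.fst (hpr.cosSol_neg (phaseOf (deriv g) A (τ / c)))
    exact this
  · simp only [evenHillSol, add_div, mul_div_cancel_left₀ _ hc, hp.phaseOf_add_period hA]
    exact congrArg Prod.fst (hpr.cosSol_periodic h0 _)

end IsEnergyChart

theorem abs_le_of_even_periodic {F : ℝ → ℝ} {B : ℝ} (heven : ∀ τ, F (-τ) = F τ)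
    (hper : Function.Periodic F (2 * π)) (hB : ∀ τ ∈ Icc 0 π, |F τ| ≤ B) (τ : ℝ) : |F τ| ≤ B := by
  obtain ⟨x, hx, hFx⟩ := hper.exists_mem_Ico (by positivity) τ (-π)
  rw [hFx]
  rcases le_total 0 x with h | h
  · exact hB x ⟨h, by linarith [hx.2]⟩
  · rw [← heven]
    exact hB (-x) ⟨by linarith, by linarith [hx.1]⟩

namespace IsEnergyChart

variable {V g : ℝ → ℝ} {R s L : ℝ}

theorem abs_phaseTime_sub_le (hp : IsPhaseDensity (deriv g) (deriv (deriv g)) (R / 2) L) {A : ℝ}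
    (hA : |A| ≤ R / 2) {θ : ℝ} (hθ : θ ∈ Icc 0 π) :
    |phaseTime (deriv g) A θ - deriv g 0 * θ| ≤ L * |A| * π := by
  have e : phaseTime (deriv g) A θ - deriv g 0 * θ =
      ∫ s in (0 : ℝ)..θ, (phaseA (deriv g) A s - deriv g 0) := by
    rw [intervalIntegral.integral_sub ((hp.continuous_phaseA hA).intervalIntegrable _ _)
      (continuous_const.intervalIntegrable _ _), intervalIntegral.integral_const, phaseTime]
    simp [mul_comm]
  have hL := hp.L_nonneg
  rw [e, ← Real.norm_eq_abs]
  refine (intervalIntegral.norm_integral_le_of_norm_le_const (C := L * |A|) fun s _ => ?_).trans ?_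
  · refine (hp.lip _ 0 (abs_mul_cos_le hA s) hp.zero_mem).trans ?_
    rw [sub_zero]
    exact mul_le_mul_of_nonneg_left (abs_mul_cos_le le_rfl s) hL
  · rw [sub_zero, abs_of_nonneg hθ.1]
    exact mul_le_mul_of_nonneg_left hθ.2 (by positivity)

/-- The even periodic solutions are uniformly close to the cosine. -/
theorem exists_evenHillSol_sub_cos_le (h : IsEnergyChart V g R s)
    (hp : IsPhaseDensity (deriv g) (deriv (deriv g)) (R / 2) L) :
    ∃ B α : ℝ, 0 < α ∧ ∀ A κ, |A| ≤ R / 2 → |A| ≤ α → |κ| ≤ 1 →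
      (phaseSol (deriv g) (deriv (deriv g)) (1, 0) A κ π).2 = 0 → ∀ τ,
      |evenHillSol g A κ (π / phaseTime (deriv g) A π) τ - cos τ| ≤ B * (|A| + |κ|) := by
  obtain ⟨Λ, hΛ, hsol⟩ := hp.exists_phaseSol_lipschitz
  have hL := hp.L_nonneg
  have hG0 := hp.pos 0 hp.zero_mem
  -- `Λ` measures the solution against the cosine of the phase, and `4 π L / g'(0)` measures the
  -- phase against `τ`. The bound on `|A|` keeps the half period above half of its value at zero
  -- amplitude.
  refine ⟨Λ + 4 * π * L / deriv g 0, deriv g 0 / (2 * (L + 1)), by positivity, ?_⟩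
  intro A κ hA hAα hκ h0 τ
  have hτ := hp.phaseTime_pi_pos hA
  set T := phaseTime (deriv g) A π with hT
  have hc : π / T ≠ 0 := by positivity
  obtain ⟨-, -, h3, h4⟩ := h.evenHillSol_spec hp hA hκ hc
  have h4 := h4 h0
  rw [hp.phaseTime_two_pi hA, ← hT, show π / T * (2 * T) = 2 * π by field_simp] at h4
  refine abs_le_of_even_periodic (F := fun τ => evenHillSol g A κ (π / T) τ - cos τ)
    (fun τ => by simp only [h3, cos_neg]) (fun τ => by simp only [h4 τ, cos_add_two_pi])
    (fun τ hτm => ?_) τ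
  -- the phase that belongs to `τ`
  set θ := phaseOf (deriv g) A (τ / (π / T)) with hθ
  have hmono := hp.phaseTime_strictMono hA
  have hτθ : τ = π / T * phaseTime (deriv g) A θ := by
    rw [hθ, hp.phaseTime_phaseOf hA, mul_div_cancel₀ τ hc]
  have hθm : θ ∈ Icc 0 π := by
    have hcpos : 0 < π / T := by positivity
    constructor
    · rw [← hmono.le_iff_le, IsPhaseDensity.phaseTime_zero]
      have := hτm.1
      rw [hτθ] at this
      exact nonneg_of_mul_nonneg_right this hcpos
    · rw [← hmono.le_iff_le, ← hT]
      have := hτm.2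
      rw [hτθ, div_mul_eq_mul_div, div_le_iff₀ hτ] at this
      exact le_of_mul_le_mul_left this pi_pos
  have hc1 : |(phaseSol (deriv g) (deriv (deriv g)) (1, 0) A κ θ).1 - cos θ| ≤
      Λ * (|A| + |κ|) := by
    have n10 : ‖((1 : ℝ), (0 : ℝ))‖ ≤ 1 := by simp [Prod.norm_def]
    have h1 := ((hsol (1, 0) n10 θ hθm A κ hA hκ).2.2 0 0 hp.zero_mem (by simp)).2
    rw [sub_zero, sub_zero] at h1
    have h2 := (norm_fst_le _).trans h1
    rw [Prod.fst_sub, hp.phaseSol_cos_zero hp.zero_mem] at h2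
    simpa [hG0.ne'] using h2
  have hTlow : deriv g 0 * π / 2 ≤ T := by
    have h1 := (abs_le.1 (abs_phaseTime_sub_le hp hA (θ := π) ⟨pi_pos.le, le_rfl⟩)).1
    have h2 : L * |A| ≤ deriv g 0 / 2 := by
      rw [le_div_iff₀ (by positivity)] at hAα
      nlinarith [abs_nonneg A]
    have h3 : L * |A| * π ≤ deriv g 0 / 2 * π := mul_le_mul_of_nonneg_right h2 pi_pos.le
    rw [← hT] at h1
    linarith
  have hdiff : |τ - θ| ≤ 4 * π * L / deriv g 0 * |A| := by
    have e : τ - θ = (π * (phaseTime (deriv g) A θ - deriv g 0 * θ) -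
        θ * (T - deriv g 0 * π)) / T := by
      rw [hτθ]; field_simp; ring
    rw [e, abs_div, abs_of_pos hτ]
    have h1 := abs_phaseTime_sub_le hp hA hθm
    have h2 := abs_phaseTime_sub_le hp hA (θ := π) ⟨pi_pos.le, le_rfl⟩
    have h3 : |π * (phaseTime (deriv g) A θ - deriv g 0 * θ) - θ * (T - deriv g 0 * π)| ≤
        2 * π ^ 2 * L * |A| := by
      refine (abs_sub _ _).trans ?_
      rw [abs_mul, abs_mul, abs_of_pos pi_pos, abs_of_nonneg hθm.1]
      have m1 := mul_le_mul_of_nonneg_left h1 pi_pos.le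
      have m2 := mul_le_mul hθm.2 h2 (abs_nonneg _) pi_pos.le
      rw [← hT] at m2
      linarith
    refine (div_le_div₀ (by positivity) h3 (by positivity) hTlow).trans (le_of_eq ?_)
    field_simp; ring
  have hcos : |cos θ - cos τ| ≤ |τ - θ| := by
    rw [abs_sub_comm]
    simpa using abs_cos_sub_cos_le τ θ
  have e : evenHillSol g A κ (π / T) τ - cos τ =
      ((phaseSol (deriv g) (deriv (deriv g)) (1, 0) A κ θ).1 - cos θ) + (cos θ - cos τ) := by
    simp only [evenHillSol, ← hθ]; ring
  rw [e]
  refine (abs_add_le _ _).trans ?_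
  have : 0 ≤ 4 * π * L / deriv g 0 * |κ| := by positivity
  linarith

end IsEnergyChart

/-! ### Analyticity of the period -/

/-- Term-by-term integration of the power series of `G`, dominated because `|A cos θ| ≤ |A|`.
Analyticity in `A` is what later allows an asymptotic relation for the period to be differentiated.
-/
theorem analyticAt_integral_comp_mul_cos {G : ℝ → ℝ} (hG : AnalyticAt ℝ G 0) :
    AnalyticAt ℝ (fun A => ∫ θ in (0 : ℝ)..π, G (A * cos θ)) 0 := by
  obtain ⟨p, hp⟩ := hG
  rw [hasFPowerSeriesAt_iff] at hp
  simp only [zero_add] at hp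
  obtain ⟨r, hr, hpr⟩ := Metric.eventually_nhds_iff.1 hp
  set u := r / 2 with hu
  have hupos : 0 < u := by positivity
  have hsum : ∀ x : ℝ, |x| ≤ u → HasSum (fun n => x ^ n • p.coeff n) (G x) := fun x hx =>
    hpr (by simp; linarith)
  have habs : Summable fun n => |u ^ n • p.coeff n| :=
    (hsum u (by rw [abs_of_pos hupos])).summable.abs
  have hmem : {A : ℝ | |A| < u} ∈ 𝓝 (0 : ℝ) :=
    (isOpen_lt continuous_abs continuous_const).mem_nhds (by simpa using hupos)
  refine ⟨FormalMultilinearSeries.ofScalars ℝ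
    (fun n => p.coeff n * ∫ θ in (0 : ℝ)..π, cos θ ^ n), ?_⟩
  rw [hasFPowerSeriesAt_iff]
  filter_upwards [hmem] with A hA
  simp only [zero_add, FormalMultilinearSeries.coeff_ofScalars]
  have hA' : |A| ≤ u := le_of_lt hA
  have key := intervalIntegral.hasSum_integral_of_dominated_convergence
    (μ := MeasureTheory.volume) (a := 0) (b := π)
    (F := fun n θ => (A * cos θ) ^ n • p.coeff n) (f := fun θ => G (A * cos θ))
    (fun n _ => |u ^ n • p.coeff n|)
    (fun n => (Continuous.aestronglyMeasurable (by fun_prop)))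
    (fun n => Eventually.of_forall fun θ _ => ?_)
    (Eventually.of_forall fun θ _ => habs) (by simp)
    (Eventually.of_forall fun θ _ => hsum _ (abs_mul_cos_le hA' θ))
  · convert! key using 2 with n
    simp only [smul_eq_mul, mul_pow]
    rw [← intervalIntegral.integral_const_mul, ← intervalIntegral.integral_const_mul]
    congr 1; ext θ; ring
  · rw [Real.norm_eq_abs, smul_eq_mul, smul_eq_mul, abs_mul, abs_mul, abs_pow, abs_pow,
      abs_of_pos hupos]
    exact mul_le_mul_of_nonneg_right
      (pow_le_pow_left₀ (abs_nonneg _) (abs_mul_cos_le hA' θ) n) (abs_nonneg _)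

namespace IsPhaseDensity

variable {G G₂ : ℝ → ℝ} {ρ L A : ℝ}

theorem hasDerivAt_phaseTime_pi (h : IsPhaseDensity G G₂ ρ L) (hA : |A| < ρ) :
    HasDerivAt (fun A => phaseTime G A π) (phaseTimeDeriv G₂ A π) A := by
  obtain ⟨C, hC⟩ := (isCompact_Icc (a := -ρ) (b := ρ)).exists_bound_of_continuousOn h.cont
  have hC0 : 0 ≤ C := (norm_nonneg _).trans (hC 0 ⟨by linarith [h.ρ_pos], h.ρ_pos.le⟩)
  have hmem : {x : ℝ | |x| < ρ} ∈ 𝓝 A := (isOpen_lt continuous_abs continuous_const).mem_nhds hA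
  refine (intervalIntegral.hasDerivAt_integral_of_dominated_loc_of_deriv_le (s := {x : ℝ | |x| < ρ})
    (F := fun x θ => phaseA G x θ) (F' := fun x θ => G₂ (x * cos θ) * cos θ)
    (bound := fun _ => C) (a := 0) (b := π) (μ := MeasureTheory.volume)
    hmem ?_ ?_ ?_ ?_ (by simp) ?_).2
  · filter_upwards [hmem] with x hx
    exact (h.continuous_phaseA (le_of_lt hx)).aestronglyMeasurable
  · exact (h.continuous_phaseA hA.le).intervalIntegrable _ _
  · exact ((h.continuous_comp h.cont hA.le).mul continuous_cos).aestronglyMeasurable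
  · refine Eventually.of_forall fun θ _ x hx => ?_
    have h1 := hC _ (abs_le.1 (abs_mul_cos_le (le_of_lt hx) θ))
    rw [norm_mul]
    calc _ ≤ C * 1 := mul_le_mul h1 (abs_cos_le_one θ) (abs_nonneg _) hC0
      _ = C := mul_one C
  · refine Eventually.of_forall fun θ _ x hx => ?_
    exact (h.deriv _ (abs_mul_cos_le (le_of_lt hx) θ)).comp x
      ((hasDerivAt_id x).mul_const (cos θ) |>.congr_deriv (one_mul _))

/-- At `θ = π` the sine terms vanish and only the amplitude derivative of the half period survives:
the even solution fails to close exactly to the extent that the period varies with the amplitude. -/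
theorem phaseSol_cos_pi_snd (h : IsPhaseDensity G G₂ ρ L) (hA : |A| ≤ ρ) :
    (phaseSol G G₂ (1, 0) A 0 π).2 = -(A * phaseTimeDeriv G₂ A π) / (G A * G (-A)) := by
  rw [h.phaseSol_cos_zero hA]
  have h1 := (h.pos A hA).ne'
  have h2 := (h.pos (-A) (by rwa [abs_neg])).ne'
  simp; field_simp

end IsPhaseDensity

/-! ### Leading power of the period variation. -/

/-- An analytic function with a prescribed leading behaviour on the right of `0`. -/
theorem exists_eq_pow_mul_of_tendsto {u : ℝ → ℝ} (hu : AnalyticAt ℝ u 0) {k : ℕ} {c : ℝ}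
    (hc : c ≠ 0) (ht : Tendsto (fun x => u x / x ^ k) (𝓝[>] 0) (𝓝 c)) :
    ∃ f : ℝ → ℝ, AnalyticAt ℝ f 0 ∧ f 0 = c ∧ ∀ᶠ x in 𝓝 0, u x = x ^ k * f x := by
  have hpos : ∀ᶠ x : ℝ in 𝓝[>] 0, 0 < x := self_mem_nhdsWithin
  have hne : ¬ ∀ᶠ x in 𝓝 0, u x = 0 := by
    intro h0
    refine hc (tendsto_nhds_unique ht (tendsto_const_nhds.congr' ?_))
    filter_upwards [h0.filter_mono nhdsWithin_le_nhds] with x hx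
    rw [hx, zero_div]
  obtain ⟨m, f, hf, hf0, hev⟩ := hu.exists_eventuallyEq_pow_smul_nonzero_iff.2 hne
  simp only [sub_zero, smul_eq_mul] at hev
  have hev' := hev.filter_mono (nhdsWithin_le_nhds (s := Ioi 0))
  have hft : Tendsto f (𝓝[>] 0) (𝓝 (f 0)) := hf.continuousAt.tendsto.mono_left nhdsWithin_le_nhds
  have hpow : ∀ j : ℕ, 0 < j → Tendsto (fun x : ℝ => x ^ j) (𝓝[>] 0) (𝓝 0) := by
    intro j hj
    have : Tendsto (fun x : ℝ => x ^ j) (𝓝 0) (𝓝 (0 ^ j)) := (continuous_pow j).tendsto 0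
    rw [zero_pow hj.ne'] at this
    exact this.mono_left nhdsWithin_le_nhds
  -- If the order `m` were below `k`, the limit would force `f 0 = 0`; if it were above, it would
  -- force `c = 0`.
  have hmk : m = k := by
    rcases lt_trichotomy m k with h | h | h
    · exfalso
      refine hf0 (tendsto_nhds_unique hft ?_)
      have := (hpow (k - m) (by omega)).mul ht
      rw [zero_mul] at this
      refine this.congr' ?_
      filter_upwards [hev', hpos] with x hx hx0
      rw [hx, ← mul_div_assoc, ← mul_assoc, ← pow_add, Nat.sub_add_cancel h.le]
      field_simp
    · exact h
    · exfalso
      refine hc (tendsto_nhds_unique ht ?_)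
      have := (hpow (m - k) (by omega)).mul hft
      rw [zero_mul] at this
      refine this.congr' ?_
      filter_upwards [hev', hpos] with x hx hx0
      rw [hx, eq_div_iff (pow_ne_zero k hx0.ne'), mul_assoc, mul_comm (f x), ← mul_assoc, ← pow_add,
        Nat.sub_add_cancel h.le]
  subst hmk
  refine ⟨f, hf, tendsto_nhds_unique hft (ht.congr' ?_), hev⟩
  filter_upwards [hev', hpos] with x hx hx0
  rw [hx]; field_simp

namespace IsEnergyChart

variable {V g : ℝ → ℝ} {R s L : ℝ}

theorem zero_lt_R (h : IsEnergyChart V g R s) : |(0 : ℝ)| < R := by simpa using h.R_pos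

theorem phaseTime_amplitude_zero (g : ℝ → ℝ) (θ : ℝ) :
    phaseTime (deriv g) 0 θ = θ * deriv g 0 := by
  simp [phaseTime, phaseA]

/-- Leading behaviour of the half period, from that of the frequency. -/
theorem tendsto_halfPeriod (h : IsEnergyChart V g R s)
    (hp : IsPhaseDensity (deriv g) (deriv (deriv g)) (R / 2) L) {n : ℕ} {γ r : ℝ} {ω : ℝ → ℝ}
    (hr : 0 < r) (hω : ∀ ε ∈ Ioo 0 r, ω ε = π / phaseTime (deriv g) √(2 * ε) π)
    (hiso : (fun ε : ℝ => ω ε ^ 2 - (potCoeff V 2 + γ * ε ^ n)) =o[𝓝[>] 0] (fun ε : ℝ => ε ^ n)) :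
    Tendsto (fun A => (phaseTime (deriv g) A π - phaseTime (deriv g) 0 π) / A ^ (2 * n))
      (𝓝[>] 0) (𝓝 (-(γ * π * deriv g 0 ^ 3) / 2 ^ (n + 1))) := by
  have hR := h.R_pos
  have hG0 := h.deriv_pos 0 h.zero_lt_R
  set τ := fun A => phaseTime (deriv g) A π with hτ
  have hτ0 : τ 0 = π * deriv g 0 := phaseTime_amplitude_zero g π
  have hcont : Tendsto τ (𝓝[>] 0) (𝓝 (τ 0)) :=
    (hp.hasDerivAt_phaseTime_pi (A := 0) (by simpa using hp.ρ_pos)).continuousAt.tendsto.mono_left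
      nhdsWithin_le_nhds
  have hsq : Tendsto (fun A : ℝ => A ^ 2 / 2) (𝓝[>] 0) (𝓝[>] 0) := by
    refine tendsto_nhdsWithin_iff.2 ⟨?_, ?_⟩
    · have : Tendsto (fun A : ℝ => A ^ 2 / 2) (𝓝 0) (𝓝 (0 ^ 2 / 2)) :=
        Continuous.tendsto (by fun_prop) 0
      simp only [ne_eq, OfNat.ofNat_ne_zero, not_false_eq_true, zero_pow, zero_div] at this
      exact this.mono_left nhdsWithin_le_nhds
    · filter_upwards [self_mem_nhdsWithin] with A hA
      have : 0 < A := hA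
      exact (show 0 < A ^ 2 / 2 by positivity)
  have h1 := (hiso.comp_tendsto hsq).tendsto_div_nhds_zero
  -- With `ω = π / τ` and `v₂ = π ^ 2 / τ₀ ^ 2`, one has `τ - τ₀ = -(ω ^ 2 - v₂) τ ^ 2 τ₀ ^ 2 / (π ^
  -- 2 (τ₀ + τ))`; this is divided by `A ^ (2n) = 2 ^ n ε ^ n`.
  have h2 : Tendsto (fun A => (γ + (ω (A ^ 2 / 2) ^ 2 - (potCoeff V 2 + γ * (A ^ 2 / 2) ^ n)) /
      (A ^ 2 / 2) ^ n) * (-(τ A ^ 2 * τ 0 ^ 2) / (π ^ 2 * (τ 0 + τ A)) / 2 ^ n)) (𝓝[>] 0)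
      (𝓝 ((γ + 0) * (-(τ 0 ^ 2 * τ 0 ^ 2) / (π ^ 2 * (τ 0 + τ 0)) / 2 ^ n))) := by
    refine (tendsto_const_nhds.add h1).mul (Tendsto.div_const (Tendsto.div ?_ ?_ ?_) _)
    · exact ((hcont.pow 2).mul_const _).neg
    · exact (tendsto_const_nhds.add hcont).const_mul _
    · rw [hτ0]; positivity
  have e : (γ + 0) * (-(τ 0 ^ 2 * τ 0 ^ 2) / (π ^ 2 * (τ 0 + τ 0)) / 2 ^ n) =
      -(γ * π * deriv g 0 ^ 3) / 2 ^ (n + 1) := by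
    rw [hτ0, pow_succ]; field_simp; ring
  rw [e] at h2
  refine h2.congr' ?_
  have hmem : Ioo 0 r ∈ 𝓝[>] (0 : ℝ) := Ioo_mem_nhdsGT hr
  have hmemA : Ioo 0 (R / 2) ∈ 𝓝[>] (0 : ℝ) := Ioo_mem_nhdsGT (by positivity)
  filter_upwards [hsq hmem, hmemA] with A hA hAR
  have hA0 : 0 < A := hAR.1
  have hAabs : |A| ≤ R / 2 := by rw [abs_of_pos hA0]; exact hAR.2.le
  have hωA := hω _ hA
  rw [show 2 * (A ^ 2 / 2) = A ^ 2 by ring, sqrt_sq hA0.le] at hωA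
  have hτA : 0 < τ A := hp.phaseTime_pi_pos hAabs
  have hτ0p : 0 < τ 0 := by rw [hτ0]; positivity
  have hv : potCoeff V 2 = π ^ 2 / τ 0 ^ 2 := by
    have := h.deriv_zero_sq
    rw [hτ0, eq_div_iff (by positivity)]
    linear_combination π ^ 2 * this
  rw [hωA, hv]
  have e1 : phaseTime (deriv g) A π = τ A := rfl
  have e2 : phaseTime (deriv g) 0 π = τ 0 := rfl
  have e3 : (A ^ 2 / 2) ^ n = A ^ (2 * n) / 2 ^ n := by rw [div_pow, pow_mul]
  rw [e1, e2, e3]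
  have hAn : A ^ (2 * n) ≠ 0 := by positivity
  have hs : τ 0 + τ A ≠ 0 := by positivity
  generalize A ^ (2 * n) = B at hAn ⊢
  field_simp
  ring

end IsEnergyChart

/-! ### The transition curve in terms of the amplitude -/

/-- Write the increment as `(B ^ k - A ^ k) F(B) + A ^ k (F(B) - F(A))`. The first term is at least
`A ^ (k-1) (B - A) c / 2`, the second at least `-Λ A ^ k (B - A)`, and the gain wins as soon as `Λ A
< c / 2`. No derivative of `F` is needed. -/
theorem exists_strictMono_pow_mul {F : ℝ → ℝ} {a c Λ : ℝ} (ha : 0 < a) (hΛ : 0 < Λ) (hc : 0 < c)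
    (hF0 : F 0 = c) (hF : ∀ A B, |A| < a → |B| < a → |F A - F B| ≤ Λ * |A - B|)
    {k : ℕ} (hk : 1 ≤ k) :
    ∃ b, 0 < b ∧ b ≤ a ∧ (∀ A, 0 < A → A < b → 0 < A ^ k * F A) ∧
      ∀ A B, 0 < A → A < B → B < b → A ^ k * F A < B ^ k * F B := by
  refine ⟨min a (c / (2 * Λ)), lt_min ha (by positivity), min_le_left _ _, ?_, ?_⟩
  all_goals
    have hlow : ∀ A, 0 < A → A < min a (c / (2 * Λ)) → c / 2 < F A ∧ A * Λ < c / 2 := by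
      intro A hA hAb
      have h1 : A < a := hAb.trans_le (min_le_left _ _)
      have h2 : A < c / (2 * Λ) := hAb.trans_le (min_le_right _ _)
      rw [lt_div_iff₀ (by positivity)] at h2
      have h3 := (abs_le.1 (hF A 0 (by rwa [abs_of_pos hA]) (by simpa using ha))).1
      rw [hF0, sub_zero, abs_of_pos hA] at h3
      constructor <;> linarith
  · intro A hA hAb
    have := (hlow A hA hAb).1
    exact mul_pos (pow_pos hA k) (by linarith)
  · intro A B hA hAB hB
    have hB0 := hA.trans hAB
    obtain ⟨h1, h2⟩ := hlow B hB0 hB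
    obtain ⟨h3, h4⟩ := hlow A hA (hAB.trans hB)
    have hBa : B < a := hB.trans_le (min_le_left _ _)
    have h5 := (abs_le.1 (hF B A (by rwa [abs_of_pos hB0]) (by rw [abs_of_pos hA]; linarith))).1
    rw [abs_of_pos (by linarith : 0 < B - A)] at h5
    obtain ⟨j, rfl⟩ : ∃ j, k = j + 1 := ⟨k - 1, by omega⟩
    have h6 : A ^ j * (B - A) ≤ B ^ (j + 1) - A ^ (j + 1) := by
      have := pow_le_pow_left₀ hA.le hAB.le j
      rw [pow_succ, pow_succ]
      nlinarith
    have hAj : 0 < A ^ j := pow_pos hA j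
    have h7 : 0 < A ^ j * (B - A) := mul_pos hAj (by linarith)
    have h8 : A ^ j * (B - A) * (c / 2) < (B ^ (j + 1) - A ^ (j + 1)) * F B :=
      lt_of_lt_of_le (mul_lt_mul_of_pos_left h1 h7)
        (mul_le_mul_of_nonneg_right h6 (by linarith))
    have h9 : -(A ^ j * (B - A) * (A * Λ)) ≤ A ^ (j + 1) * (F B - F A) := by
      have := mul_le_mul_of_nonneg_left h5 (pow_pos hA (j + 1)).le
      rw [pow_succ] at this ⊢
      linarith
    have h10 : A ^ j * (B - A) * (A * Λ) < A ^ j * (B - A) * (c / 2) :=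
      mul_lt_mul_of_pos_left h4 h7
    linarith

namespace IsEnergyChart

variable {V g : ℝ → ℝ} {R s L : ℝ}

/-- The transition parameter factors through the leading power of the amplitude. -/
theorem exists_factor (h : IsEnergyChart V g R s)
    (hp : IsPhaseDensity (deriv g) (deriv (deriv g)) (R / 2) L) {n : ℕ} {γ r : ℝ} {ω : ℝ → ℝ}
    (hn : 1 ≤ n) (hγ : γ ≠ 0)
    (hr : 0 < r) (hω : ∀ ε ∈ Ioo 0 r, ω ε = π / phaseTime (deriv g) √(2 * ε) π)
    (hiso : (fun ε : ℝ => ω ε ^ 2 - (potCoeff V 2 + γ * ε ^ n)) =o[𝓝[>] 0] (fun ε : ℝ => ε ^ n)) :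
    ∃ P : ℝ → ℝ, AnalyticAt ℝ P 0 ∧ P 0 = n * γ * π * deriv g 0 / 2 ^ n ∧
      ∀ᶠ A in 𝓝 0, (phaseSol (deriv g) (deriv (deriv g)) (1, 0) A 0 π).2 = A ^ (2 * n) * P A := by
  have hR := h.R_pos
  have hG0 := h.deriv_pos 0 h.zero_lt_R
  have hc : -(γ * π * deriv g 0 ^ 3) / 2 ^ (n + 1) ≠ 0 :=
    div_ne_zero (neg_ne_zero.2 (by positivity)) (by positivity)
  have hτan : AnalyticAt ℝ (fun A => phaseTime (deriv g) A π - phaseTime (deriv g) 0 π) 0 :=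
    (analyticAt_integral_comp_mul_cos (h.analytic 0 h.zero_lt_R).deriv).sub analyticAt_const
  obtain ⟨f, hf, hf0, hev⟩ := exists_eq_pow_mul_of_tendsto hτan hc
    (h.tendsto_halfPeriod hp hr hω hiso)
  have hGan := (h.analytic 0 h.zero_lt_R).deriv
  have hGneg : AnalyticAt ℝ (fun A => deriv g (-A)) 0 :=
    AnalyticAt.comp (g := deriv g) (by simpa using hGan) (analyticAt_id.neg)
  -- From `τ(A) - τ(0) = A ^ (2n) f(A)` follows `A τ'(A) = A ^ (2n) (2n f + A f')`.
  refine ⟨fun A => -(2 * n * f A + A * deriv f A) / (deriv g A * deriv g (-A)), ?_, ?_, ?_⟩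
  · refine AnalyticAt.div ?_ (hGan.mul hGneg) (by simp [hG0.ne'])
    exact ((analyticAt_const.mul hf).add (analyticAt_id.mul hf.deriv)).neg
  · simp only [hf0, zero_mul, add_zero, neg_zero]
    field_simp; ring
  · have hmem : {A : ℝ | |A| < R / 2} ∈ 𝓝 (0 : ℝ) :=
      (isOpen_lt continuous_abs continuous_const).mem_nhds (by simpa using hp.ρ_pos)
    filter_upwards [hmem, hev.eventually_nhds, hf.eventually_analyticAt] with A hA hevA hfA
    have hA' : |A| < R / 2 := hA
    rw [hp.phaseSol_cos_pi_snd hA'.le]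
    have h1 := (hp.hasDerivAt_phaseTime_pi hA').sub_const (phaseTime (deriv g) 0 π)
    have h2 : HasDerivAt (fun A => A ^ (2 * n) * f A)
        (((2 * n : ℕ) : ℝ) * A ^ (2 * n - 1) * f A + A ^ (2 * n) * deriv f A) A :=
      (hasDerivAt_pow (2 * n) A).mul hfA.differentiableAt.hasDerivAt
    have h3 := h1.unique (h2.congr_of_eventuallyEq hevA)
    rw [h3]
    obtain ⟨j, hj⟩ : ∃ j, 2 * n = j + 1 := ⟨2 * n - 1, by omega⟩
    have hj' : (2 * n : ℝ) = j + 1 := by exact_mod_cast hj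
    rw [hj', hj, Nat.add_sub_cancel, ← mul_div_assoc]
    congr 1
    push_cast
    ring

/-- Multiplies the analytic factor `P` of the half-period value by the Lipschitz factor `H` of
`exists_transition`. The product `F` is Lipschitz and its value at `0` carries the leading
coefficient. -/
theorem exists_transition_factor (h : IsEnergyChart V g R s)
    (hp : IsPhaseDensity (deriv g) (deriv (deriv g)) (R / 2) L) {n : ℕ} {γ r : ℝ} {ω : ℝ → ℝ}
    (hn : 1 ≤ n) (hγ : γ ≠ 0)
    (hr : 0 < r) (hω : ∀ ε ∈ Ioo 0 r, ω ε = π / phaseTime (deriv g) √(2 * ε) π)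
    (hiso : (fun ε : ℝ => ω ε ^ 2 - (potCoeff V 2 + γ * ε ^ n)) =o[𝓝[>] 0] (fun ε : ℝ => ε ^ n)) :
    ∃ (A₁ d Λ : ℝ) (κs F : ℝ → ℝ), 0 < A₁ ∧ A₁ ≤ R / 2 ∧ 0 < d ∧ d ≤ 1 ∧ 0 < Λ ∧
      (∀ A, |A| < A₁ → |κs A| < d ∧
        (∀ κ, |κ| ≤ d → ∃ m m' : ℝ, 0 < m ∧ 0 < m' ∧
          (phaseSol (deriv g) (deriv (deriv g)) (1, 0) A κ π).2 = m * (κ - κs A) ∧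
          (phaseSol (deriv g) (deriv (deriv g)) (0, 1) A κ π).1 = -m' * κ ∧
          -1 < closing g A κ) ∧
        κs A = A ^ (2 * n) * F A ∧
        ∀ B, |B| < A₁ → |F A - F B| ≤ Λ * |A - B| ∧ |κs A - κs B| ≤ Λ * |A - B|) ∧
      F 0 = -(n * γ) / 2 ^ (n + 1) ∧ κs 0 = 0 ∧
      (∀ A, 0 < A → A < A₁ → 0 < -γ * κs A) ∧
      ∀ A B, 0 < A → A < B → B < A₁ → -γ * κs A < -γ * κs B := by
  have hG0 := h.deriv_pos 0 h.zero_lt_R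
  obtain ⟨A₀, d, Λ, κs, H, hA₀, hA₀R, hd, hd1, hΛ, hall, hH0, hκ0⟩ := hp.exists_transition
  obtain ⟨P, hP, hP0, hPev⟩ := h.exists_factor hp hn hγ hr hω hiso
  obtain ⟨α, hα, hPα⟩ := Metric.eventually_nhds_iff.1 (hPev.and hP.eventually_analyticAt)
  set a := min A₀ (α / 2) with ha
  have ha0 : 0 < a := lt_min hA₀ (by positivity)
  have haA₀ : a ≤ A₀ := min_le_left _ _
  have haα : a ≤ α / 2 := min_le_right _ _
  obtain ⟨C, hC0, hC⟩ := exists_lipschitz_of_analyticAt (f := P) (ρ := a) fun u hu =>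
    (hPα (show dist u 0 < α by simp; linarith)).2
  -- bounds of the two factors
  have hz : |(0 : ℝ)| < A₀ := by simpa using hA₀
  set BP := |P 0| + C * a
  set BH := |H 0| + Λ * A₀
  have hBP : ∀ A, |A| ≤ a → |P A| ≤ BP := by
    intro A hA
    have h1 := hC A 0 hA (by simpa using ha0.le)
    rw [sub_zero] at h1
    have h2 : C * |A| ≤ C * a := mul_le_mul_of_nonneg_left hA hC0
    have h3 := abs_sub_abs_le_abs_sub (P A) (P 0)
    simp only [BP]; linarith
  have hBH : ∀ A, |A| < A₀ → |H A| ≤ BH := by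
    intro A hA
    have h1 := ((hall A hA).2.2.2 0 hz).1
    rw [sub_zero] at h1
    have h2 : Λ * |A| ≤ Λ * A₀ := mul_le_mul_of_nonneg_left hA.le hΛ.le
    have h3 := abs_sub_abs_le_abs_sub (H A) (H 0)
    simp only [BH]; linarith
  have hBP0 : 0 ≤ BP := by positivity
  have hBH0 : 0 ≤ BH := by positivity
  set Λ' := Λ + (BP * Λ + BH * C) with hΛ'
  have hΛ'0 : 0 < Λ' := by positivity
  have hF : ∀ A B, |A| < a → |B| < a → |P A * H A - P B * H B| ≤ Λ' * |A - B| := by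
    intro A B hA hB
    have h1 := hC A B hA.le hB.le
    have h2 := ((hall A (hA.trans_le haA₀)).2.2.2 B (hB.trans_le haA₀)).1
    rw [show P A * H A - P B * H B = P A * (H A - H B) + H B * (P A - P B) by ring]
    refine (abs_add_le _ _).trans ?_
    rw [abs_mul, abs_mul]
    have h3 := mul_le_mul (hBP A hA.le) h2 (abs_nonneg _) hBP0
    have h4 := mul_le_mul (hBH B (hB.trans_le haA₀)) h1 (abs_nonneg _) hBH0
    have h5 : 0 ≤ Λ * |A - B| := by positivity
    rw [hΛ']; linarith
  have hF0 : P 0 * H 0 = -(n * γ) / 2 ^ (n + 1) := by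
    rw [hP0, hH0, pow_succ]; field_simp
  have hγ2 : 0 < γ ^ 2 := by positivity
  have hn0 : (0 : ℝ) < n := by exact_mod_cast hn
  -- Multiplication by `-γ` makes the value at `0` positive, namely `n γ ^ 2 / 2 ^ (n+1)`, and so
  -- treats both signs of `γ` at once.
  obtain ⟨b, hb, hba, hpos, hmono⟩ := exists_strictMono_pow_mul (F := fun A => -γ * (P A * H A))
    (a := a) (c := n * γ ^ 2 / 2 ^ (n + 1)) (Λ := |γ| * Λ') ha0 (by positivity) (by positivity)
    (by simp only [hF0]; ring)
    (fun A B hA hB => by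
      rw [← mul_sub, abs_mul, abs_neg, mul_assoc]
      exact mul_le_mul_of_nonneg_left (hF A B hA hB) (abs_nonneg _)) (k := 2 * n) (by omega)
  have hκ : ∀ A, |A| < b → κs A = A ^ (2 * n) * (P A * H A) := by
    intro A hA
    have hAα : dist A 0 < α := by simp; linarith
    rw [(hall A (by linarith)).2.2.1, (hPα hAα).1, mul_assoc]
  refine ⟨b, d, Λ', κs, fun A => P A * H A, hb, hba.trans (haA₀.trans hA₀R), hd, hd1, hΛ'0,
    fun A hA => ?_, hF0, hκ0, fun A hA hAb => ?_, fun A B hA hAB hB => ?_⟩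
  · obtain ⟨h1, h2, -, h4⟩ := hall A (by linarith)
    refine ⟨h1, h2, hκ A hA, fun B hB => ⟨hF A B (by linarith) (by linarith), ?_⟩⟩
    refine (h4 B (by linarith)).2.trans (mul_le_mul_of_nonneg_right ?_ (abs_nonneg _))
    have : 0 ≤ BP * Λ + BH * C := by positivity
    rw [hΛ']; linarith
  · rw [hκ A (by rwa [abs_of_pos hA])]
    have := hpos A hA hAb
    linarith
  · rw [hκ A (by rw [abs_of_pos hA]; linarith), hκ B (by rw [abs_of_pos (hA.trans hAB)]; linarith)]
    have := hmono A B hA hAB hB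
    linarith

end IsEnergyChart

/-! ### The leading frequency coefficient in the generic case -/

namespace IsEnergyChart

variable {V g : ℝ → ℝ} {R s L : ℝ}

/-- In the expansion of `g'(A cos θ)` the linear term integrates to zero over `[0, π]`, and `cos ^
2` contributes `π / 2` to the quadratic one. -/
theorem tendsto_halfPeriod_sq (h : IsEnergyChart V g R s)
    (hp : IsPhaseDensity (deriv g) (deriv (deriv g)) (R / 2) L) :
    Tendsto (fun A => (phaseTime (deriv g) A π - phaseTime (deriv g) 0 π) / A ^ (2 * 1))
      (𝓝[>] 0) (𝓝 (deriv (deriv (deriv g)) 0 * π / 4)) := by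
  have hGan := (h.analytic 0 h.zero_lt_R).deriv
  obtain ⟨F, hF, hev⟩ := hGan.exists_eventuallyEq_sum_add_pow_mul 3
  have hFb : ∀ᶠ u in 𝓝 0, |F u| < |F 0| + 1 :=
    hF.continuousAt.abs.eventually (gt_mem_nhds (lt_add_one _))
  obtain ⟨α, hα, hb⟩ := Metric.eventually_nhds_iff.1 (hev.and hFb)
  set C := |F 0| + 1
  have hC : 0 ≤ C := by positivity
  set G₂ := deriv (deriv g) 0 with hG₂
  set G₃ := deriv (deriv (deriv g)) 0 with hG₃
  have hrem : ∀ u, |u| < α → |deriv g u - (deriv g 0 + G₂ * u + G₃ / 2 * u ^ 2)| ≤ C * |u| ^ 3 := by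
    intro u hu
    obtain ⟨h1, h2⟩ := hb (show dist u 0 < α by simpa using hu)
    rw [h1]
    simp only [Finset.sum_range_succ, Finset.range_zero, Finset.sum_empty, iteratedDeriv_zero,
      iteratedDeriv_succ, smul_eq_mul, ← hG₂, ← hG₃]
    norm_num [Nat.factorial]
    rw [show deriv g 0 + u * G₂ + u ^ 2 / 2 * G₃ + u ^ 3 * F u -
      (deriv g 0 + G₂ * u + G₃ / 2 * u ^ 2) = F u * u ^ 3 by ring, abs_mul, abs_pow]
    exact mul_le_mul_of_nonneg_right h2.le (by positivity)
  rw [tendsto_iff_dist_tendsto_zero]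
  have hlim : Tendsto (fun A : ℝ => C * π * A) (𝓝[>] 0) (𝓝 0) := by
    have : Tendsto (fun A : ℝ => C * π * A) (𝓝 0) (𝓝 (C * π * 0)) :=
      Continuous.tendsto (by fun_prop) 0
    rw [mul_zero] at this
    exact this.mono_left nhdsWithin_le_nhds
  refine squeeze_zero' (Eventually.of_forall fun _ => dist_nonneg) ?_ hlim
  have hmem : Ioo 0 (min α (R / 2)) ∈ 𝓝[>] (0 : ℝ) := Ioo_mem_nhdsGT (lt_min hα hp.ρ_pos)
  filter_upwards [hmem] with A hA
  have hA0 : 0 < A := hA.1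
  have hAα : |A| < α := by rw [abs_of_pos hA0]; exact hA.2.trans_le (min_le_left _ _)
  have hAR : |A| ≤ R / 2 := by rw [abs_of_pos hA0]; exact hA.2.le.trans (min_le_right _ _)
  have hint : phaseTime (deriv g) A π - phaseTime (deriv g) 0 π - G₃ * π / 4 * A ^ 2 =
      ∫ θ in (0 : ℝ)..π, (phaseA (deriv g) A θ -
        (deriv g 0 + G₂ * A * cos θ + G₃ / 2 * A ^ 2 * cos θ ^ 2)) := by
    rw [intervalIntegral.integral_sub ((hp.continuous_phaseA hAR).intervalIntegrable _ _)
      (Continuous.intervalIntegrable (by fun_prop) _ _),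
      intervalIntegral.integral_add (Continuous.intervalIntegrable (by fun_prop) _ _)
      (Continuous.intervalIntegrable (by fun_prop) _ _),
      intervalIntegral.integral_add (Continuous.intervalIntegrable (by fun_prop) _ _)
      (Continuous.intervalIntegrable (by fun_prop) _ _), intervalIntegral.integral_const_mul,
      intervalIntegral.integral_const_mul, integral_cos_sq, integral_cos,
      phaseTime_amplitude_zero, phaseTime]
    simp
    ring
  have hbound : |phaseTime (deriv g) A π - phaseTime (deriv g) 0 π - G₃ * π / 4 * A ^ 2| ≤
      C * A ^ 3 * π := by
    rw [hint, ← Real.norm_eq_abs]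
    refine (intervalIntegral.norm_integral_le_of_norm_le_const (C := C * A ^ 3)
      fun θ _ => ?_).trans (by rw [sub_zero, abs_of_pos pi_pos])
    have h1 := abs_mul_cos_le le_rfl θ (A := A)
    have h2 := hrem (A * cos θ) (h1.trans_lt hAα)
    rw [Real.norm_eq_abs, phaseA, show deriv g 0 + G₂ * A * cos θ + G₃ / 2 * A ^ 2 * cos θ ^ 2 =
      deriv g 0 + G₂ * (A * cos θ) + G₃ / 2 * (A * cos θ) ^ 2 by ring]
    refine h2.trans (mul_le_mul_of_nonneg_left ?_ hC)
    rw [abs_of_pos hA0] at h1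
    exact pow_le_pow_left₀ (abs_nonneg _) h1 3
  have e : (phaseTime (deriv g) A π - phaseTime (deriv g) 0 π) / A ^ (2 * 1) - G₃ * π / 4 =
      (phaseTime (deriv g) A π - phaseTime (deriv g) 0 π - G₃ * π / 4 * A ^ 2) / A ^ 2 := by
    rw [mul_one]; field_simp
  rw [Real.dist_eq, e, abs_div, abs_of_pos (by positivity : 0 < A ^ 2), div_le_iff₀ (by positivity)]
  refine hbound.trans (le_of_eq (by ring))

theorem hasDerivAt_iteratedDeriv_comp (h : IsEnergyChart V g R s) {u : ℝ} (hu : |u| < R) (k : ℕ) :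
    HasDerivAt (fun u => iteratedDeriv k V (g u)) (iteratedDeriv (k + 1) V (g u) * deriv g u) u := by
  have h0 : HasDerivAt (iteratedDeriv k V) (iteratedDeriv (k + 1) V (g u)) (g u) := by
    rw [iteratedDeriv_succ]
    have := (h.analyticV u hu).iterated_deriv k
    rw [← iteratedDeriv_eq_iterate] at this
    exact this.differentiableAt.hasDerivAt
  exact h0.comp u (h.hasDerivAt hu)

/-- The third and fourth order relations between the Taylor coefficients of `V` and of `g`. -/
theorem coeff_relations (h : IsEnergyChart V g R s) :
    iteratedDeriv 3 V 0 * deriv g 0 ^ 3 +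
      3 * iteratedDeriv 2 V 0 * deriv g 0 * deriv (deriv g) 0 = 0 ∧
    iteratedDeriv 4 V 0 * deriv g 0 ^ 4 + 6 * iteratedDeriv 3 V 0 * deriv g 0 ^ 2 *
      deriv (deriv g) 0 + 3 * iteratedDeriv 2 V 0 * deriv (deriv g) 0 ^ 2 +
      4 * iteratedDeriv 2 V 0 * deriv g 0 * deriv (deriv (deriv g)) 0 = 0 := by
  have hV := fun u (hu : |u| < R) k => h.hasDerivAt_iteratedDeriv_comp hu k
  have hG := fun u (hu : |u| < R) => h.hasDerivAt_deriv hu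
  have hG₂ : ∀ u, |u| < R → HasDerivAt (deriv (deriv g)) (deriv (deriv (deriv g)) u) u :=
    fun u hu => (h.analytic u hu).deriv.deriv.differentiableAt.hasDerivAt
  have hG₃ : ∀ u, |u| < R →
      HasDerivAt (deriv (deriv (deriv g))) (deriv (deriv (deriv (deriv g))) u) u :=
    fun u hu => (h.analytic u hu).deriv.deriv.deriv.differentiableAt.hasDerivAt
  have hV1 : iteratedDeriv 1 V 0 = 0 := by
    have h2 := h.deriv_mul h.zero_lt_R
    rw [h.zero] at h2
    rw [iteratedDeriv_one]
    exact (mul_eq_zero.1 h2).resolve_right (h.deriv_pos 0 h.zero_lt_R).ne'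
  have third : ∀ u, |u| < R → iteratedDeriv 3 V (g u) * deriv g u ^ 3 +
      3 * iteratedDeriv 2 V (g u) * deriv g u * deriv (deriv g) u +
      iteratedDeriv 1 V (g u) * deriv (deriv (deriv g)) u = 0 := by
    intro u hu
    have h1 := ((hV u hu 2).mul ((hG u hu).pow 2)).add ((hV u hu 1).mul (hG₂ u hu))
    have h2 := h1.unique ((hasDerivAt_const u (1 : ℝ)).congr_of_eventuallyEq
      ((eventually_lt hu).mono fun v hv => by
        simpa [iteratedDeriv_one] using! h.deriv_deriv_mul hv))
    simp only [Pi.pow_apply] at h2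
    linear_combination h2
  have hz := h.zero_lt_R
  refine ⟨?_, ?_⟩
  · have := third 0 hz
    rw [h.zero, hV1] at this
    linear_combination this
  · have h1 := (((hV 0 hz 3).mul ((hG 0 hz).pow 3)).add
      ((((hV 0 hz 2).const_mul 3).mul (hG 0 hz)).mul (hG₂ 0 hz))).add
      ((hV 0 hz 1).mul (hG₃ 0 hz))
    have h2 := h1.unique ((hasDerivAt_const (0 : ℝ) (0 : ℝ)).congr_of_eventuallyEq
      ((eventually_lt hz).mono fun v hv => by simpa using! third v hv))
    simp only [Pi.pow_apply, Pi.mul_apply, h.zero, hV1] at h2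
    linear_combination h2

/-- Two evaluations of the same limit give `γ g'(0) ^ 3 = -g'''(0)`. The Taylor relations of `V (g
u) = u ^ 2 / 2` then eliminate the derivatives of `g`. -/
theorem gamma_one (h : IsEnergyChart V g R s)
    (hp : IsPhaseDensity (deriv g) (deriv (deriv g)) (R / 2) L) {γ r : ℝ} {ω : ℝ → ℝ}
    (hr : 0 < r) (hω : ∀ ε ∈ Ioo 0 r, ω ε = π / phaseTime (deriv g) √(2 * ε) π)
    (hiso : (fun ε : ℝ => ω ε ^ 2 - (potCoeff V 2 + γ * ε ^ 1)) =o[𝓝[>] 0] (fun ε : ℝ => ε ^ 1)) :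
    γ = 3 * potCoeff V 4 / (2 * potCoeff V 2)
      - 5 * potCoeff V 3 ^ 2 / (3 * potCoeff V 2 ^ 2) := by
  have h1 := tendsto_nhds_unique (h.tendsto_halfPeriod hp hr hω hiso) (h.tendsto_halfPeriod_sq hp)
  have hG := h.deriv_pos 0 h.zero_lt_R
  obtain ⟨h3, h4⟩ := h.coeff_relations
  have h2 := h.deriv_zero_sq
  have e2 : iteratedDeriv 2 V 0 = potCoeff V 2 := (potCoeff_two V).symm
  have e3 : iteratedDeriv 3 V 0 = 2 * potCoeff V 3 := by simp [potCoeff]; ring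
  have e4 : iteratedDeriv 4 V 0 = 6 * potCoeff V 4 := by
    simp [potCoeff, Nat.factorial]; ring
  rw [e2, e3] at h3
  rw [e2, e3, e4] at h4
  have hv : 0 < potCoeff V 2 := by
    by_contra hneg
    have := mul_nonpos_of_nonpos_of_nonneg (not_lt.1 hneg) (sq_nonneg (deriv g 0))
    linarith
  generalize potCoeff V 2 = v2 at *
  generalize potCoeff V 3 = v3 at *
  generalize potCoeff V 4 = v4 at *
  generalize deriv (deriv (deriv g)) 0 = G₃ at *
  generalize deriv (deriv g) 0 = G₂ at *
  generalize deriv g 0 = G at *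
  have hγ : γ * G ^ 3 = -G₃ := by
    have : γ * π * G ^ 3 = -G₃ * π := by norm_num at h1; linarith
    have hpi := pi_pos.ne'
    field_simp at this ⊢
    linarith
  have hG2 : G₂ = -(2 * v3 * G ^ 2) / (3 * v2) := by
    rw [eq_div_iff (by positivity)]
    have : G * (G₂ * (3 * v2)) = G * (-(2 * v3 * G ^ 2)) := by linear_combination h3
    exact mul_left_cancel₀ hG.ne' this
  have hG3 : G₃ = -(γ * G ^ 3) := by linarith
  rw [hG2, hG3] at h4
  field_simp at h4 ⊢
  have hG4 : 0 < G ^ 4 := by positivity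
  nlinarith

end IsEnergyChart

/-! ### Perturbations of the in-phase mode -/

theorem couplingParam_pos {W : ℝ → ℝ} (hW : IsPotential W) {N : ℕ} (hN : 2 ≤ N) {l : ℤ}
    (hl : ¬ (N : ℤ) ∣ l) : 0 < couplingParam W N l := by
  have hN0 : (N : ℝ) ≠ 0 := by positivity
  refine mul_pos hW.potCoeff_two_pos (sq_pos_of_ne_zero ?_)
  intro h0
  obtain ⟨k, hk⟩ := sin_eq_zero_iff.1 h0
  apply hl
  refine ⟨k, ?_⟩
  have h1 : (l : ℝ) = N * k := by
    have hpi := pi_pos.ne'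
    field_simp at hk
    linarith
  exact_mod_cast h1

/-- The amplitude equation for perturbations of given wave number. -/
theorem isModePerturbation_iff {V W : ℝ → ℝ} {N : ℕ} (hN : 2 ≤ N) (l : ℤ) (x : ℝ → ℝ)
    (η : ℝ → ℂ) : IsModePerturbation V W N l (fun _ => x) η ↔
      ∀ t, HasDerivAt η (deriv η t) t ∧ HasDerivAt (deriv η)
        (-((iteratedDeriv 2 V (x t) + 4 * couplingParam W N l : ℝ) : ℂ) * η t) t := by
  have hN0 : (N : ℝ) ≠ 0 := by positivity
  set q : ℝ := 2 * π * l / N with hq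
  set e : ℤ → ℂ := fun j => Complex.exp (-(Complex.I * ((q * (j : ℝ) : ℝ) : ℂ))) with he
  have e0 : e 0 = 1 := by simp [he]
  have ene : ∀ j, e j ≠ 0 := fun j => Complex.exp_ne_zero _
  have eadd : ∀ j k, e (j + k) = e j * e k := by
    intro j k
    simp only [he]
    rw [← Complex.exp_add]
    congr 1; push_cast; ring
  have eN : ∀ j, e (j + N) = e j := by
    intro j
    rw [eadd]
    have : e N = 1 := by
      simp only [he]
      rw [Complex.exp_eq_one_iff]
      refine ⟨-l, ?_⟩
      have hNC : (N : ℂ) ≠ 0 := by exact_mod_cast hN0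
      simp only [hq]; push_cast; field_simp
    rw [this, mul_one]
  -- the discrete Laplacian of a plane wave
  have hlap : 4 * (couplingParam W N l : ℂ) =
      ((iteratedDeriv 2 W 0 : ℝ) : ℂ) * (2 - e 1 - e (-1)) := by
    have h1 : e 1 + e (-1) = 2 * Complex.cos q := by
      rw [Complex.two_cos]
      simp only [he]; push_cast; rw [add_comm]
      congr 1 <;> (congr 1; ring)
    have h2 : Complex.cos q = 1 - 2 * Complex.sin (q / 2 : ℝ) ^ 2 := by
      have := Complex.cos_two_mul' (q / 2 : ℝ)
      have hsc := Complex.sin_sq_add_cos_sq (q / 2 : ℝ)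
      rw [show (2 : ℂ) * ((q / 2 : ℝ) : ℂ) = q by push_cast; ring] at this
      rw [this]; linear_combination hsc
    have h3 : π * (l : ℝ) / N = q / 2 := by rw [hq]; ring
    rw [sub_sub, h1, h2, couplingParam, h3, potCoeff_two]
    push_cast; ring
  have hderiv : ∀ j, deriv (fun t => e j * η t) = fun t => e j * deriv η t := by
    intro j; funext t; exact deriv_const_mul_field (e j)
  have hrhs : ∀ j t, -((iteratedDeriv 2 V (x t) : ℝ) : ℂ) * (e j * η t)
        - ((iteratedDeriv 2 W (x t - x t) : ℝ) : ℂ) * (e j * η t - e (j - 1) * η t)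
        + ((iteratedDeriv 2 W (x t - x t) : ℝ) : ℂ) * (e (j + 1) * η t - e j * η t) =
      e j * (-((iteratedDeriv 2 V (x t) + 4 * couplingParam W N l : ℝ) : ℂ) * η t) := by
    intro j t
    rw [sub_self, sub_eq_add_neg j 1, eadd, eadd]
    push_cast
    rw [hlap]; ring
  have hdef : IsModePerturbation V W N l (fun _ => x) η ↔
      (∀ j : ℤ, (fun t => e (j + N) * η t) = fun t => e j * η t) ∧ ∀ (j : ℤ) (t : ℝ),
        HasDerivAt (fun t => e j * η t) (deriv (fun t => e j * η t) t) t ∧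
        HasDerivAt (deriv (fun t => e j * η t))
          (-((iteratedDeriv 2 V (x t) : ℝ) : ℂ) * (e j * η t)
            - ((iteratedDeriv 2 W (x t - x t) : ℝ) : ℂ) * (e j * η t - e (j - 1) * η t)
            + ((iteratedDeriv 2 W (x t - x t) : ℝ) : ℂ) * (e (j + 1) * η t - e j * η t)) t :=
    Iff.rfl
  rw [hdef]
  constructor
  · rintro ⟨-, h⟩ t
    have := h 0 t
    rw [hrhs, hderiv, e0] at this
    simpa using this
  · intro h
    refine ⟨fun j => by rw [eN], fun j t => ?_⟩
    rw [hrhs, hderiv]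
    exact ⟨(h t).1.const_mul (e j), (h t).2.const_mul (e j)⟩

section
variable {V W g : ℝ → ℝ} {N : ℕ} {l : ℤ} {A : ℝ}

theorem isModePerturbation_ofReal (hN : 2 ≤ N) {η : ℝ → ℝ}
    (hη : IsModeHillSol V g A (couplingParam W N l) 1 η) :
    IsModePerturbation V W N l (fun _ => modeOrbit g A) (fun t => (η t : ℂ)) := by
  rw [isModePerturbation_iff hN]
  have h1 : deriv (fun t => (η t : ℂ)) = fun t => ((deriv η t : ℝ) : ℂ) :=
    funext fun t => (hη t).1.ofReal_comp.deriv
  intro t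
  rw [h1]
  refine ⟨(hη t).1.ofReal_comp, ?_⟩
  convert! (hη t).2.ofReal_comp using 1
  rw [div_one]; push_cast; ring

/-- The amplitude equation has real coefficients, so real and imaginary parts separate and complex
perturbations reduce to real Hill solutions. -/
theorem isModeHillSol_of_perturbation (hN : 2 ≤ N) {η : ℝ → ℂ}
    (hη : IsModePerturbation V W N l (fun _ => modeOrbit g A) η) :
    IsModeHillSol V g A (couplingParam W N l) 1 (fun t => (η t).re) ∧
      IsModeHillSol V g A (couplingParam W N l) 1 (fun t => (η t).im) := by
  rw [isModePerturbation_iff hN] at hη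
  have hre : ∀ {f : ℝ → ℂ} {f' : ℂ} {t : ℝ}, HasDerivAt f f' t →
      HasDerivAt (fun t => (f t).re) f'.re t := fun h =>
    Complex.reCLM.hasFDerivAt.comp_hasDerivAt _ h
  have him : ∀ {f : ℝ → ℂ} {f' : ℂ} {t : ℝ}, HasDerivAt f f' t →
      HasDerivAt (fun t => (f t).im) f'.im t := fun h =>
    Complex.imCLM.hasFDerivAt.comp_hasDerivAt _ h
  constructor
  · have h1 : deriv (fun t => (η t).re) = fun t => (deriv η t).re :=
      funext fun t => (hre (hη t).1).deriv
    intro t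
    rw [h1]
    refine ⟨hre (hη t).1, ?_⟩
    convert! hre (hη t).2 using 1
    rw [div_one, ← Complex.ofReal_neg, Complex.re_ofReal_mul]; ring
  · have h1 : deriv (fun t => (η t).im) = fun t => (deriv η t).im :=
      funext fun t => (him (hη t).1).deriv
    intro t
    rw [h1]
    refine ⟨him (hη t).1, ?_⟩
    convert! him (hη t).2 using 1
    rw [div_one, ← Complex.ofReal_neg, Complex.im_ofReal_mul]; ring

theorem isStableMode_iff (hN : 2 ≤ N) : IsStableMode V W N l (modeOrbit g A) ↔
    ∀ η, IsModeHillSol V g A (couplingParam W N l) 1 η → ∃ C : ℝ, ∀ t, |η t| ≤ C := by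
  constructor
  · intro h η hη
    obtain ⟨C, hC⟩ := h _ (isModePerturbation_ofReal hN hη)
    exact ⟨C, fun t => by simpa using hC t⟩
  · intro h η hη
    obtain ⟨h1, h2⟩ := isModeHillSol_of_perturbation hN hη
    obtain ⟨C₁, hC₁⟩ := h _ h1
    obtain ⟨C₂, hC₂⟩ := h _ h2
    exact ⟨C₁ + C₂, fun t => (Complex.norm_le_abs_re_add_abs_im _).trans
      (add_le_add (hC₁ t) (hC₂ t))⟩

theorem hasPeriodicPerturbation_iff (hN : 2 ≤ N) (T : ℝ) :
    HasPeriodicPerturbation V W N l (modeOrbit g A) T ↔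
    ∃ η : ℝ → ℝ, η ≠ 0 ∧ IsModeHillSol V g A (couplingParam W N l) 1 η ∧
      Function.Periodic η T := by
  constructor
  · rintro ⟨η, hne, hη, hper⟩
    obtain ⟨h1, h2⟩ := isModeHillSol_of_perturbation hN hη
    by_cases h0 : (fun t => (η t).re) = 0
    · refine ⟨_, fun h0' => hne ?_, h2, fun t => by simp only [hper t]⟩
      funext t
      exact Complex.ext (congrFun h0 t) (congrFun h0' t)
    · exact ⟨_, h0, h1, fun t => by simp only [hper t]⟩
  · rintro ⟨η, hne, hη, hper⟩
    refine ⟨_, fun h0 => hne ?_, isModePerturbation_ofReal hN hη, fun t => by simp only [hper t]⟩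
    funext t
    have := congrFun h0 t
    simpa using this

end

/-! ### Stability in terms of the transition parameter -/

/-- Stability, instability and periodic solutions of the Hill equation of a mode, according to the
position of the coupling `κ` relative to `0` and to the transition value `κs`. -/
structure IsHillDichotomy (V g : ℝ → ℝ) (A κ κs c : ℝ) : Prop where
  unstable : κ * (κ - κs) < 0 → ∃ η, IsModeHillSol V g A κ c η ∧ ¬ ∃ C, ∀ τ, |η τ| ≤ C
  stable : 0 < κ * (κ - κs) → ∀ η, IsModeHillSol V g A κ c η → ∃ C, ∀ τ, |η τ| ≤ C
  periodic : ∀ η, IsModeHillSol V g A κ c η → η ≠ 0 →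
    Function.Periodic η (c * phaseTime (deriv g) A (2 * π)) → κ * (κ - κs) = 0
  even_iff : (∃ η, η ≠ 0 ∧ IsModeHillSol V g A κ c η ∧ (∀ τ, η (-τ) = η τ) ∧
    Function.Periodic η (c * phaseTime (deriv g) A (2 * π))) ↔ κ = κs
  even : κ = κs → evenHillSol g A κ c ≠ 0 ∧ IsModeHillSol V g A κ c (evenHillSol g A κ c) ∧
    (∀ τ, evenHillSol g A κ c (-τ) = evenHillSol g A κ c τ) ∧
    Function.Periodic (evenHillSol g A κ c) (c * phaseTime (deriv g) A (2 * π))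

namespace IsEnergyChart

variable {V g : ℝ → ℝ} {R s L A κ κs c : ℝ}

/-- The conclusions of Floquet theory at one amplitude, once the half-period values have the
signs of `κ - κs` and `-κ`. -/
theorem hill_dichotomy (h : IsEnergyChart V g R s)
    (hp : IsPhaseDensity (deriv g) (deriv (deriv g)) (R / 2) L) (hA : |A| ≤ R / 2)
    (hκ : |κ| ≤ 1) (hc : c ≠ 0) {m m' : ℝ} (hm : 0 < m) (hm' : 0 < m')
    (h1 : (phaseSol (deriv g) (deriv (deriv g)) (1, 0) A κ π).2 = m * (κ - κs))
    (h2 : (phaseSol (deriv g) (deriv (deriv g)) (0, 1) A κ π).1 = -m' * κ)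
    (h3 : -1 < closing g A κ) :
    IsHillDichotomy V g A κ κs c := by
  have hcl : closing g A κ = -(m * m') * (κ * (κ - κs)) := by
    rw [closing, h1, h2]; ring
  have hmm : 0 < m * m' := mul_pos hm hm'
  have heven : κ = κs → evenHillSol g A κ c ≠ 0 ∧ IsModeHillSol V g A κ c (evenHillSol g A κ c) ∧
      (∀ τ, evenHillSol g A κ c (-τ) = evenHillSol g A κ c τ) ∧
      Function.Periodic (evenHillSol g A κ c) (c * phaseTime (deriv g) A (2 * π)) := by
    intro he
    obtain ⟨e1, e2, e3, e4⟩ := h.evenHillSol_spec hp hA hκ hc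
    refine ⟨fun h0 => ?_, e1, e3, e4 (by rw [h1, he, sub_self, mul_zero])⟩
    rw [h0] at e2; simp at e2
  refine ⟨fun hneg => ?_, fun hpos η hη => ?_, fun η hη hne hper => ?_, ⟨?_, fun he => ?_⟩, heven⟩
  · exact h.exists_unbounded hp hA hκ hc (by rw [hcl]; nlinarith)
  · exact h.hill_bounded hp hA hκ hc (by rw [hcl]; nlinarith) h3 hη
  · have := h.closing_eq_zero hp hA hκ hc hη hne hper
    rw [hcl] at this
    exact (mul_eq_zero.1 this).resolve_left (neg_ne_zero.2 hmm.ne')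
  · rintro ⟨η, hne, hη, hev, hper⟩
    have := h.even_closing hp hA hκ hc hη hne hper hev
    rw [h1] at this
    have := (mul_eq_zero.1 this).resolve_left hm.ne'
    linarith
  · obtain ⟨e1, e2, e3, e4⟩ := heven he
    exact ⟨_, e1, e2, e3, e4⟩

end IsEnergyChart

/-! ### The symmetric transition curve -/

/-- `κs` is the transition parameter for amplitudes below `A₁` and couplings up to `d`. -/
structure IsTransitionParam (g : ℝ → ℝ) (R : ℝ) (n : ℕ) (γ A₁ d Λ : ℝ) (κs F : ℝ → ℝ) : Prop where
  A₁_pos : 0 < A₁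
  A₁_le : A₁ ≤ R / 2
  d_pos : 0 < d
  d_le : d ≤ 1
  Λ_pos : 0 < Λ
  mem : ∀ A, |A| < A₁ → |κs A| < d
  closing : ∀ A, |A| < A₁ → ∀ κ, |κ| ≤ d → ∃ m m' : ℝ, 0 < m ∧ 0 < m' ∧
    (phaseSol (deriv g) (deriv (deriv g)) (1, 0) A κ π).2 = m * (κ - κs A) ∧
    (phaseSol (deriv g) (deriv (deriv g)) (0, 1) A κ π).1 = -m' * κ ∧
    -1 < IsEnergyChart.closing g A κ
  factor : ∀ A, |A| < A₁ → κs A = A ^ (2 * n) * F A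
  lip_F : ∀ A B, |A| < A₁ → |B| < A₁ → |F A - F B| ≤ Λ * |A - B|
  lip : ∀ A B, |A| < A₁ → |B| < A₁ → |κs A - κs B| ≤ Λ * |A - B|
  F_zero : F 0 = -(n * γ) / 2 ^ (n + 1)
  zero : κs 0 = 0
  sign : ∀ A, 0 < A → A < A₁ → 0 < -γ * κs A
  mono : ∀ A B, 0 < A → A < B → B < A₁ → -γ * κs A < -γ * κs B

theorem continuousOn_of_lipschitz {f : ℝ → ℝ} {a Λ : ℝ} (hΛ : 0 ≤ Λ)
    (hf : ∀ A B, |A| < a → |B| < a → |f A - f B| ≤ Λ * |A - B|) :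
    ContinuousOn f {A | |A| < a} :=
  (LipschitzOnWith.of_dist_le_mul (K := ⟨Λ, hΛ⟩) fun A hA B hB => hf A B hA hB).continuousOn

theorem mul_sub_neg_of_between {x s : ℝ} (h1 : min 0 s < x) (h2 : x < max 0 s) :
    x * (x - s) < 0 := by
  rcases le_total 0 s with h | h
  · rw [min_eq_left h] at h1; rw [max_eq_right h] at h2
    exact mul_neg_of_pos_of_neg h1 (by linarith)
  · rw [min_eq_right h] at h1; rw [max_eq_left h] at h2
    exact mul_neg_of_neg_of_pos h2 (by linarith)

theorem mul_sub_pos_of_outside {x s : ℝ} (h : x < min 0 s ∨ max 0 s < x) : 0 < x * (x - s) := by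
  rcases h with h | h
  · rw [lt_min_iff] at h
    exact mul_pos_of_neg_of_neg h.1 (by linarith [h.2])
  · rw [max_lt_iff] at h
    exact mul_pos h.1 (by linarith [h.2])

namespace IsTransitionParam

variable {V g : ℝ → ℝ} {R s L : ℝ} {n : ℕ} {γ A₁ d Λ : ℝ} {κs F : ℝ → ℝ}

theorem zero_mem (ht : IsTransitionParam g R n γ A₁ d Λ κs F) : |(0 : ℝ)| < A₁ := by
  simpa using ht.A₁_pos

theorem continuousOn (ht : IsTransitionParam g R n γ A₁ d Λ κs F) :
    ContinuousOn κs {A | |A| < A₁} := continuousOn_of_lipschitz ht.Λ_pos.le ht.lip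

theorem tendsto_F (ht : IsTransitionParam g R n γ A₁ d Λ κs F) :
    Tendsto F (𝓝 0) (𝓝 (-(n * γ) / 2 ^ (n + 1))) := by
  have h1 := continuousOn_of_lipschitz ht.Λ_pos.le ht.lip_F
  have h2 : {A : ℝ | |A| < A₁} ∈ 𝓝 (0 : ℝ) :=
    (isOpen_lt continuous_abs continuous_const).mem_nhds ht.zero_mem
  rw [← ht.F_zero]
  exact h1.continuousAt h2

theorem tendsto_zero (ht : IsTransitionParam g R n γ A₁ d Λ κs F) :
    Tendsto κs (𝓝 0) (𝓝 0) := by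
  have h2 : {A : ℝ | |A| < A₁} ∈ 𝓝 (0 : ℝ) :=
    (isOpen_lt continuous_abs continuous_const).mem_nhds ht.zero_mem
  have := (ht.continuousOn.continuousAt h2).tendsto
  rwa [ht.zero] at this

end IsTransitionParam

theorem tendsto_const_mul_nhdsGT {c : ℝ} (hc : 0 < c) :
    Tendsto (fun X : ℝ => c * X) (𝓝[>] 0) (𝓝[>] 0) := by
  refine tendsto_nhdsWithin_iff.2 ⟨?_, ?_⟩
  · have : Tendsto (fun X : ℝ => c * X) (𝓝 0) (𝓝 (c * 0)) := Continuous.tendsto (by fun_prop) 0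
    rw [mul_zero] at this
    exact this.mono_left nhdsWithin_le_nhds
  · filter_upwards [self_mem_nhdsWithin] with X hX
    exact mul_pos hc hX

theorem isLittleO_pow_of_tendsto {f : ℝ → ℝ} {k : ℕ} {c : ℝ}
    (h : Tendsto (fun X => f X / X ^ k) (𝓝[>] 0) (𝓝 c)) :
    (fun X => f X - c * X ^ k) =o[𝓝[>] 0] (fun X : ℝ => X ^ k) := by
  have hne : ∀ᶠ X : ℝ in 𝓝[>] 0, X ^ k ≠ 0 := by
    filter_upwards [self_mem_nhdsWithin] with X hX
    exact pow_ne_zero k (ne_of_gt hX)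
  rw [isLittleO_iff_tendsto' (hne.mono fun X hX h0 => absurd h0 hX)]
  have := h.sub_const c
  rw [sub_self] at this
  refine this.congr' ?_
  filter_upwards [hne] with X hX
  rw [sub_div, mul_div_assoc, div_self hX, mul_one]

namespace IsEnergyChart

variable {V g : ℝ → ℝ} {R s L : ℝ} {n : ℕ} {γ r : ℝ} {ω : ℝ → ℝ} {Q : ℝ → ℝ → ℝ}

theorem exists_transitionParam (h : IsEnergyChart V g R s)
    (hp : IsPhaseDensity (deriv g) (deriv (deriv g)) (R / 2) L)
    (hn : 1 ≤ n) (hγ : γ ≠ 0)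
    (hr : 0 < r) (hω : ∀ ε ∈ Ioo 0 r, ω ε = π / phaseTime (deriv g) √(2 * ε) π)
    (hiso : (fun ε : ℝ => ω ε ^ 2 - (potCoeff V 2 + γ * ε ^ n)) =o[𝓝[>] 0] (fun ε : ℝ => ε ^ n)) :
    ∃ (A₁ d Λ : ℝ) (κs F : ℝ → ℝ), IsTransitionParam g R n γ A₁ d Λ κs F := by
  obtain ⟨A₁, d, Λ, κs, F, h1, h2, h3, h4, h5, h6, h7, h8, h9, h10⟩ :=
    h.exists_transition_factor hp hn hγ hr hω hiso
  exact ⟨A₁, d, Λ, κs, F, h1, h2, h3, h4, h5, fun A hA => (h6 A hA).1, fun A hA => (h6 A hA).2.1,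
    fun A hA => (h6 A hA).2.2.1, fun A B hA hB => ((h6 A hA).2.2.2 B hB).1,
    fun A B hA hB => ((h6 A hA).2.2.2 B hB).2, h7, h8, h9, h10⟩

theorem two_mul_energyOf (hV : IsPotential V) {X : ℝ} (hX : 0 < X) :
    √(2 * energyOf V X) = √(potCoeff V 2) * X := by
  have hv := hV.potCoeff_two_pos
  rw [energyOf, show 2 * (potCoeff V 2 * X ^ 2 / 2) = potCoeff V 2 * X ^ 2 by ring,
    sqrt_mul hv.le, sqrt_sq hX.le]

theorem energyOf_mem (hV : IsPotential V) {X : ℝ} (hX : 0 < X)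
    (hXr : √(potCoeff V 2) * X < √(2 * r)) : energyOf V X ∈ Ioo 0 r := by
  have hv := hV.potCoeff_two_pos
  refine ⟨by rw [energyOf]; positivity, ?_⟩
  rw [← two_mul_energyOf hV hX, sqrt_lt_sqrt_iff (by rw [energyOf]; positivity)] at hXr
  linarith

/-- The scaled period is `τ(A) / τ(0)` at `A = √v₂ X`, since `τ(0) = π g'(0)` and `√v₂ g'(0) = 1`.
-/
theorem scaledPeriod_isLittleO (h : IsEnergyChart V g R s) (hV : IsPotential V)
    (hp : IsPhaseDensity (deriv g) (deriv (deriv g)) (R / 2) L)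
    (hr : 0 < r) (hω : ∀ ε ∈ Ioo 0 r, ω ε = π / phaseTime (deriv g) √(2 * ε) π)
    (hiso : (fun ε : ℝ => ω ε ^ 2 - (potCoeff V 2 + γ * ε ^ n)) =o[𝓝[>] 0] (fun ε : ℝ => ε ^ n)) :
    (fun X : ℝ => scaledPeriod V ω X -
      (1 + -γ / (2 * potCoeff V 2) * (potCoeff V 2 / 2) ^ n * X ^ (2 * n)))
      =o[𝓝[>] 0] (fun X : ℝ => X ^ (2 * n)) := by
  have hv := hV.potCoeff_two_pos
  have hG0 := h.deriv_pos 0 h.zero_lt_R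
  set v := potCoeff V 2 with hvdef
  set w := √v with hw
  have hw0 : 0 < w := sqrt_pos.2 hv
  have hwsq : w ^ 2 = v := sq_sqrt hv.le
  have hwG : w * deriv g 0 = 1 := by
    have h1 := h.deriv_zero_sq
    rw [← hvdef, ← hwsq, ← mul_pow] at h1
    exact (pow_eq_one_iff_of_nonneg (by positivity) two_ne_zero).1 h1
  have h1 := ((h.tendsto_halfPeriod hp hr hω hiso).comp (tendsto_const_mul_nhdsGT hw0)).mul_const
    (w ^ (2 * n) * (w / π))
  have e : -(γ * π * deriv g 0 ^ 3) / 2 ^ (n + 1) * (w ^ (2 * n) * (w / π)) =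
      -γ / (2 * v) * (v / 2) ^ n := by
    have hG : deriv g 0 = 1 / w := by field_simp; linarith
    have hdp : (w ^ 2 / 2) ^ n = (w ^ 2) ^ n / 2 ^ n := div_pow _ _ _
    rw [hG, ← hwsq, hdp, pow_mul, pow_succ 2 n]
    field_simp
  rw [e] at h1
  have h2 : Tendsto (fun X => (scaledPeriod V ω X - 1) / X ^ (2 * n)) (𝓝[>] 0)
      (𝓝 (-γ / (2 * v) * (v / 2) ^ n)) := by
    refine h1.congr' ?_
    have hmem : Ioo 0 (min √(2 * r) (R / 2)) ∈ 𝓝[>] (0 : ℝ) :=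
      Ioo_mem_nhdsGT (lt_min (sqrt_pos.2 (by linarith)) hp.ρ_pos)
    filter_upwards [tendsto_const_mul_nhdsGT hw0 hmem, self_mem_nhdsWithin] with X hX hX0
    have hX0' : 0 < X := hX0
    have hXm : w * X < min √(2 * r) (R / 2) := hX.2
    have hA : |w * X| ≤ R / 2 := by
      rw [abs_of_pos (mul_pos hw0 hX0')]; exact hXm.le.trans (min_le_right _ _)
    have hτ := hp.phaseTime_pi_pos hA
    have hωX := hω _ (energyOf_mem hV hX0' (hXm.trans_le (min_le_left _ _)))
    rw [two_mul_energyOf hV hX0'] at hωX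
    simp only [Function.comp, scaledPeriod]
    rw [← hvdef, ← hw] at hωX ⊢
    rw [hωX, phaseTime_amplitude_zero, mul_pow]
    have hwX : w ^ (2 * n) ≠ 0 := by positivity
    have hXn : X ^ (2 * n) ≠ 0 := by positivity
    generalize phaseTime (deriv g) (w * X) π = τ at *
    have hG : deriv g 0 = 1 / w := by field_simp; linarith
    rw [hG]
    generalize w ^ (2 * n) = w' at *
    generalize X ^ (2 * n) = X' at *
    field_simp
  refine (isLittleO_pow_of_tendsto h2).congr_left fun X => by ring

/-- As `T̃ ^ 2 = v₂ / ω ^ 2`, the coefficient is `(V'' - v₂ Δ) / ω ^ 2`, and `-v₂ Δ` plays the role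
of `4 κ`. -/
theorem isHillSolution_iff (hV : IsPotential V) {X c : ℝ} (hc : 0 < c)
    (hQX : Q (energyOf V X) = modeOrbit g (√(potCoeff V 2) * X))
    (hωX : ω (energyOf V X) = c) (Δ : ℝ) (η : ℝ → ℝ) :
    IsHillSolution V Q ω X Δ η ↔
      IsModeHillSol V g (√(potCoeff V 2) * X) (-(potCoeff V 2 * Δ) / 4) c η := by
  have hv := hV.potCoeff_two_pos
  have hsp : scaledPeriod V ω X ^ 2 = potCoeff V 2 / c ^ 2 := by
    rw [scaledPeriod, hωX, div_pow, mul_pow, sq_sqrt hv.le]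
    field_simp
  refine forall_congr' fun τ => ?_
  rw [hsp, scaledOrbit, hQX, hωX]
  have : potCoeff V 2 / c ^ 2 * (iteratedDeriv 2 V (modeOrbit g (√(potCoeff V 2) * X) (τ / c)) /
      potCoeff V 2 - Δ) * η τ = (iteratedDeriv 2 V (modeOrbit g (√(potCoeff V 2) * X) (τ / c)) +
      4 * (-(potCoeff V 2 * Δ) / 4)) / c ^ 2 * η τ := by
    field_simp; ring
  rw [this]

/-- The substitution `κ = -v₂ Δ / 4` multiplies `Δ (Δ - Δs)` by the positive number `v₂ ^ 2 / 16`,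
so it preserves the dichotomy although it reverses orientation. -/
theorem isSymmetricTransitionCurve (h : IsEnergyChart V g R s) (hV : IsPotential V)
    (hp : IsPhaseDensity (deriv g) (deriv (deriv g)) (R / 2) L) (hr : 0 < r)
    (hQ : ∀ ε ∈ Ioo 0 r, Q ε = modeOrbit g √(2 * ε) ∧ ω ε = π / phaseTime (deriv g) √(2 * ε) π)
    {A₁ d Λ : ℝ} {κs F : ℝ → ℝ} (ht : IsTransitionParam g R n γ A₁ d Λ κs F) :
    IsSymmetricTransitionCurve V Q ω (min A₁ √(2 * r) / √(potCoeff V 2)) (4 * d / potCoeff V 2)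
      (fun X => -(4 * κs (√(potCoeff V 2) * X)) / potCoeff V 2) := by
  have hv := hV.potCoeff_two_pos
  set v := potCoeff V 2 with hvdef
  set w := √v with hw
  have hw0 : 0 < w := sqrt_pos.2 hv
  have hd := ht.d_pos
  have ha : 0 < min A₁ √(2 * r) := lt_min ht.A₁_pos (sqrt_pos.2 (by linarith))
  have hamp : ∀ X ∈ Ioo 0 (min A₁ √(2 * r) / w), |w * X| < A₁ ∧ |w * X| ≤ R / 2 ∧
      energyOf V X ∈ Ioo 0 r := by
    intro X hX
    have h1 := hX.2
    rw [lt_div_iff₀ hw0, mul_comm, lt_min_iff] at h1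
    have h2 : |w * X| < A₁ := by rw [abs_of_pos (mul_pos hw0 hX.1)]; exact h1.1
    exact ⟨h2, h2.le.trans ht.A₁_le, energyOf_mem hV hX.1 h1.2⟩
  have hsol : ∀ X ∈ Ioo 0 (min A₁ √(2 * r) / w), 0 < π / phaseTime (deriv g) (w * X) π ∧
      π / phaseTime (deriv g) (w * X) π * phaseTime (deriv g) (w * X) (2 * π) = 2 * π ∧
      ∀ Δ η, IsHillSolution V Q ω X Δ η ↔ IsModeHillSol V g (w * X) (-(v * Δ) / 4)
        (π / phaseTime (deriv g) (w * X) π) η := by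
    intro X hX
    obtain ⟨h1, h2, h3⟩ := hamp X hX
    have hτ := hp.phaseTime_pi_pos h2
    obtain ⟨hQ1, hQ2⟩ := hQ _ h3
    rw [two_mul_energyOf hV hX.1] at hQ1 hQ2
    refine ⟨by positivity, ?_, isHillSolution_iff hV (by positivity) hQ1 hQ2⟩
    rw [hp.phaseTime_two_pi h2]; field_simp
  have hdich : ∀ X ∈ Ioo 0 (min A₁ √(2 * r) / w), ∀ Δ, |Δ| < 4 * d / v →
      IsHillDichotomy V g (w * X) (-(v * Δ) / 4) (κs (w * X))
        (π / phaseTime (deriv g) (w * X) π) := fun X hX Δ hΔ => by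
    obtain ⟨h1, h2, h3⟩ := hamp X hX
    have hκ : |-(v * Δ) / 4| ≤ d := by
      rw [lt_div_iff₀ hv] at hΔ
      rw [abs_div, abs_neg, abs_mul, abs_of_pos hv, abs_of_pos (by norm_num : (0 : ℝ) < 4)]
      linarith
    obtain ⟨m, m', hm, hm', e1, e2, e3⟩ := ht.closing _ h1 _ hκ
    exact h.hill_dichotomy hp h2 (hκ.trans ht.d_le) (hsol X hX).1.ne' hm hm' e1 e2 e3
  have hmem : ∀ X ∈ Ioo 0 (min A₁ √(2 * r) / w), |-(4 * κs (w * X)) / v| < 4 * d / v := by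
    intro X hX
    have := ht.mem _ (hamp X hX).1
    rw [abs_div, abs_neg, abs_mul, abs_of_pos hv, abs_of_pos (by norm_num : (0 : ℝ) < 4)]
    gcongr
  have heq : ∀ X Δ : ℝ, -(v * Δ) / 4 = κs (w * X) ↔ Δ = -(4 * κs (w * X)) / v := by
    intro X Δ
    rw [eq_div_iff hv.ne']
    constructor <;> intro h <;> linarith
  have hprod : ∀ X Δ : ℝ, -(v * Δ) / 4 * (-(v * Δ) / 4 - κs (w * X)) =
      v ^ 2 / 16 * (Δ * (Δ - -(4 * κs (w * X)) / v)) := by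
    intro X Δ; field_simp; ring
  have hv2 : 0 < v ^ 2 / 16 := by positivity
  have htend : Tendsto (fun X => w * X) (𝓝[>] 0) (𝓝 0) :=
    (tendsto_const_mul_nhdsGT hw0).mono_right nhdsWithin_le_nhds
  refine ⟨by positivity, by positivity, hmem, ?_, ?_, fun X hX Δ hΔ => ?_, ?_,
    fun X hX Δ h1 h2 => ?_, fun X hX Δ hΔ h1 => ?_⟩
  · have hmaps : MapsTo (fun X => w * X) (Ioo 0 (min A₁ √(2 * r) / w)) {A | |A| < A₁} :=
      fun X hX => (hamp X hX).1
    have := ht.continuousOn.comp (continuous_const.mul continuous_id).continuousOn hmaps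
    exact ((this.const_mul 4).neg).div_const v
  · have := ((ht.tendsto_zero.comp htend).const_mul 4).neg.div_const v
    simpa using! this
  · have hD := (hdich X hX Δ hΔ).even_iff
    obtain ⟨-, hper, hiff⟩ := hsol X hX
    rw [hper, heq] at hD
    simp only [hiff]
    exact hD
  · refine ⟨fun X => evenHillSol g (w * X) (κs (w * X)) (π / phaseTime (deriv g) (w * X) π),
      fun X hX => ?_, ?_⟩
    · have hD := (hdich X hX _ (hmem X hX)).even
      obtain ⟨-, hper, hiff⟩ := hsol X hX
      have hκ := (heq X _).2 rfl
      rw [hper, hκ] at hD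
      simp only [hiff, hκ]
      exact hD rfl
    · obtain ⟨B, α, hα, hB⟩ := h.exists_evenHillSol_sub_cos_le hp
      rw [Metric.tendstoUniformly_iff]
      intro e he
      have hlim : Tendsto (fun X => B * (|w * X| + |κs (w * X)|)) (𝓝[>] 0) (𝓝 0) := by
        have := (htend.abs.add (ht.tendsto_zero.comp htend).abs).const_mul B
        simpa using! this
      have hm : Ioo 0 (min A₁ √(2 * r) / w) ∈ 𝓝[>] (0 : ℝ) := Ioo_mem_nhdsGT (by positivity)
      have habs : ∀ᶠ X in 𝓝[>] (0 : ℝ), |w * X| < α := by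
        have := htend.abs
        rw [abs_zero] at this
        exact this.eventually (gt_mem_nhds hα)
      filter_upwards [hm, habs, hlim.eventually (gt_mem_nhds he)] with X hX hXα hXe τ
      obtain ⟨h1, h2, h3⟩ := hamp X hX
      have hκd := ht.mem _ h1
      obtain ⟨m, m', hm, hm', e1, e2, e3⟩ := ht.closing _ h1 _ hκd.le
      rw [dist_comm, Real.dist_eq]
      refine (hB _ _ h2 hXα.le (hκd.le.trans ht.d_le) ?_ τ).trans_lt hXe
      rw [e1, sub_self, mul_zero]
  · have hΔ : |Δ| < 4 * d / v := by
      have hm := abs_lt.1 (hmem X hX)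
      have hpos : 0 < 4 * d / v := by positivity
      rw [abs_lt]
      exact ⟨(lt_min (by linarith) hm.1).trans h1, h2.trans (max_lt hpos hm.2)⟩
    have hneg : -(v * Δ) / 4 * (-(v * Δ) / 4 - κs (w * X)) < 0 := by
      rw [hprod]
      exact mul_neg_of_pos_of_neg hv2 (mul_sub_neg_of_between h1 h2)
    obtain ⟨η, hη, hunb⟩ := (hdich X hX Δ hΔ).unstable hneg
    intro hst
    exact hunb (hst η (((hsol X hX).2.2 Δ η).2 hη))
  · have hpos : 0 < -(v * Δ) / 4 * (-(v * Δ) / 4 - κs (w * X)) := by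
      rw [hprod]
      exact mul_pos hv2 (mul_sub_pos_of_outside h1)
    intro η hη
    exact (hdich X hX Δ hΔ).stable hpos η (((hsol X hX).2.2 Δ η).1 hη)

theorem transitionCurve_isLittleO (hV : IsPotential V)
    {A₁ d Λ : ℝ} {κs F : ℝ → ℝ} (ht : IsTransitionParam g R n γ A₁ d Λ κs F) :
    (fun X : ℝ => -(4 * κs (√(potCoeff V 2) * X)) / potCoeff V 2 -
      (-4 * (n : ℝ) * (-γ / (2 * potCoeff V 2) * (potCoeff V 2 / 2) ^ n) * X ^ (2 * n)))
      =o[𝓝[>] 0] (fun X : ℝ => X ^ (2 * n)) := by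
  have hv := hV.potCoeff_two_pos
  set v := potCoeff V 2 with hvdef
  set w := √v with hw
  have hw0 : 0 < w := sqrt_pos.2 hv
  have hwsq : w ^ 2 = v := sq_sqrt hv.le
  have htend : Tendsto (fun X => w * X) (𝓝[>] 0) (𝓝 0) :=
    (tendsto_const_mul_nhdsGT hw0).mono_right nhdsWithin_le_nhds
  have h1 := ((ht.tendsto_F.comp htend).const_mul (4 * v ^ n)).neg.div_const v
  have h2 : Tendsto (fun X => -(4 * κs (w * X)) / v / X ^ (2 * n)) (𝓝[>] 0)
      (𝓝 (-4 * (n : ℝ) * (-γ / (2 * v) * (v / 2) ^ n))) := by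
    have e : -(4 * v ^ n * (-(n * γ) / 2 ^ (n + 1))) / v =
        -4 * (n : ℝ) * (-γ / (2 * v) * (v / 2) ^ n) := by
      rw [div_pow, pow_succ]; field_simp
    rw [e] at h1
    refine h1.congr' ?_
    have hmem : {A : ℝ | |A| < A₁} ∈ 𝓝 (0 : ℝ) :=
      (isOpen_lt continuous_abs continuous_const).mem_nhds ht.zero_mem
    filter_upwards [htend hmem, self_mem_nhdsWithin] with X hX hX0
    have hX0' : 0 < X := hX0
    have hXn : X ^ (2 * n) ≠ 0 := by positivity
    simp only [Function.comp]
    rw [ht.factor _ hX, mul_pow, pow_mul w, hwsq]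
    field_simp
  exact isLittleO_pow_of_tendsto h2

end IsEnergyChart

/-! ### The tangent bifurcation energy -/

namespace IsTransitionParam

variable {g : ℝ → ℝ} {R : ℝ} {n : ℕ} {γ A₁ d Λ r : ℝ} {κs F : ℝ → ℝ}

theorem sqrt_two_mul_mem (ht : IsTransitionParam g R n γ A₁ d Λ κs F) (hr : r ≤ A₁ ^ 2 / 2)
    {e : ℝ} (he : e ∈ Ioo 0 r) : 0 < √(2 * e) ∧ √(2 * e) < A₁ := by
  refine ⟨sqrt_pos.2 (by linarith [he.1]), ?_⟩
  rw [sqrt_lt' ht.A₁_pos]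
  linarith [he.2]

theorem abs_sqrt_two_mul_lt (ht : IsTransitionParam g R n γ A₁ d Λ κs F) (hr : r ≤ A₁ ^ 2 / 2)
    {e : ℝ} (he : e ∈ Ioo 0 r) : |√(2 * e)| < A₁ := by
  rw [abs_of_nonneg (sqrt_nonneg _)]
  exact (ht.sqrt_two_mul_mem hr he).2

theorem strictMonoOn_energy (ht : IsTransitionParam g R n γ A₁ d Λ κs F) (hr : r ≤ A₁ ^ 2 / 2)
    (hγ : γ < 0) : StrictMonoOn (fun e => κs √(2 * e)) (Ioo 0 r) := by
  intro a ha b hb hab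
  have := ht.mono _ _ (ht.sqrt_two_mul_mem hr ha).1
    (sqrt_lt_sqrt (by linarith [ha.1]) (by linarith : 2 * a < 2 * b)) (ht.sqrt_two_mul_mem hr hb).2
  exact lt_of_mul_lt_mul_left this (by linarith)

theorem energy_pos (ht : IsTransitionParam g R n γ A₁ d Λ κs F) (hr : r ≤ A₁ ^ 2 / 2)
    (hγ : γ < 0) {e : ℝ} (he : e ∈ Ioo 0 r) : 0 < κs √(2 * e) := by
  have h1 := ht.sqrt_two_mul_mem hr he
  exact pos_of_mul_pos_right (ht.sign _ h1.1 h1.2) (by linarith)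

/-- Intermediate values on `[0, r / 2]`, which stays clear of the excluded end point `r`; the value
at `r / 2` is `κs √r`, whence the range of couplings. -/
theorem exists_energy_eq (ht : IsTransitionParam g R n γ A₁ d Λ κs F) (hr0 : 0 < r)
    (hr : r ≤ A₁ ^ 2 / 2) {κ : ℝ} (hκ : κ ∈ Ioo 0 (κs √r)) :
    ∃ e ∈ Ioo 0 r, κs √(2 * e) = κ := by
  have hcont : ContinuousOn (fun e => κs √(2 * e)) (Icc 0 (r / 2)) := by
    refine ht.continuousOn.comp (by fun_prop) fun e he => ?_
    rcases he.1.eq_or_lt with h0 | h0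
    · rw [← h0]; simpa using ht.A₁_pos
    · exact ht.abs_sqrt_two_mul_lt hr ⟨h0, by linarith [he.2]⟩
  have h1 := intermediate_value_Ioo (by linarith : (0 : ℝ) ≤ r / 2) hcont
  have h2 : κ ∈ Ioo (κs √(2 * 0)) (κs √(2 * (r / 2))) := by
    rw [mul_zero, sqrt_zero, ht.zero, mul_div_cancel₀ r two_ne_zero]
    exact hκ
  obtain ⟨e, he, hκe⟩ := h1 h2
  exact ⟨e, ⟨he.1, by linarith [he.2]⟩, hκe⟩

/-- Inserting `A = √(2 E)` in `κs A = A ^ (2n) F(A)` gives `-2 κ / (n γ) = E ^ n F(A) / F(0)`. Since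
`E → 0` by monotonicity, the last quotient tends to `1`, and taking `n`-th roots finishes. -/
theorem isEquivalent_energy (ht : IsTransitionParam g R n γ A₁ d Λ κs F) (hn : 1 ≤ n)
    (hr0 : 0 < r) (hr : r ≤ A₁ ^ 2 / 2) (hγ : γ < 0) (hκ₀ : 0 < κs √r) {E : ℝ → ℝ}
    (hE : ∀ κ ∈ Ioo 0 (κs √r), E κ ∈ Ioo 0 r ∧ κs √(2 * E κ) = κ) :
    E ~[𝓝[>] 0] (fun κ : ℝ => (-2 * κ / ((n : ℝ) * γ)) ^ (1 / (n : ℝ))) := by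
  have hn0 : n ≠ 0 := by omega
  have hnR : (0 : ℝ) < n := by positivity
  have hmem : Ioo 0 (κs √r) ∈ 𝓝[>] (0 : ℝ) := Ioo_mem_nhdsGT hκ₀
  have hmono := ht.strictMonoOn_energy hr hγ
  have hlim : Tendsto E (𝓝[>] 0) (𝓝 0) := by
    rw [Metric.tendsto_nhds]
    intro δ hδ
    set a := min (δ / 2) (r / 2) with ha
    have ha0 : a ∈ Ioo 0 r :=
      ⟨by positivity, (min_le_right _ _).trans_lt (by linarith)⟩
    have hK := ht.energy_pos hr hγ ha0
    filter_upwards [hmem, Ioo_mem_nhdsGT hK] with κ hκ hκa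
    obtain ⟨h1, h2⟩ := hE κ hκ
    rw [dist_zero_right, norm_of_nonneg h1.1.le]
    have h3 : E κ < a := (hmono.lt_iff_lt h1 ha0).1 (by simpa only [h2] using hκa.2)
    exact h3.trans ((min_le_left _ _).trans_lt (by linarith))
  set F₀ := -(n * γ) / 2 ^ (n + 1) with hF₀
  have hF₀pos : 0 < F₀ := div_pos (by nlinarith) (by positivity)
  have hsqrt : Tendsto (fun κ => √(2 * E κ)) (𝓝[>] 0) (𝓝 0) := by
    have := (hlim.const_mul 2).sqrt
    rwa [mul_zero, sqrt_zero] at this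
  have hφ : Tendsto (fun κ => F √(2 * E κ) / F₀) (𝓝[>] 0) (𝓝 1) := by
    have := (ht.tendsto_F.comp hsqrt).div_const F₀
    rwa [← hF₀, div_self hF₀pos.ne'] at this
  refine IsEquivalent.symm (isEquivalent_iff_exists_eq_mul.2
    ⟨fun κ => (F √(2 * E κ) / F₀) ^ (1 / (n : ℝ)), ?_, ?_⟩)
  · have := hφ.rpow_const (p := 1 / (n : ℝ)) (Or.inl one_ne_zero)
    rwa [one_rpow] at this
  · filter_upwards [hmem, hφ.eventually (lt_mem_nhds zero_lt_one)] with κ hκ hpos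
    obtain ⟨h1, h2⟩ := hE κ hκ
    have h3 := ht.factor _ (ht.abs_sqrt_two_mul_lt hr h1)
    rw [h2, pow_mul, sq_sqrt (by linarith [h1.1])] at h3
    have h4 : -2 * κ / ((n : ℝ) * γ) = F √(2 * E κ) / F₀ * E κ ^ n := by
      have := hγ.ne
      rw [show -2 * κ = -2 * ((2 * E κ) ^ n * F √(2 * E κ)) by rw [← h3], hF₀, mul_pow, pow_succ]
      field_simp
    rw [Pi.mul_apply, h4, mul_rpow hpos.le (pow_nonneg h1.1.le n), one_div,
      pow_rpow_inv_natCast h1.1.le hn0]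

end IsTransitionParam

/-! ### From Hill's equation to bifurcations of the lattice mode. -/

theorem isLatticeMotion_const {V W q : ℝ → ℝ} (hW : IsPotential W) (N : ℕ)
    (hq : ∀ t, HasDerivAt q (deriv q t) t ∧ HasDerivAt (deriv q) (-deriv V (q t)) t) :
    IsLatticeMotion V W N (fun _ => q) := by
  refine ⟨fun _ => rfl, fun _ t => ⟨(hq t).1, ?_⟩⟩
  simpa [hW.critical] using (hq t).2

theorem latticeEnergy_const {V W q : ℝ → ℝ} (hW : IsPotential W) (N : ℕ) {e : ℝ}
    (hq : ∀ t, deriv q t ^ 2 / 2 + V (q t) = e) (t : ℝ) :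
    latticeEnergy V W N (fun _ => q) t = N * e := by
  simp [latticeEnergy, hW.zero, hq t]

namespace IsEnergyChart

variable {V W g : ℝ → ℝ} {R s L : ℝ} {n : ℕ} {γ r A₁ d Λ : ℝ} {ω κs F : ℝ → ℝ} {Q : ℝ → ℝ → ℝ}
  {N : ℕ} {l : ℤ}

theorem hillDichotomy_of_mem (h : IsEnergyChart V g R s)
    (hp : IsPhaseDensity (deriv g) (deriv (deriv g)) (R / 2) L)
    (ht : IsTransitionParam g R n γ A₁ d Λ κs F) {A κ c : ℝ} (hA : |A| < A₁) (hκ : |κ| ≤ d)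
    (hc : c ≠ 0) : IsHillDichotomy V g A κ (κs A) c := by
  obtain ⟨m, m', hm, hm', e1, e2, e3⟩ := ht.closing _ hA _ hκ
  exact h.hill_dichotomy hp (hA.le.trans ht.A₁_le) (hκ.trans ht.d_le) hc hm hm' e1 e2 e3

/-- Stability and periodic perturbations of the in-phase mode of energy density `e`, in terms of
the transition parameter. -/
theorem mode_dichotomy (h : IsEnergyChart V g R s)
    (hp : IsPhaseDensity (deriv g) (deriv (deriv g)) (R / 2) L)
    (ht : IsTransitionParam g R n γ A₁ d Λ κs F) (hr : r ≤ A₁ ^ 2 / 2)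
    (hQ : ∀ ε ∈ Ioo 0 r, Q ε = modeOrbit g √(2 * ε) ∧ ω ε = π / phaseTime (deriv g) √(2 * ε) π)
    (hN : 2 ≤ N) (hκ : |couplingParam W N l| ≤ d) {e : ℝ} (he : e ∈ Ioo 0 r) :
    (0 < couplingParam W N l * (couplingParam W N l - κs √(2 * e)) →
      IsStableMode V W N l (Q e)) ∧
    (couplingParam W N l * (couplingParam W N l - κs √(2 * e)) < 0 →
      ¬ IsStableMode V W N l (Q e)) ∧
    (HasPeriodicPerturbation V W N l (Q e) (2 * π / ω e) →
      couplingParam W N l * (couplingParam W N l - κs √(2 * e)) = 0) ∧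
    (couplingParam W N l = κs √(2 * e) →
      HasPeriodicPerturbation V W N l (Q e) (2 * π / ω e)) := by
  have hA := ht.abs_sqrt_two_mul_lt hr he
  have hA' := hA.le.trans ht.A₁_le
  have hD := h.hillDichotomy_of_mem hp ht hA hκ one_ne_zero
  have hT : 2 * π / (π / phaseTime (deriv g) √(2 * e) π) =
      1 * phaseTime (deriv g) √(2 * e) (2 * π) := by
    have := hp.phaseTime_pi_pos hA'
    rw [hp.phaseTime_two_pi hA']
    field_simp
  rw [(hQ e he).1, (hQ e he).2, hT, isStableMode_iff hN, hasPeriodicPerturbation_iff hN]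
  refine ⟨hD.stable, fun hneg hst => ?_, ?_, fun heq => ?_⟩
  · obtain ⟨η, hη, hunb⟩ := hD.unstable hneg
    exact hunb (hst η hη)
  · rintro ⟨η, hne, hη, hper⟩
    exact hD.periodic η hη hne hper
  · obtain ⟨h1, h2, -, h4⟩ := hD.even heq
    exact ⟨_, h1, h2, h4⟩

/-- For `γ < 0` the transition value increases with the energy and passes the fixed coupling exactly
at `E`, where `κ - κs` turns from positive to negative. -/
theorem tangentBifurcation_of_neg (h : IsEnergyChart V g R s)
    (hp : IsPhaseDensity (deriv g) (deriv (deriv g)) (R / 2) L)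
    (ht : IsTransitionParam g R n γ A₁ d Λ κs F) (hr : r ≤ A₁ ^ 2 / 2)
    (hQ : ∀ ε ∈ Ioo 0 r, Q ε = modeOrbit g √(2 * ε) ∧ ω ε = π / phaseTime (deriv g) √(2 * ε) π)
    (hγ : γ < 0) (hN : 2 ≤ N) (hκ : |couplingParam W N l| ≤ d)
    (hκ0 : 0 < couplingParam W N l) {E : ℝ} (hE : E ∈ Ioo 0 r)
    (hκE : κs √(2 * E) = couplingParam W N l) {e : ℝ} (he : e ∈ Ioo 0 r) :
    (IsTangentBifurcationEnergy V W N l Q ω e ↔ e = E) ∧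
    (e < E → IsStableMode V W N l (Q e)) ∧ (E < e → ¬ IsStableMode V W N l (Q e)) := by
  have hmono := ht.strictMonoOn_energy hr hγ
  have hst : ∀ e ∈ Ioo 0 r, e < E → IsStableMode V W N l (Q e) := fun e he heE => by
    have := hmono he hE heE
    simp only [hκE] at this
    exact (h.mode_dichotomy hp ht hr hQ hN hκ he).1 (mul_pos hκ0 (by linarith))
  have hun : ∀ e ∈ Ioo 0 r, E < e → ¬ IsStableMode V W N l (Q e) := fun e he heE => by
    have := hmono hE he heE
    simp only [hκE] at this
    exact (h.mode_dichotomy hp ht hr hQ hN hκ he).2.1 (mul_neg_of_pos_of_neg hκ0 (by linarith))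
  refine ⟨⟨fun hT => ?_, ?_⟩, hst e he, hun e he⟩
  · have h1 := (h.mode_dichotomy hp ht hr hQ hN hκ he).2.2.1 hT.1
    have h2 := (mul_eq_zero.1 h1).resolve_left hκ0.ne'
    exact hmono.injOn he hE (show κs √(2 * e) = κs √(2 * E) by linarith)
  · rintro rfl
    refine ⟨(h.mode_dichotomy hp ht hr hQ hN hκ he).2.2.2 hκE.symm, ?_, ?_⟩
    · filter_upwards [Ioo_mem_nhdsLT he.1] with e' he'
      exact hst e' ⟨he'.1, he'.2.trans he.2⟩ he'.2
    · filter_upwards [Ioo_mem_nhdsGT he.2] with e' he'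
      exact hun e' ⟨he.1.trans he'.1, he'.2⟩ he'.1

/-- For `γ > 0` the transition value is negative while the coupling is positive, so `κ (κ - κs)` is
positive throughout. -/
theorem no_bifurcation_of_pos (h : IsEnergyChart V g R s)
    (hp : IsPhaseDensity (deriv g) (deriv (deriv g)) (R / 2) L)
    (ht : IsTransitionParam g R n γ A₁ d Λ κs F) (hr : r ≤ A₁ ^ 2 / 2)
    (hQ : ∀ ε ∈ Ioo 0 r, Q ε = modeOrbit g √(2 * ε) ∧ ω ε = π / phaseTime (deriv g) √(2 * ε) π)
    (hγ : 0 < γ) (hN : 2 ≤ N) (hκ : |couplingParam W N l| ≤ d)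
    (hκ0 : 0 < couplingParam W N l) {e : ℝ} (he : e ∈ Ioo 0 r) :
    ¬ HasPeriodicPerturbation V W N l (Q e) (2 * π / ω e) ∧ IsStableMode V W N l (Q e) := by
  have h1 := ht.sqrt_two_mul_mem hr he
  have h2 : κs √(2 * e) < 0 := by
    have := ht.sign _ h1.1 h1.2
    by_contra! h3
    nlinarith
  have h3 : 0 < couplingParam W N l * (couplingParam W N l - κs √(2 * e)) :=
    mul_pos hκ0 (by linarith)
  have hD := h.mode_dichotomy hp ht hr hQ hN hκ he
  exact ⟨fun hP => h3.ne' (hD.2.2.1 hP), hD.1 h3⟩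

end IsEnergyChart

theorem leadingOrder_one {v₂ v₃ v₄ γ : ℝ} (hv : 0 < v₂) (hγ : γ ≠ 0)
    (h : γ = 3 * v₄ / (2 * v₂) - 5 * v₃ ^ 2 / (3 * v₂ ^ 2)) (κ : ℝ) :
    -2 * κ / γ = 12 * κ * v₂ ^ 2 / (10 * v₃ ^ 2 - 9 * v₂ * v₄) := by
  have h1 : 10 * v₃ ^ 2 - 9 * v₂ * v₄ = -6 * v₂ ^ 2 * γ := by
    rw [h]; field_simp; ring
  rw [h1]; field_simp; ring

end

/-! ### Assembly of the main theorem. -/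

theorem mainTheorem3 (V : ℝ → ℝ) (hV : IsPotential V) :
    (∃ (ε₀ : ℝ) (Q : ℝ → ℝ → ℝ) (ω : ℝ → ℝ), IsInPhaseMode V ε₀ Q ω) ∧
    ∀ (ε₀ : ℝ) (Q : ℝ → ℝ → ℝ) (ω : ℝ → ℝ) (n : ℕ) (γ : ℝ),
      IsInPhaseMode V ε₀ Q ω → IsIsochronousUpTo V ω n γ →
      -- the symmetric transition curve
      (∃ T₂ₙ : ℝ,
        (fun X : ℝ => scaledPeriod V ω X - (1 + T₂ₙ * X ^ (2 * n)))
          =o[𝓝[>] 0] (fun X : ℝ => X ^ (2 * n)) ∧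
        γ = -2 * potCoeff V 2 * (2 / potCoeff V 2) ^ n * T₂ₙ ∧
        ∃ (X₀ δ₀ : ℝ) (Δs : ℝ → ℝ),
          IsSymmetricTransitionCurve V Q ω X₀ δ₀ Δs ∧
          (fun X : ℝ => Δs X - (-4 * (n : ℝ) * T₂ₙ * X ^ (2 * n)))
            =o[𝓝[>] 0] (fun X : ℝ => X ^ (2 * n))) ∧
      -- the tangent bifurcation energy
      (∃ r κ₀ : ℝ, 0 < r ∧ r ≤ ε₀ ∧ 0 < κ₀ ∧
        (∀ (W : ℝ → ℝ) (N : ℕ), IsPotential W → Even N → 2 ≤ N → ∀ e ∈ Set.Ioo 0 r,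
          IsLatticeMotion V W N (fun _ => Q e) ∧
          ∀ t, latticeEnergy V W N (fun _ => Q e) t = (N : ℝ) * e) ∧
        (γ < 0 → ∃ E : ℝ → ℝ,
          E ~[𝓝[>] 0] (fun κ : ℝ => (-2 * κ / ((n : ℝ) * γ)) ^ (1 / (n : ℝ))) ∧
          StrictMonoOn E (Set.Ioo 0 κ₀) ∧
          ∀ (W : ℝ → ℝ) (N : ℕ) (l : ℤ), IsPotential W → Even N → 2 ≤ N → ¬ (N : ℤ) ∣ l →
            couplingParam W N l < κ₀ →
            E (couplingParam W N l) ∈ Set.Ioo 0 r ∧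
            ∀ e ∈ Set.Ioo 0 r,
              (IsTangentBifurcationEnergy V W N l Q ω e ↔ e = E (couplingParam W N l)) ∧
              (e < E (couplingParam W N l) → IsStableMode V W N l (Q e)) ∧
              (E (couplingParam W N l) < e → ¬ IsStableMode V W N l (Q e))) ∧
        (0 < γ →
          ∀ (W : ℝ → ℝ) (N : ℕ) (l : ℤ), IsPotential W → Even N → 2 ≤ N → ¬ (N : ℤ) ∣ l →
            couplingParam W N l < κ₀ →
            ∀ e ∈ Set.Ioo 0 r,
              ¬ HasPeriodicPerturbation V W N l (Q e) (2 * π / ω e) ∧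
              ¬ IsTangentBifurcationEnergy V W N l Q ω e ∧
              IsStableMode V W N l (Q e))) ∧
      -- the case `n = 1`
      (n = 1 →
        γ = 3 * potCoeff V 4 / (2 * potCoeff V 2)
            - 5 * potCoeff V 3 ^ 2 / (3 * potCoeff V 2 ^ 2) ∧
        ∀ κ : ℝ, (-2 * κ / ((n : ℝ) * γ)) ^ (1 / (n : ℝ))
          = 12 * κ * potCoeff V 2 ^ 2
            / (10 * potCoeff V 3 ^ 2 - 9 * potCoeff V 2 * potCoeff V 4)) := by
  obtain ⟨g, R, s, h⟩ := hV.exists_chart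
  obtain ⟨L, hp⟩ := h.exists_phaseDensity
  have hv := hV.potCoeff_two_pos
  refine ⟨⟨_, _, _, h.exists_mode hp⟩, fun ε₀ Q ω n γ hmode ⟨hn, hγ, hiso⟩ => ?_⟩
  obtain ⟨r₀, hr₀, hr₀ε, -, hQ⟩ := h.mode_unique hp hV hmode
  have hω : ∀ ε ∈ Ioo 0 r₀, ω ε = π / phaseTime (deriv g) √(2 * ε) π := fun ε hε => (hQ ε hε).2
  obtain ⟨A₁, d, Λ, κs, F, ht⟩ := h.exists_transitionParam hp hn hγ hr₀ hω hiso
  have hA₁ := ht.A₁_pos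
  refine ⟨⟨-γ / (2 * potCoeff V 2) * (potCoeff V 2 / 2) ^ n,
    h.scaledPeriod_isLittleO hV hp hr₀ hω hiso, ?_, _, _, _,
    h.isSymmetricTransitionCurve hV hp hr₀ hQ ht, IsEnergyChart.transitionCurve_isLittleO hV ht⟩,
    ?_, ?_⟩
  · rw [div_pow, div_pow]; field_simp
  · set r := min r₀ (A₁ ^ 2 / 2) with hrdef
    have hr : 0 < r := by positivity
    have hrA : r ≤ A₁ ^ 2 / 2 := min_le_right _ _
    have hrr : ∀ {e}, e ∈ Ioo 0 r → e ∈ Ioo 0 r₀ := fun he =>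
      ⟨he.1, he.2.trans_le (min_le_left _ _)⟩
    have hrε : r ≤ ε₀ := (min_le_left _ _).trans hr₀ε
    have hQr : ∀ ε ∈ Ioo 0 r, Q ε = modeOrbit g √(2 * ε) ∧
        ω ε = π / phaseTime (deriv g) √(2 * ε) π := fun ε hε => hQ ε (hrr hε)
    have hhalf : r / 2 ∈ Ioo 0 r := ⟨by linarith, by linarith⟩
    have h2 : 2 * (r / 2) = r := by ring
    have hrA₁ := ht.sqrt_two_mul_mem hrA hhalf
    have hmem := ht.mem _ (ht.abs_sqrt_two_mul_lt hrA hhalf)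
    rw [h2] at hrA₁ hmem
    have hsign := ht.sign _ hrA₁.1 hrA₁.2
    have hκd : ∀ {κ : ℝ}, 0 < κ → κ < |κs √r| → |κ| ≤ d := fun h0 hκ => by
      rw [abs_of_pos h0]; exact (hκ.trans hmem).le
    -- The coupling bound is the transition value at energy `r / 2`, positive in absolute value for
    -- either sign of `γ` and below `d`. It is built from `V` and the mode only.
    refine ⟨r, |κs √r|, hr, hrε, abs_pos.2 fun h0 => ?_, fun W N hW _ _ e he => ?_,
      fun hneg => ?_, fun hpos W N l hW _ hN hl hκ e he => ?_⟩
    · rw [h0, mul_zero] at hsign; exact hsign.false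
    · have heε : e ∈ Ioo 0 ε₀ := ⟨he.1, he.2.trans_le hrε⟩
      exact ⟨isLatticeMotion_const hW N (hmode.motion e heε),
        latticeEnergy_const hW N (hmode.energy e heε)⟩
    · have hK : 0 < κs √r := pos_of_mul_pos_right hsign (by linarith)
      rw [abs_of_pos hK] at hκd ⊢
      -- `E` is the inverse of the energy-to-transition-value map, with the default value `0`
      -- outside its range; it is fixed before `W`, `N` and `l` enter, so it cannot depend on them.
      have hex : ∀ κ, ∃ e, κ ∈ Ioo 0 (κs √r) → e ∈ Ioo 0 r ∧ κs √(2 * e) = κ := fun κ => by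
        by_cases hκ : κ ∈ Ioo 0 (κs √r)
        · obtain ⟨e, he⟩ := ht.exists_energy_eq hr hrA hκ
          exact ⟨e, fun _ => he⟩
        · exact ⟨0, fun h0 => absurd h0 hκ⟩
      choose E hE using hex
      refine ⟨E, ht.isEquivalent_energy hn hr hrA hneg hK hE, fun a ha b hb hab => ?_,
        fun W N l hW _ hN hl hκ => ?_⟩
      · rw [← (ht.strictMonoOn_energy hrA hneg).lt_iff_lt (hE a ha).1 (hE b hb).1]
        simpa only [(hE a ha).2, (hE b hb).2] using hab
      · have hκ0 := couplingParam_pos hW hN hl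
        obtain ⟨h3, h4⟩ := hE _ ⟨hκ0, hκ⟩
        exact ⟨h3, fun e he => h.tangentBifurcation_of_neg hp ht hrA hQr hneg hN
          (hκd hκ0 hκ) hκ0 h3 h4 he⟩
    · have hκ0 := couplingParam_pos hW hN hl
      obtain ⟨h3, h4⟩ := h.no_bifurcation_of_pos hp ht hrA hQr hpos hN (hκd hκ0 hκ) hκ0 he
      exact ⟨h3, fun hT => h3 hT.1, h4⟩
  · rintro rfl
    have hγ1 := h.gamma_one hp hr₀ hω hiso
    refine ⟨hγ1, fun κ => ?_⟩
    rw [Nat.cast_one, one_mul, div_one, rpow_one]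
    exact leadingOrder_one hv hγ hγ1 κ
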